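/- For a real polynomial $P$ let $\|P\|=\max_{-1\le x\le 1}|P(x)|$. For $s\in\mathbb R$, Zolotarev's first problem in degree $7$ asks for a polynomial of least norm $\|\cdot\|$ among all $x^7-7s\,x^6+a_5x^5+\dots+a_1x+a_0$ with $a_0,\dots,a_5\in\mathbb R$. If $s>\tan^2(\pi/14)$, a solution $\widetilde Z$ is called a monic septic proper Zolotarev polynomial (for $s$), and $\widetilde Z/\|\widetilde Z\|$ a normalized septic proper Zolotarev polynomial (for $s$). Let $\theta=-27.963755\ldots$ be the smallest real root of $x^3+27x^2-93x-1847$, let $I_7=(\theta,-13)$, and for $t\in I_7$ put $\omega=\omega(t)=\sqrt{3(506+75t-t^3)}$, $q=q(t)=2^{14}\,3^3(1+t)^{12}$ and $$Z_{7,t}(x)=\sum_{k=0}^7 b_{k,7}(t)x^k=\frac1q\Big((p_{01}+\omega p_{02})-\sqrt{p_{11}+\omega p_{12}}\,x+(p_{21}+\omega p_{22})x^2+\sqrt{p_{31}+\omega p_{32}}\,x^3+(p_{41}+\omega p_{42})x^4-\sqrt{p_{51}+\omega p_{52}}\,x^5+(p_{61}+\omega p_{62})x^6+\sqrt{p_{71}+\omega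 p_{72}}\,x^7\Big),$$ where the polynomials $p_{kj}=p_{kj}(t)$ are those listed below. Then the $Z_{7,t}$, $t\in I_7$, parametrize the normalized septic proper Zolotarev polynomials: 1. For every $t\in I_7$ all radicands above are nonnegative, $b_{7,7}(t)>0$ and $\|Z_{7,t}\|=1$. Put $a_{k,7}(t)=b_{k,7}(t)/b_{7,7}(t)$ for $0\le k\le 7$, and $s(t)=-a_{6,7}(t)/7$. Then $s(t)>\tan^2(\pi/14)$, the polynomial $Z_{7,t}$ is the one and only normalized septic proper Zolotarev polynomial for $s(t)$, and $\widetilde Z_{7,t}(x)=\sum_{k=0}^7a_{k,7}(t)x^k$ is the one and only monic one. 2. The map $t\mapsto s(t)$ is a bijection of $I_7$ onto $(\tan^2(\pi/14),\infty)$. 3. For every real $x$, with $T_n$ the Chebyshev polynomials of the first kind, $$\lim_{t\to-13^-}Z_{7,t}(x)=-T_6(x)=1-18x^2+48x^4-32x^6,$$ $$\lim_{t\to\theta^+}Z_{7,t}(x)=T_7(y)=-7y+56y^3-112y^5+64y^7,\qquad y=(1+x)\cos^2(\pi/14)-1.$$ The polynomials $p_{kj}$ are $$p_{01}=-18763256064938069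 - 14792872686537861 t - 4057867882494249 t^2 - 256473877330753 t^3 + 85285038707343 t^4 + 17823637386255 t^5 + 692357704507 t^6 - 127085232717 t^7 - 14780540079 t^8 - 560972063 t^9 - 31101579 t^{10} - 2597811 t^{11} + 82613 t^{12} - 1323 t^{13} + 57 t^{14} + t^{15},$$ $$p_{02}=-2 (-11 + t) (13 + t) (-1674587596733 - 1209041071723 t - 302152954691 t^2 - 21722362269 t^3 + 3705247230 t^4 + 789592530 t^5 + 56234874 t^6 + 3485670 t^7 + 365007 t^8 + 23113 t^9 + 953 t^{10} + 7 t^{11}),$$ $$p_{11}=(-11 + t)^2 (13 + t) (452216947186296794781508787221 + 777864295951362656514677949267 t + 607534824156974545331687561835 t^2 + 288634496196055112144179788837 t^3 + 94921610624381795338201698150 t^4 + 23398676158988289024635179242 t^5 + 4516301732554082896075701906 t^6 + 670693737388662494219775918 t^7 + 65114539902315732706516167 t^8 + 225857740971173605970001 t^9 - 1430942150712305946880479 t^{10} - 342406310658223828546833 t^{11} - 50591510405201802666684 t^{12} - 5031713916356520207588 t^{13} - 245445214348728475284 t^{14} + 18666155444026029204 t^{15} + 5518191822155449683 t^{16} +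 667345379819561157 t^{17} + 56579749561878525 t^{18} + 3879945477820083 t^{19} + 222845520949494 t^{20} + 10128182363994 t^{21} + 372786923490 t^{22} + 14225061342 t^{23} + 269308977 t^{24} + 2533431 t^{25} + 12183 t^{26} + 25 t^{27}),$$ $$p_{12}=-4 (-11 + t) (13 + t) (31914659841429719306288181169 + 49622272083198674583533509976 t + 34282407163818360892131872011 t^2 + 14089140494250744184954719632 t^3 + 3939130934203140296373699118 t^4 + 816295770208132930522370528 t^5 + 128243247492098759194165618 t^6 + 13314328240910465891671856 t^7 + 128141672346772035888475 t^8 - 286794878594776251702280 t^9 - 69849141585341704716287 t^{10} - 10401588386734438049632 t^{11} - 1051853965102136706572 t^{12} - 44866622100154016896 t^{13} + 7156442882520008620 t^{14} + 1751453046589473632 t^{15} + 198334297114129879 t^{16} + 15312353847501512 t^{17} + 913407761253853 t^{18} + 43228054413008 t^{19} + 1867714065406 t^{20} + 77464313504 t^{21} + 424793026 t^{22} + 97097840 t^{23} + 2479357 t^{24} + 20456 t^{25} + 55 t^{26}),$$ $$p_{21}=3 (18693496205907553 + 14653197505814513 t + 3981810914612581 t^2 + 239053845556285 t^3 - 102939835099507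 t^4 - 25328343306323 t^5 - 1853461246959 t^6 + 107242836249 t^7 + 29544857619 t^8 + 2472362275 t^9 + 146645759 t^{10} + 4570855 t^{11} - 537665 t^{12} + 13055 t^{13} + 715 t^{14} + 3 t^{15}),$$ $$p_{22}=6(-11+t)(-21838212747157 - 17497718905404 t - 5120760089418 t^2 - 504642284812 t^3 + 58729363461 t^4 + 20582639496 t^5 + 2601849972 t^6 + 260190216 t^7 + 24607269 t^8 + 1916084 t^9 + 126006 t^{10} + 2820 t^{11} + 11 t^{12}),$$ $$p_{31}=(-11 + t)^2 (13 + t) (4067505216555761454939774893653 + 6987837642353627260453914645459 t + 5438613582037781367520396463019 t^2 + 2560707467679066258265342737957 t^3 + 824972899826967571738685701350 t^4 + 195202779101501586572821066218 t^5 + 35131305236199004729935240210 t^6 + 4678831943670682549788428718 t^7 + 361836187431226939045737351 t^8 - 20164101539468052079040559 t^9 - 13174289998662412173304863 t^{10} - 2713002595179009782526225 t^{11} - 370593851448133729776060 t^{12} - 34447522144717830870756 t^{13} - 1447965995249043223956 t^{14} + 171750733434992851092 t^{15} + 44014595143625089299 t^{16} + 5235351517006620741 t^{17} + 455693290860748989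 t^{18} + 34604751969519795 t^{19} + 2164988949830262 t^{20} + 86364631885914 t^{21} + 2806443018594 t^{22} + 191205136350 t^{23} + 833140593 t^{24} - 18388809 t^{25} - 108585 t^{26} + 25 t^{27}),$$ $$p_{32}=4 (-11 + t) (13 + t) (-287083238187382918159834379953 - 445801161270188409230824278008 t - 306728192538886372185457889323 t^2 - 124540340456986580024209236752 t^3 - 33754019007714977189198810542 t^4 - 6551380444197468706377349664 t^5 - 918445270855125642258035890 t^6 - 75504009528614463821485232 t^7 + 3790216746747400729507877 t^8 + 2726753925037134860883880 t^9 + 554883207716411782569503 t^{10} + 72654419716931233973344 t^{11} + 6402816324184929410828 t^{12} + 222919538823946521856 t^{13} - 45365822597641351468 t^{14} - 11428229964701074016 t^{15} - 1568015533264197079 t^{16} - 148747442138288168 t^{17} - 8894717908807357 t^{18} - 336458623759952 t^{19} - 23802738217342 t^{20} - 1386825048800 t^{21} + 41898906878 t^{22} - 3064255472 t^{23} - 52362109 t^{24} - 143240 t^{25} + 425 t^{26}),$$ $$p_{41}=-55871225142758423 - 43540681750709607 t - 11717614079999475 t^2 - 665505935839675 t^3 + 361155464423541 t^4 + 98101500744117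 t^5 + 8901143308057 t^6 - 283763308671 t^7 - 131298459093 t^8 - 12236812901 t^9 - 634905225 t^{10} + 4984959 t^{11} + 5484599 t^{12} - 90153 t^{13} - 5469 t^{14} - 5 t^{15},$$ $$p_{42}=2 (-11 + t) (65720348410115 + 52809871430820 t + 15313261582566 t^2 + 1273925478740 t^3 - 273249867411 t^4 - 81619243704 t^5 - 10990866156 t^6 - 1213822008 t^7 - 112375539 t^8 - 9007084 t^9 - 714138 t^{10} - 12060 t^{11} + 35 t^{12}),$$ $$p_{51}=9 (-11 + t)^2 (13 + t) (451683738573925104075654483397 + 775028304316495850519095857571 t + 601098380398696980859206188475 t^2 + 280438400343985227860396599637 t^3 + 88413801617548106639965501190 t^4 + 19995978992632195901029965642 t^5 + 3311133099437108231552511346 t^6 + 381643355735517005395779022 t^7 + 20320264324033151140865367 t^8 - 3195804458535397562311231 t^9 - 1143533730000698431197679 t^{10} - 199161415603964037521793 t^{11} - 24372543185825459073788 t^{12} - 2046716710595960850596 t^{13} - 54372780278781597012 t^{14} + 15828476336106803540 t^{15} + 2730101569863744803 t^{16} + 213625544957043957 t^{17} + 16273483271374381 t^{18} + 2177665019822083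 t^{19} + 170504391614358 t^{20} + 1407379805882 t^{21} - 64033877566 t^{22} + 34948495614 t^{23} - 280552415 t^{24} - 2994617 t^{25} - 3033 t^{26} + 9 t^{27}),$$ $$p_{52}=36 (-11 + t) (13 + t) (-31880883382920453164668056673 - 49442138480111650024519040920 t - 33876857431725516714538231899 t^2 - 13586828819760368667536109968 t^3 - 3564076460496389044892230862 t^4 - 641364123356694605499355488 t^5 - 76820427126193234239727954 t^6 - 4024537857983776624054576 t^7 + 721610167022215867925013 t^8 + 250695526123771611854152 t^9 + 42150204570837646184719 t^{10} + 4607435727083778525024 t^{11} + 285829921804590641228 t^{12} - 1218353702615312512 t^{13} - 2310870292391561964 t^{14} - 479326657450856288 t^{15} - 99660901007536295 t^{16} - 11197664464328328 t^{17} - 270797298387469 t^{18} + 23020663051568 t^{19} - 2954480013726 t^{20} - 221351668256 t^{21} + 23088702814 t^{22} - 709577328 t^{23} - 2352877 t^{24} + 17624 t^{25} + 57 t^{26}),$$ $$p_{61}=-(-11 + t)^2 (-153338781731665 - 146672852170183 t - 57053827731174 t^2 - 10853963116498 t^3 - 364563173779 t^4 + 353504395539 t^5 + 100621371036 t^6 +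 14639637108 t^7 + 1357232985 t^8 + 82116623 t^9 + 2086442 t^{10} - 122370 t^{11} - 3157 t^{12} + 5 t^{13}),$$ $$p_{62}=-2 (-11 + t) (21975348926173 + 17708836243740 t + 5088010797018 t^2 + 344542288492 t^3 - 123507628749 t^4 - 33841275336 t^5 - 4705962132 t^6 - 534799944 t^7 - 46784493 t^8 - 3924308 t^9 - 371622 t^{10} - 4644 t^{11} + 61 t^{12}),$$ $$p_{71}=(-11+t)^5(13+t) (-339168361039365519460069487 - 673770165671451476923579920 t - 624601585018296333977402028 t^2 - 361544324905454191834056976 t^3 - 147614051919387405233687790 t^4 - 45526903723214507531501616 t^5 - 11086126516765664128988252 t^6 - 2197894018386795481276848 t^7 - 362820760120106657958897 t^8 - 50767332334243984565152 t^9 - 6127600928703138323160 t^{10} - 650077861901582788512 t^{11} - 61158225664029403460 t^{12} - 5020585598717657952 t^{13} - 364251213557808792 t^{14} - 29139030508404832 t^{15} - 3029017347965889 t^{16} - 254576059234128 t^{17} - 7598948126588 t^{18} + 550936914864 t^{19} + 31892020818 t^{20} - 830153584 t^{21} + 4681716 t^{22} - 6384 t^{23} + t^{24}),$$ $$p_{72}=4(-11+t)^4(13+t)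 (23939066421797920012252547 + 43604945745949888884259555 t + 36595686922095182565230747 t^2 + 18937189808814759845550851 t^3 + 6829585752660013948505437 t^4 + 1838774116182807709355117 t^5 + 385867254213289689843597 t^6 + 64938062296917527124693 t^7 + 8939182382326190698494 t^8 + 1017640859072593780990 t^9 + 95200006411552224398 t^{10} + 7145677316358425566 t^{11} + 448416529340354362 t^{12} + 29699683025185562 t^{13} + 1131537557463418 t^{14} - 300028277805366 t^{15} - 48306393782385 t^{16} + 333976819119 t^{17} + 484360416551 t^{18} + 17604770671 t^{19} - 1059177895 t^{20} + 10971881 t^{21} - 30551 t^{22} + 17 t^{23}).$$ -/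

import Mathlib

open Polynomial Set Filter Topology

noncomputable section

namespace SepticZolotarev

/-! # Zolotarev's first problem -/

/-- The uniform norm of a real polynomial on `[-1, 1]`. -/
def uniformNorm (P : ℝ[X]) : ℝ := ‖P.toContinuousMapOn (Icc (-1 : ℝ) 1)‖

/-- The polynomials `x ^ n + (-n s) x ^ (n - 1) + a_{n-2} x ^ (n - 2) + ... + a_0` with arbitrary
real `a_0, ..., a_{n-2}` (for `n ≥ 2`). -/
def admissible (n : ℕ) (s : ℝ) : Set ℝ[X] :=
  {P | P.natDegree = n ∧ P.coeff n = 1 ∧ P.coeff (n - 1) = -(n * s)}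

/-- `P` solves Zolotarev's first problem for `n` and `s`: it has least uniform norm on `[-1, 1]`
among all admissible polynomials. -/
def IsMonicZolotarev (n : ℕ) (s : ℝ) (P : ℝ[X]) : Prop :=
  P ∈ admissible n s ∧ ∀ Q ∈ admissible n s, uniformNorm P ≤ uniformNorm Q

/-- The bound above which the solution of Zolotarev's first problem is called proper. -/
def properBound (n : ℕ) : ℝ := Real.tan (Real.pi / (2 * n)) ^ 2

/-- `P` is a monic proper Zolotarev polynomial of degree `n`, for the parameter `s`. -/
def IsMonicProperZolotarev (n : ℕ) (s : ℝ) (P : ℝ[X]) : Prop :=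
  properBound n < s ∧ IsMonicZolotarev n s P

/-- `Z` is a normalized proper Zolotarev polynomial of degree `n`, for the parameter `s`:
a monic proper one divided by its least deviation from zero. -/
def IsNormalizedProperZolotarev (n : ℕ) (s : ℝ) (Z : ℝ[X]) : Prop :=
  ∃ P, IsMonicProperZolotarev n s P ∧ Z = C (uniformNorm P)⁻¹ * P

/-! # The explicit coefficients in degree 7 -/

def p01 (t : ℝ) : ℝ :=
  -18763256064938069 - 14792872686537861 * t - 4057867882494249 * t^2 - 256473877330753 *
    t^3 + 85285038707343 * t^4 + 17823637386255 * t^5 + 692357704507 * t^6 - 127085232717 *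
    t^7 - 14780540079 * t^8 - 560972063 * t^9 - 31101579 * t^10 - 2597811 * t^11 + 82613 *
    t^12 - 1323 * t^13 + 57 * t^14 + t^15

def p02 (t : ℝ) : ℝ :=
  -2 * (-11 + t) * (13 + t) * (-1674587596733 - 1209041071723 * t - 302152954691 * t^2 -
    21722362269 * t^3 + 3705247230 * t^4 + 789592530 * t^5 + 56234874 * t^6 + 3485670 * t^7
    + 365007 * t^8 + 23113 * t^9 + 953 * t^10 + 7 * t^11)

def p11 (t : ℝ) : ℝ :=
  (-11 + t)^2 * (13 + t) * (452216947186296794781508787221 + 777864295951362656514677949267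
    * t + 607534824156974545331687561835 * t^2 + 288634496196055112144179788837 * t^3 +
    94921610624381795338201698150 * t^4 + 23398676158988289024635179242 * t^5 +
    4516301732554082896075701906 * t^6 + 670693737388662494219775918 * t^7 +
    65114539902315732706516167 * t^8 + 225857740971173605970001 * t^9 -
    1430942150712305946880479 * t^10 - 342406310658223828546833 * t^11 -
    50591510405201802666684 * t^12 - 5031713916356520207588 * t^13 - 245445214348728475284 *
    t^14 + 18666155444026029204 * t^15 + 5518191822155449683 * t^16 + 667345379819561157 *
    t^17 + 56579749561878525 * t^18 + 3879945477820083 * t^19 + 222845520949494 * t^20 +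
    10128182363994 * t^21 + 372786923490 * t^22 + 14225061342 * t^23 + 269308977 * t^24 +
    2533431 * t^25 + 12183 * t^26 + 25 * t^27)

def p12 (t : ℝ) : ℝ :=
  -4 * (-11 + t) * (13 + t) * (31914659841429719306288181169 + 49622272083198674583533509976
    * t + 34282407163818360892131872011 * t^2 + 14089140494250744184954719632 * t^3 +
    3939130934203140296373699118 * t^4 + 816295770208132930522370528 * t^5 +
    128243247492098759194165618 * t^6 + 13314328240910465891671856 * t^7 +
    128141672346772035888475 * t^8 - 286794878594776251702280 * t^9 -
    69849141585341704716287 * t^10 - 10401588386734438049632 * t^11 - 1051853965102136706572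
    * t^12 - 44866622100154016896 * t^13 + 7156442882520008620 * t^14 + 1751453046589473632
    * t^15 + 198334297114129879 * t^16 + 15312353847501512 * t^17 + 913407761253853 * t^18 +
    43228054413008 * t^19 + 1867714065406 * t^20 + 77464313504 * t^21 + 424793026 * t^22 +
    97097840 * t^23 + 2479357 * t^24 + 20456 * t^25 + 55 * t^26)

def p21 (t : ℝ) : ℝ :=
  3 * (18693496205907553 + 14653197505814513 * t + 3981810914612581 * t^2 + 239053845556285
    * t^3 - 102939835099507 * t^4 - 25328343306323 * t^5 - 1853461246959 * t^6 +
    107242836249 * t^7 + 29544857619 * t^8 + 2472362275 * t^9 + 146645759 * t^10 + 4570855 *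
    t^11 - 537665 * t^12 + 13055 * t^13 + 715 * t^14 + 3 * t^15)

def p22 (t : ℝ) : ℝ :=
  6 * (-11 + t) * (-21838212747157 - 17497718905404 * t - 5120760089418 * t^2 - 504642284812
    * t^3 + 58729363461 * t^4 + 20582639496 * t^5 + 2601849972 * t^6 + 260190216 * t^7 +
    24607269 * t^8 + 1916084 * t^9 + 126006 * t^10 + 2820 * t^11 + 11 * t^12)

def p31 (t : ℝ) : ℝ :=
  (-11 + t)^2 * (13 + t) * (4067505216555761454939774893653 +
    6987837642353627260453914645459 * t + 5438613582037781367520396463019 * t^2 +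
    2560707467679066258265342737957 * t^3 + 824972899826967571738685701350 * t^4 +
    195202779101501586572821066218 * t^5 + 35131305236199004729935240210 * t^6 +
    4678831943670682549788428718 * t^7 + 361836187431226939045737351 * t^8 -
    20164101539468052079040559 * t^9 - 13174289998662412173304863 * t^10 -
    2713002595179009782526225 * t^11 - 370593851448133729776060 * t^12 -
    34447522144717830870756 * t^13 - 1447965995249043223956 * t^14 + 171750733434992851092 *
    t^15 + 44014595143625089299 * t^16 + 5235351517006620741 * t^17 + 455693290860748989 *
    t^18 + 34604751969519795 * t^19 + 2164988949830262 * t^20 + 86364631885914 * t^21 +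
    2806443018594 * t^22 + 191205136350 * t^23 + 833140593 * t^24 - 18388809 * t^25 - 108585
    * t^26 + 25 * t^27)

def p32 (t : ℝ) : ℝ :=
  4 * (-11 + t) * (13 + t) * (-287083238187382918159834379953 -
    445801161270188409230824278008 * t - 306728192538886372185457889323 * t^2 -
    124540340456986580024209236752 * t^3 - 33754019007714977189198810542 * t^4 -
    6551380444197468706377349664 * t^5 - 918445270855125642258035890 * t^6 -
    75504009528614463821485232 * t^7 + 3790216746747400729507877 * t^8 +
    2726753925037134860883880 * t^9 + 554883207716411782569503 * t^10 +
    72654419716931233973344 * t^11 + 6402816324184929410828 * t^12 + 222919538823946521856 *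
    t^13 - 45365822597641351468 * t^14 - 11428229964701074016 * t^15 - 1568015533264197079 *
    t^16 - 148747442138288168 * t^17 - 8894717908807357 * t^18 - 336458623759952 * t^19 -
    23802738217342 * t^20 - 1386825048800 * t^21 + 41898906878 * t^22 - 3064255472 * t^23 -
    52362109 * t^24 - 143240 * t^25 + 425 * t^26)

def p41 (t : ℝ) : ℝ :=
  -55871225142758423 - 43540681750709607 * t - 11717614079999475 * t^2 - 665505935839675 *
    t^3 + 361155464423541 * t^4 + 98101500744117 * t^5 + 8901143308057 * t^6 - 283763308671
    * t^7 - 131298459093 * t^8 - 12236812901 * t^9 - 634905225 * t^10 + 4984959 * t^11 +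
    5484599 * t^12 - 90153 * t^13 - 5469 * t^14 - 5 * t^15

def p42 (t : ℝ) : ℝ :=
  2 * (-11 + t) * (65720348410115 + 52809871430820 * t + 15313261582566 * t^2 +
    1273925478740 * t^3 - 273249867411 * t^4 - 81619243704 * t^5 - 10990866156 * t^6 -
    1213822008 * t^7 - 112375539 * t^8 - 9007084 * t^9 - 714138 * t^10 - 12060 * t^11 + 35 *
    t^12)

def p51 (t : ℝ) : ℝ :=
  9 * (-11 + t)^2 * (13 + t) * (451683738573925104075654483397 +
    775028304316495850519095857571 * t + 601098380398696980859206188475 * t^2 +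
    280438400343985227860396599637 * t^3 + 88413801617548106639965501190 * t^4 +
    19995978992632195901029965642 * t^5 + 3311133099437108231552511346 * t^6 +
    381643355735517005395779022 * t^7 + 20320264324033151140865367 * t^8 -
    3195804458535397562311231 * t^9 - 1143533730000698431197679 * t^10 -
    199161415603964037521793 * t^11 - 24372543185825459073788 * t^12 -
    2046716710595960850596 * t^13 - 54372780278781597012 * t^14 + 15828476336106803540 *
    t^15 + 2730101569863744803 * t^16 + 213625544957043957 * t^17 + 16273483271374381 * t^18
    + 2177665019822083 * t^19 + 170504391614358 * t^20 + 1407379805882 * t^21 - 64033877566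
    * t^22 + 34948495614 * t^23 - 280552415 * t^24 - 2994617 * t^25 - 3033 * t^26 + 9 *
    t^27)

def p52 (t : ℝ) : ℝ :=
  36 * (-11 + t) * (13 + t) * (-31880883382920453164668056673 -
    49442138480111650024519040920 * t - 33876857431725516714538231899 * t^2 -
    13586828819760368667536109968 * t^3 - 3564076460496389044892230862 * t^4 -
    641364123356694605499355488 * t^5 - 76820427126193234239727954 * t^6 -
    4024537857983776624054576 * t^7 + 721610167022215867925013 * t^8 +
    250695526123771611854152 * t^9 + 42150204570837646184719 * t^10 + 4607435727083778525024
    * t^11 + 285829921804590641228 * t^12 - 1218353702615312512 * t^13 - 2310870292391561964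
    * t^14 - 479326657450856288 * t^15 - 99660901007536295 * t^16 - 11197664464328328 * t^17
    - 270797298387469 * t^18 + 23020663051568 * t^19 - 2954480013726 * t^20 - 221351668256 *
    t^21 + 23088702814 * t^22 - 709577328 * t^23 - 2352877 * t^24 + 17624 * t^25 + 57 *
    t^26)

def p61 (t : ℝ) : ℝ :=
  -(-11 + t)^2 * (-153338781731665 - 146672852170183 * t - 57053827731174 * t^2 -
    10853963116498 * t^3 - 364563173779 * t^4 + 353504395539 * t^5 + 100621371036 * t^6 +
    14639637108 * t^7 + 1357232985 * t^8 + 82116623 * t^9 + 2086442 * t^10 - 122370 * t^11 -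
    3157 * t^12 + 5 * t^13)

def p62 (t : ℝ) : ℝ :=
  -2 * (-11 + t) * (21975348926173 + 17708836243740 * t + 5088010797018 * t^2 + 344542288492
    * t^3 - 123507628749 * t^4 - 33841275336 * t^5 - 4705962132 * t^6 - 534799944 * t^7 -
    46784493 * t^8 - 3924308 * t^9 - 371622 * t^10 - 4644 * t^11 + 61 * t^12)

def p71 (t : ℝ) : ℝ :=
  (-11 + t)^5 * (13 + t) * (-339168361039365519460069487 - 673770165671451476923579920 * t -
    624601585018296333977402028 * t^2 - 361544324905454191834056976 * t^3 -
    147614051919387405233687790 * t^4 - 45526903723214507531501616 * t^5 -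
    11086126516765664128988252 * t^6 - 2197894018386795481276848 * t^7 -
    362820760120106657958897 * t^8 - 50767332334243984565152 * t^9 - 6127600928703138323160
    * t^10 - 650077861901582788512 * t^11 - 61158225664029403460 * t^12 -
    5020585598717657952 * t^13 - 364251213557808792 * t^14 - 29139030508404832 * t^15 -
    3029017347965889 * t^16 - 254576059234128 * t^17 - 7598948126588 * t^18 + 550936914864 *
    t^19 + 31892020818 * t^20 - 830153584 * t^21 + 4681716 * t^22 - 6384 * t^23 + t^24)

def p72 (t : ℝ) : ℝ :=
  4 * (-11 + t)^4 * (13 + t) * (23939066421797920012252547 + 43604945745949888884259555 * t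
    + 36595686922095182565230747 * t^2 + 18937189808814759845550851 * t^3 +
    6829585752660013948505437 * t^4 + 1838774116182807709355117 * t^5 +
    385867254213289689843597 * t^6 + 64938062296917527124693 * t^7 + 8939182382326190698494
    * t^8 + 1017640859072593780990 * t^9 + 95200006411552224398 * t^10 + 7145677316358425566
    * t^11 + 448416529340354362 * t^12 + 29699683025185562 * t^13 + 1131537557463418 * t^14
    - 300028277805366 * t^15 - 48306393782385 * t^16 + 333976819119 * t^17 + 484360416551 *
    t^18 + 17604770671 * t^19 - 1059177895 * t^20 + 10971881 * t^21 - 30551 * t^22 + 17 *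
    t^23)

def ω (t : ℝ) : ℝ := √(3 * (506 + 75 * t - t ^ 3))

def q (t : ℝ) : ℝ := 2 ^ 14 * 3 ^ 3 * (1 + t) ^ 12

/-- The coefficient of `x ^ k` in the normalized septic polynomial. -/
def b : ℕ → ℝ → ℝ
  | 0, t => (p01 t + ω t * p02 t) / q t
  | 1, t => -√(p11 t + ω t * p12 t) / q t
  | 2, t => (p21 t + ω t * p22 t) / q t
  | 3, t => √(p31 t + ω t * p32 t) / q t
  | 4, t => (p41 t + ω t * p42 t) / q t
  | 5, t => -√(p51 t + ω t * p52 t) / q t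
  | 6, t => (p61 t + ω t * p62 t) / q t
  | 7, t => √(p71 t + ω t * p72 t) / q t
  | _, _ => 0

/-- The coefficient of `x ^ k` in the monic septic polynomial. -/
def a (k : ℕ) (t : ℝ) : ℝ := b k t / b 7 t

/-- The normalized septic polynomial with parameter `t`. -/
def Z7 (t : ℝ) : ℝ[X] := ∑ k ∈ Finset.range 8, C (b k t) * X ^ k

/-- The monic septic polynomial with parameter `t`. -/
def monicZ7 (t : ℝ) : ℝ[X] := ∑ k ∈ Finset.range 8, C (a k t) * X ^ k

/-- The number `s` for which the second leading coefficient of the monic septic polynomial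
is `-7 s`. -/
def s7 (t : ℝ) : ℝ := -a 6 t / 7

end SepticZolotarev

end

/-! # The curve `Y ^ 2 = (v - 1) * Y + v ^ 3` and the polynomials living on it -/

noncomputable section

namespace ZolotarevCurve

/-! Put v = -(t+1)/12 and Y = (ω/36 + v - 1)/2. Then (v, Y) runs through a branch of the cubic curve
Y² = (v-1)Y + v³ with v > 1 and Y > 0, and the coefficients of `Z7 t` become functions on that
curve, the odd ones up to one common square root. Scaling the variable by U = `scale t`, with U² =
`rho`, removes this root and turns `Z7 t` into `curvePoly` (`eval_Z7_eq_curvePoly`).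

The theorem rests on a Pell-type identity. With a cubic C and a quadratic Q over the curve, the
scaled polynomial is at once 1 + lead·(y-β)·C² and -1 + lead·(y²-U²)(y-α)·Q²
(`scaled_pell_identity`, `curvePoly_eq`), and its derivative is lead·C·Q·(7y-γ₇)
(`hasDerivAt_curvePoly`). If U < α, then the bound by 1 on [-U, U] can be read off from the two
forms. The values at ±U and at the two roots of Q are -1, and Rolle's theorem puts a root of C,
where the value is 1, into each of the three gaps (`exists_alternation`). Seven alternation points
suffice for optimality and uniqueness, because two admissible polynomials share their two top
coefficients (`isMonicZolotarev_iff_of_alternating`). On the branch, U < α follows from v³ - 2v² - v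
+ 1 < 0, which in terms of t is exactly the condition t > θ.

The number s determines the optimal polynomial, hence its norm and `Z7 t`, hence the points α/U and
β/U where the graph leaves the strip between -1 and 1. The ratio (β-α)/(β+α) is strictly monotone in
v, so s determines t (`injOn_s7`). A continuous injective function on an interval is strictly
monotone, so the bijection and the bound s > tan²(π/14) follow from the limits of s at the two ends.

At t = -13 the radicands of the odd coefficients vanish and -T₆ remains. At t = θ one has v = k² - 1
with k = 2cos(π/7), and both factors of the first form become those of T₇ - 1 = (y-1)(8y³+4y²-4y-1)²
in an affine variable. Continuity of the coefficients gives both limits. -/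

/-- The square of the common irrationality of the odd coefficients. -/
def radSq (v Y : ℝ) : ℝ := (v^2 - 1) * (v^2 * (v - 1) + (3 * v + 1) * Y)

/-- The factor between the common irrationality and the scale `√rho`. -/
def kappa (v Y : ℝ) : ℝ := (v^2 + Y - v + 1) / v

/-- The square of the scale. -/
def rho (v Y : ℝ) : ℝ :=
  (1 - 4 * v + 2 * v^2 + v^3 - 7 * v^4 + 2 * v^5 + 4 * v^6 + v^7) +
      (1 - 3 * v - 2 * v^2 - 2 * v^3 + v^4 + 5 * v^5) * Y

/-- The leading coefficient of the scaled polynomial. -/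
def lead (v Y : ℝ) : ℝ :=
  (Y * (v^2 - v + 1) - v^3) / (256 * (v + 1)^3 * (v - 1)^5 * v^17)

/-- The scaled third end point of the inverse image of `[-1, 1]`. -/
def alpha (v Y : ℝ) : ℝ :=
  (1 - 2 * v - v^2 + 6 * v^3) +
      (1 - v^2) * Y

/-- The scaled last end point of the inverse image of `[-1, 1]`. -/
def beta (v Y : ℝ) : ℝ :=
  (-1 + 2 * v + v^2 + 2 * v^3) +
      (-1 + v^2) * Y

/-- Seven times the scaled critical point outside of `[-1, 1]`. -/
def gamma7 (v Y : ℝ) : ℝ :=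
  (-1 + 2 * v + v^2 + 14 * v^3) +
      (-1 + 4 * v + 5 * v^2) * Y

/-- A coefficient of the cubic `cubicFactor`. -/
def c₂ (v Y : ℝ) : ℝ :=
  (-1 + 2 * v + v^2 - 6 * v^3) +
      (-1 + 2 * v + 3 * v^2) * Y

/-- A coefficient of the cubic `cubicFactor`. -/
def c₁ (v Y : ℝ) : ℝ :=
  (-1 + 4 * v - 2 * v^2 - v^3 + 3 * v^4 - 2 * v^5 + 4 * v^6 + 3 * v^7) +
      (-1 + 3 * v + 2 * v^2 + 2 * v^3 - 5 * v^4 - 9 * v^5) * Y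

/-- A coefficient of the cubic `cubicFactor`. -/
def c₀ (v Y : ℝ) : ℝ :=
  (1 - 6 * v + 9 * v^2 + 8 * v^3 - 36 * v^4 + 20 * v^5 + 28 * v^6 - 32 * v^7 + 3 * v^8 + 10 *
      v^9 - 5 * v^10) +
      (1 - 5 * v + 4 * v^2 + 10 * v^3 - 22 * v^4 + 4 * v^5 + 20 * v^6 - 10 * v^7 - 3 * v^8 + v^9) *
          Y

/-- A coefficient of the quadratic `quadFactor`. -/
def b₁ (v Y : ℝ) : ℝ :=
  (-4 * v^3) +
      (2 * v + 2 * v^2) * Y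

/-- A coefficient of the quadratic `quadFactor`. -/
def b₀ (v Y : ℝ) : ℝ :=
  (-1 + 4 * v - 2 * v^2 - 5 * v^3 + 5 * v^4 + 4 * v^5 + 2 * v^6 + v^7) +
      (-1 + 3 * v - 4 * v^3 - 3 * v^4 - 3 * v^5) * Y

/-- The cubic vanishing at the points where the scaled polynomial touches `1`. -/
def cubicFactor (v Y y : ℝ) : ℝ := y^3 + c₂ v Y * y^2 + c₁ v Y * y + c₀ v Y

/-- The quadratic vanishing at the inner points where the scaled polynomial touches `-1`. -/
def quadFactor (v Y y : ℝ) : ℝ := y^2 + b₁ v Y * y + b₀ v Y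

/-- The scaled polynomial. -/
def curvePoly (v Y y : ℝ) : ℝ := 1 + lead v Y * ((y - beta v Y) * cubicFactor v Y y ^ 2)

/-! ### Products of the coefficients, reduced modulo the curve equation to the form A(v) + B(v)·Y -/

variable {v Y : ℝ}

theorem c₂_mul_c₂ (h : Y^2 = (v - 1) * Y + v^3) :
    c₂ v Y * c₂ v Y =
      (1 - 4 * v + 2 * v^2 + 17 * v^3 - 27 * v^4 - 14 * v^5 + 48 * v^6 + 9 * v^7) +
      (1 - 3 * v - 2 * v^2 + 14 * v^3 - 15 * v^4 - 27 * v^5) * Y := by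
  unfold c₂
  linear_combination (1 - 4 * v - 2 * v^2 + 12 * v^3 + 9 * v^4) * h

theorem c₂_mul_c₁ (h : Y^2 = (v - 1) * Y + v^3) :
    c₂ v Y * c₁ v Y =
      (1 - 6 * v + 9 * v^2 + 8 * v^3 - 36 * v^4 + 20 * v^5 + 12 * v^6 + 27 * v^8 - 54 * v^9 - 45
      * v^10) +
      (1 - 5 * v + 4 * v^2 + 10 * v^3 - 22 * v^4 + 4 * v^5 + 4 * v^6 + 14 * v^7 + 45 * v^8 + 9 *
      v^9) * Y := by
  unfold c₂ c₁
  linear_combination (1 - 5 * v + v^2 + 11 * v^3 + 15 * v^4 + 5 * v^5 - 33 * v^6 - 27 * v^7) * h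

theorem c₁_mul_c₁ (h : Y^2 = (v - 1) * Y + v^3) :
    c₁ v Y * c₁ v Y =
      (1 - 8 * v + 20 * v^2 - 13 * v^3 - 16 * v^4 + 37 * v^5 - 27 * v^6 + 54 * v^7 + 17 * v^8 -
      102 * v^9 - 34 * v^10 - 9 * v^11 + 94 * v^12 + 105 * v^13 + 9 * v^14) +
      (1 - 7 * v + 13 * v^2 - v^3 - 12 * v^4 + 18 * v^5 + 2 * v^6 + 54 * v^7 - 31 * v^8 - 107 *
      v^9 + 17 * v^10 - 21 * v^11 - 54 * v^12) * Y := by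
  unfold c₁
  linear_combination (1 - 6 * v + 5 * v^2 + 8 * v^3 + 26 * v^4 - 4 * v^5 - 70 * v^6 - 56 * v^7 - 11
      * v^8 + 90 *
      v^9 + 81 * v^10) * h

theorem c₀_mul_c₂ (h : Y^2 = (v - 1) * Y + v^3) :
    c₀ v Y * c₂ v Y =
      (-1 + 8 * v - 20 * v^2 - 3 * v^3 + 104 * v^4 - 149 * v^5 - 89 * v^6 + 378 * v^7 - 177 * v^8
      - 282 * v^9 + 282 * v^10 + 25 * v^11 - 102 * v^12 + 23 * v^13 + 3 * v^14) +
      (-1 + 7 * v - 13 * v^2 - 15 * v^3 + 84 * v^4 - 58 * v^5 - 130 * v^6 + 194 * v^7 + 15 * v^8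
      - 157 * v^9 + 63 * v^10 + 29 * v^11 - 18 * v^12) * Y := by
  unfold c₀ c₂
  linear_combination (-1 + 7 * v - 11 * v^2 - 17 * v^3 + 54 * v^4 - 18 * v^5 - 78 * v^6 + 62 * v^7
      + 43 * v^8 -
      37 * v^9 - 7 * v^10 + 3 * v^11) * h

theorem c₀_mul_c₁ (h : Y^2 = (v - 1) * Y + v^3) :
    c₀ v Y * c₁ v Y =
      (-1 + 10 * v - 35 * v^2 + 38 * v^3 + 67 * v^4 - 226 * v^5 + 153 * v^6 + 170 * v^7 - 339 *
      v^8 + 222 * v^9 - 57 * v^10 - 182 * v^11 + 433 * v^12 - 174 * v^13 - 253 * v^14 + 166 *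
      v^15 + 32 * v^16 - 24 * v^17) +
      (-1 + 9 * v - 26 * v^2 + 13 * v^3 + 72 * v^4 - 135 * v^5 + 22 * v^6 + 117 * v^7 - 154 * v^8
      + 163 * v^9 + 18 * v^10 - 225 * v^11 + 144 * v^12 + 27 * v^13 - 78 * v^14 + 31 * v^15 + 3
      * v^16) * Y := by
  unfold c₀ c₁
  linear_combination (-1 + 8 * v - 17 * v^2 - 6 * v^3 + 45 * v^4 - 26 * v^5 - 7 * v^6 - 52 * v^7 +
      41 * v^8 +
      188 * v^9 - 159 * v^10 - 134 * v^11 + 107 * v^12 + 22 * v^13 - 9 * v^14) * h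

theorem c₀_mul_c₀ (h : Y^2 = (v - 1) * Y + v^3) :
    c₀ v Y * c₀ v Y =
      (1 - 12 * v + 54 * v^2 - 91 * v^3 - 97 * v^4 + 649 * v^5 - 788 * v^6 - 744 * v^7 + 2818 *
      v^8 - 1660 * v^9 - 2832 * v^10 + 4530 * v^11 - 466 * v^12 - 3570 * v^13 + 2500 * v^14 +
      640 * v^15 - 1379 * v^16 + 368 * v^17 + 170 * v^18 - 111 * v^19 + 19 * v^20 + v^21) +
      (1 - 11 * v + 43 * v^2 - 49 * v^3 - 136 * v^4 + 480 * v^5 - 292 * v^6 - 892 * v^7 + 1626 *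
      v^8 - 54 * v^9 - 2190 * v^10 + 1666 * v^11 + 800 * v^12 - 1608 * v^13 + 476 * v^14 + 436 *
      v^15 - 371 * v^16 + 41 * v^17 + 43 * v^18 - 9 * v^19) * Y := by
  unfold c₀
  linear_combination (1 - 10 * v + 33 * v^2 - 20 * v^3 - 128 * v^4 + 308 * v^5 - 76 * v^6 - 628 *
      v^7 + 818 *
      v^8 + 176 * v^9 - 1098 * v^10 + 548 * v^11 + 472 * v^12 - 468 * v^13 - 12 * v^14 + 100 *
      v^15 - 11 * v^16 - 6 * v^17 + v^18) * h

theorem b₁_mul_b₁ (h : Y^2 = (v - 1) * Y + v^3) :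
    b₁ v Y * b₁ v Y =
      (4 * v^5 + 24 * v^6 + 4 * v^7) +
      (-4 * v^2 - 4 * v^3 - 12 * v^4 - 12 * v^5) * Y := by
  unfold b₁
  linear_combination (4 * v^2 + 8 * v^3 + 4 * v^4) * h

theorem b₀_mul_b₁ (h : Y^2 = (v - 1) * Y + v^3) :
    b₀ v Y * b₁ v Y =
      (4 * v^3 - 18 * v^4 + 12 * v^5 + 26 * v^6 - 28 * v^7 - 30 * v^8 - 20 * v^9 - 10 * v^10) +
      (6 * v^3 - 12 * v^4 + 6 * v^5 + 32 * v^6 + 18 * v^7 + 12 * v^8 + 2 * v^9) * Y := by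
  unfold b₀ b₁
  linear_combination (-2 * v + 4 * v^2 + 6 * v^3 - 8 * v^4 - 14 * v^5 - 12 * v^6 - 6 * v^7) * h

theorem b₀_mul_b₀ (h : Y^2 = (v - 1) * Y + v^3) :
    b₀ v Y * b₀ v Y =
      (1 - 8 * v + 20 * v^2 - 5 * v^3 - 52 * v^4 + 61 * v^5 + 41 * v^6 - 70 * v^7 - 27 * v^8 + 14
      * v^9 + 50 * v^10 + 59 * v^11 + 30 * v^12 + 13 * v^13 + v^14) +
      (1 - 7 * v + 13 * v^2 + 7 * v^3 - 40 * v^4 + 14 * v^5 + 38 * v^6 - 14 * v^7 - 35 * v^8 - 55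
      * v^9 - 35 * v^10 - 9 * v^11 - 6 * v^12) * Y := by
  unfold b₀
  linear_combination (1 - 6 * v + 9 * v^2 + 8 * v^3 - 18 * v^4 - 12 * v^5 - 2 * v^6 + 24 * v^7 + 33
      * v^8 + 18 *
      v^9 + 9 * v^10) * h

/-- This and the following lemmas up to index 6 give the coefficients of (y-β)·C² in ascending
order, in reduced form. They serve both the Pell identity and the computation of the coefficients of
the septic. -/
theorem coeff_square_mul_linear₀ (h : Y^2 = (v - 1) * Y + v^3) :
    -(beta v Y * (c₀ v Y * c₀ v Y)) =
      (1 - 14 * v + 77 * v^2 - 188 * v^3 + 44 * v^4 + 868 * v^5 - 1845 * v^6 + 198 * v^7 + 4325 *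
      v^8 - 5132 * v^9 - 2214 * v^10 + 8136 * v^11 - 2536 * v^12 - 5320 * v^13 + 2766 * v^14 +
      3132 * v^15 - 1293 * v^16 - 2838 * v^17 + 1577 * v^18 + 1092 * v^19 - 1060 * v^20 + 148 *
      v^21 + 151 * v^22 - 82 * v^23 + 7 * v^24) +
      (1 - 13 * v + 64 * v^2 - 125 * v^3 - 69 * v^4 + 747 * v^5 - 1024 * v^6 - 693 * v^7 + 3058 *
      v^8 - 1666 * v^9 - 2920 * v^10 + 3502 * v^11 + 862 * v^12 - 2330 * v^13 - 424 * v^14 +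
      1334 * v^15 + 509 * v^16 - 1329 * v^17 + 200 * v^18 + 591 * v^19 - 265 * v^20 - 17 * v^21
      + 8 * v^22 - v^23) * Y := by
  rw [c₀_mul_c₀ h]
  unfold beta
  linear_combination (1 - 11 * v + 42 * v^2 - 38 * v^3 - 179 * v^4 + 529 * v^5 - 156 * v^6 - 1372 *
      v^7 + 1918 *
      v^8 + 838 * v^9 - 3816 * v^10 + 1720 * v^11 + 2990 * v^12 - 3274 * v^13 - 324 * v^14 +
      2044 * v^15 - 847 * v^16 - 395 * v^17 + 414 * v^18 - 50 * v^19 - 43 * v^20 + 9 * v^21) * h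

theorem coeff_square_mul_linear₁ (h : Y^2 = (v - 1) * Y + v^3) :
    c₀ v Y * c₀ v Y - 2 * beta v Y * (c₀ v Y * c₁ v Y) =
      (-1 + 12 * v - 54 * v^2 + 107 * v^3 - 67 * v^4 - 57 * v^5 + 144 * v^6 - 636 * v^7 + 1762 *
      v^8 - 912 * v^9 - 3332 * v^10 + 4954 * v^11 + 446 * v^12 - 4714 * v^13 + 1776 * v^14 + 852
      * v^15 - 273 * v^16 + 428 * v^17 - 454 * v^18 - 29 * v^19 + 53 * v^20 - 5 * v^21) +
      (-1 + 11 * v - 43 * v^2 + 65 * v^3 - 12 * v^4 - 36 * v^5 + 72 * v^6 - 576 * v^7 + 1218 *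
      v^8 + 226 * v^9 - 2654 * v^10 + 1746 * v^11 + 1252 * v^12 - 1988 * v^13 + 400 * v^14 + 408
      * v^15 - 25 * v^16 + 123 * v^17 - 207 * v^18 + 21 * v^19) * Y := by
  rw [c₀_mul_c₀ h, c₀_mul_c₁ h]
  unfold beta
  linear_combination (-2 + 18 * v - 50 * v^2 + 8 * v^3 + 196 * v^4 - 296 * v^5 - 100 * v^6 + 504 *
      v^7 - 352 *
      v^8 + 92 * v^9 + 344 * v^10 - 776 * v^11 + 252 * v^12 + 504 * v^13 - 444 * v^14 + 8 * v^15
      + 162 * v^16 - 62 * v^17 - 6 * v^18) * h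

theorem coeff_square_mul_linear₂ (h : Y^2 = (v - 1) * Y + v^3) :
    2 * (c₀ v Y * c₁ v Y) - beta v Y * (c₁ v Y * c₁ v Y + 2 * (c₀ v Y * c₂ v Y)) =
      (-3 + 30 * v - 105 * v^2 + 90 * v^3 + 375 * v^4 - 1050 * v^5 + 431 * v^6 + 1606 * v^7 -
      1975 * v^8 - 362 * v^9 + 1005 * v^10 + 214 * v^11 + 613 * v^12 - 934 * v^13 - 307 * v^14 +
      138 * v^15 - 290 * v^16 + 12 * v^17) +
      (-3 + 27 * v - 78 * v^2 + 15 * v^3 + 366 * v^4 - 629 * v^5 - 162 * v^6 + 1095 * v^7 - 588 *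
      v^8 - 375 * v^9 - 2 * v^10 + 117 * v^11 + 874 * v^12 - 175 * v^13 - 142 * v^14 + 181 *
      v^15 - 9 * v^16) * Y := by
  rw [c₀_mul_c₁ h, c₁_mul_c₁ h, c₀_mul_c₂ h]
  unfold beta
  linear_combination (-1 + 7 * v - 12 * v^2 - 38 * v^3 + 169 * v^4 - 67 * v^5 - 414 * v^6 + 540 *
      v^7 + 257 *
      v^8 - 863 * v^9 + 144 * v^10 + 458 * v^11 - 233 * v^12 - 37 * v^13 + 90 * v^14) * h

theorem coeff_square_mul_linear₃ (h : Y^2 = (v - 1) * Y + v^3) :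
    c₁ v Y * c₁ v Y + 2 * (c₀ v Y * c₂ v Y) - beta v Y * (2 * c₀ v Y + 2 * (c₂ v Y * c₁ v Y)) =
      (3 - 24 * v + 60 * v^2 - 39 * v^3 - 24 * v^4 + 15 * v^5 - 145 * v^6 + 690 * v^7 - 413 * v^8
      - 834 * v^9 + 666 * v^10 + 245 * v^11 + 178 * v^12 + 267 * v^13 - 5 * v^14) +
      (3 - 21 * v + 39 * v^2 - 3 * v^3 - 4 * v^4 - 10 * v^5 - 170 * v^6 + 514 * v^7 - 77 * v^8 -
      673 * v^9 - 61 * v^10 - 127 * v^11 - 50 * v^12) * Y := by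
  rw [c₁_mul_c₁ h, c₀_mul_c₂ h, c₂_mul_c₁ h]
  unfold beta c₀
  linear_combination (4 - 20 * v + 12 * v^2 + 60 * v^3 - 104 * v^4 - 24 * v^5 + 136 * v^6 - 8 * v^7
      + 36 * v^8 +
      12 * v^9 - 84 * v^10 - 20 * v^11) * h

theorem coeff_square_mul_linear₄ (h : Y^2 = (v - 1) * Y + v^3) :
    2 * c₀ v Y + 2 * (c₂ v Y * c₁ v Y) - beta v Y * (c₂ v Y * c₂ v Y + 2 * c₁ v Y) =
      (3 - 18 * v + 27 * v^2 + 48 * v^3 - 198 * v^4 + 96 * v^5 + 178 * v^6 - 128 * v^7 - 53 * v^8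
      - 190 * v^9 - 85 * v^10) +
      (3 - 15 * v + 12 * v^2 + 52 * v^3 - 134 * v^4 + 2 * v^5 + 116 * v^6 + 116 * v^7 + 163 * v^8
      + 5 * v^9) * Y := by
  rw [c₂_mul_c₁ h, c₂_mul_c₂ h]
  unfold beta c₀ c₁
  linear_combination (-1 + 3 * v + 3 * v^2 + 15 * v^3 - 27 * v^4 - 63 * v^5 + 25 * v^6 + 45 * v^7)
      * h

theorem coeff_square_mul_linear₅ (h : Y^2 = (v - 1) * Y + v^3) :
    c₂ v Y * c₂ v Y + 2 * c₁ v Y - 2 * beta v Y * c₂ v Y =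
      (-3 + 12 * v - 6 * v^2 - 3 * v^3 - 3 * v^4 - 2 * v^5 + 76 * v^6 + 9 * v^7) +
      (-3 + 9 * v + 2 * v^2 + 2 * v^3 - 39 * v^4 - 51 * v^5) * Y := by
  rw [c₂_mul_c₂ h]
  unfold beta c₁ c₂
  linear_combination (-2 + 4 * v + 8 * v^2 - 4 * v^3 - 6 * v^4) * h

theorem coeff_square_mul_linear₆  :
    2 * c₂ v Y - beta v Y =
      (-1 + 2 * v + v^2 - 14 * v^3) +
      (-1 + 4 * v + 5 * v^2) * Y := by
  unfold beta c₂
  ring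

/-- Likewise for the coefficients of (y-α)·Q², up to index 4. -/
theorem coeff_quad_square_mul_linear₀ (h : Y^2 = (v - 1) * Y + v^3) :
    -(alpha v Y * (b₀ v Y * b₀ v Y)) =
      (-1 + 10 * v - 35 * v^2 + 30 * v^3 + 117 * v^4 - 302 * v^5 + 45 * v^6 + 578 * v^7 - 445 *
      v^8 - 462 * v^9 + 399 * v^10 + 290 * v^11 + 95 * v^12 - 194 * v^13 - 345 * v^14 - 194 *
      v^15 - 86 * v^16 - 12 * v^17) +
      (-1 + 9 * v - 26 * v^2 + 5 * v^3 + 114 * v^4 - 171 * v^5 - 114 * v^6 + 369 * v^7 - 16 * v^8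
      - 309 * v^9 - 62 * v^10 + 95 * v^11 + 286 * v^12 + 215 * v^13 + 74 * v^14 + 43 * v^15 +
      v^16) * Y := by
  rw [b₀_mul_b₀ h]
  unfold alpha
  linear_combination (-1 + 7 * v - 12 * v^2 - 14 * v^3 + 53 * v^4 - 7 * v^5 - 78 * v^6 + 28 * v^7 +
      73 * v^8 +
      41 * v^9 - 46 * v^11 - 29 * v^12 - 9 * v^13 - 6 * v^14) * h

theorem coeff_quad_square_mul_linear₁ (h : Y^2 = (v - 1) * Y + v^3) :
    b₀ v Y * b₀ v Y - 2 * alpha v Y * (b₀ v Y * b₁ v Y) =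
      (1 - 8 * v + 20 * v^2 - 13 * v^3 - 27 * v^5 - 59 * v^6 + 354 * v^7 - 171 * v^8 - 522 * v^9
      + 242 * v^10 + 379 * v^11 + 282 * v^12 + 157 * v^13 + 5 * v^14) +
      (1 - 7 * v + 13 * v^2 - v^3 + 8 * v^4 - 26 * v^5 - 98 * v^6 + 250 * v^7 + 53 * v^8 - 367 *
      v^9 - 251 * v^10 - 169 * v^11 - 46 * v^12) * Y := by
  rw [b₀_mul_b₀ h, b₀_mul_b₁ h]
  unfold alpha
  linear_combination (-12 * v^3 + 24 * v^4 - 88 * v^6 - 24 * v^7 + 40 * v^8 + 32 * v^9 + 24 * v^10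
      + 4 * v^11) * h

theorem coeff_quad_square_mul_linear₂ (h : Y^2 = (v - 1) * Y + v^3) :
    2 * (b₀ v Y * b₁ v Y) - alpha v Y * (b₁ v Y * b₁ v Y + 2 * b₀ v Y) =
      (2 - 12 * v + 18 * v^2 + 32 * v^3 - 124 * v^4 + 48 * v^5 + 136 * v^6 - 40 * v^7 - 86 * v^8
      - 220 * v^9 - 74 * v^10) +
      (2 - 10 * v + 8 * v^2 + 36 * v^3 - 80 * v^4 - 8 * v^5 + 88 * v^6 + 132 * v^7 + 142 * v^8 +
      10 * v^9) * Y := by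
  rw [b₀_mul_b₁ h, b₁_mul_b₁ h]
  unfold alpha b₀
  linear_combination (2 - 6 * v + 2 * v^2 + 18 * v^3 + 14 * v^4 + 6 * v^5 - 18 * v^6 - 18 * v^7) * h

theorem coeff_quad_square_mul_linear₃ (h : Y^2 = (v - 1) * Y + v^3) :
    b₁ v Y * b₁ v Y + 2 * b₀ v Y - 2 * alpha v Y * b₁ v Y =
      (-2 + 8 * v - 4 * v^2 - 2 * v^3 - 10 * v^4 + 80 * v^6 + 10 * v^7) +
      (-2 + 6 * v - 38 * v^4 - 46 * v^5) * Y := by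
  rw [b₁_mul_b₁ h]
  unfold alpha b₀ b₁
  linear_combination (-4 * v - 4 * v^2 + 4 * v^3 + 4 * v^4) * h

theorem coeff_quad_square_mul_linear₄  :
    2 * b₁ v Y - alpha v Y =
      (-1 + 2 * v + v^2 - 14 * v^3) +
      (-1 + 4 * v + 5 * v^2) * Y := by
  unfold alpha b₁
  ring

/-! ### The Pell-type identity and the derivative -/

/-- The last factor is minus the conjugate of the numerator of `lead` over the field of rational
functions in v. Their product is v⁵(v-1)², which cancels the remaining denominator. Twice this
reciprocal of `lead` is the constant in `scaled_pell_identity`. -/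
theorem lead_mul (h : Y^2 = (v - 1) * Y + v^3) (hv : 1 < v) :
    lead v Y * (256 * (v + 1)^3 * (v - 1)^3 * v^12 * (v^3 + (v^2 - v + 1) * (Y - v + 1))) = 1 := by
  have h1 : v - 1 ≠ 0 := by linarith
  unfold lead
  rw [div_mul_eq_mul_div, div_eq_one_iff_eq (by positivity)]
  linear_combination
    (256 * (v + 1)^3 * (v - 1)^3 * v^12 * (v^2 - v + 1)^2) * h

theorem scaled_pell_coeff₀ (h : Y^2 = (v - 1) * Y + v^3) :
    0 - rho v Y * (-(alpha v Y * (b₀ v Y * b₀ v Y))) =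
      -(beta v Y * (c₀ v Y * c₀ v Y)) +
      2 * (256 * (v + 1)^3 * (v - 1)^3 * v^12 * (v^3 + (v^2 - v + 1) * (Y - v + 1))) := by
  rw [coeff_quad_square_mul_linear₀ h, coeff_square_mul_linear₀ h]
  unfold rho
  linear_combination (1 - 12 * v + 51 * v^2 - 67 * v^3 - 132 * v^4 + 467 * v^5 - 180 * v^6 - 700 *
      v^7 + 414 *
      v^8 + 372 * v^9 + 810 * v^10 - 730 * v^11 - 2572 * v^12 + 1098 * v^13 + 2940 * v^14 + 1396
      * v^15 - 55 * v^16 - 1408 * v^17 - 1061 * v^18 - 411 * v^19 - 216 * v^20 - 5 * v^21) * h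

theorem scaled_pell_coeff₁ (h : Y^2 = (v - 1) * Y + v^3) :
    0 - rho v Y * (b₀ v Y * b₀ v Y - 2 * alpha v Y * (b₀ v Y * b₁ v Y)) =
      c₀ v Y * c₀ v Y - 2 * beta v Y * (c₀ v Y * c₁ v Y) := by
  rw [coeff_quad_square_mul_linear₁ h, coeff_square_mul_linear₁ h]
  unfold rho
  linear_combination (-1 + 10 * v - 32 * v^2 + 28 * v^3 + 76 * v^5 + 56 * v^6 - 644 * v^7 + 446 *
      v^8 + 816 *
      v^9 - 16 * v^10 - 972 * v^11 - 3000 * v^12 - 876 * v^13 + 1656 * v^14 + 1332 * v^15 + 891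
      * v^16 + 230 * v^17) * h

theorem scaled_pell_coeff₂ (h : Y^2 = (v - 1) * Y + v^3) :
    (-(alpha v Y * (b₀ v Y * b₀ v Y))) - rho v Y * (2 * (b₀ v Y * b₁ v Y) - alpha v Y * (b₁ v Y *
        b₁ v Y + 2 * b₀ v Y)) =
      2 * (c₀ v Y * c₁ v Y) - beta v Y * (c₁ v Y * c₁ v Y + 2 * (c₀ v Y * c₂ v Y)) := by
  rw [coeff_quad_square_mul_linear₀ h, coeff_quad_square_mul_linear₂ h, coeff_square_mul_linear₂ h]
  unfold rho
  linear_combination (-2 + 16 * v - 34 * v^2 - 28 * v^3 + 182 * v^4 - 144 * v^5 - 158 * v^6 - 120 *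
      v^7 + 314 *
      v^8 + 1264 * v^9 + 530 * v^10 - 268 * v^11 - 782 * v^12 - 720 * v^13 - 50 * v^14) * h

theorem scaled_pell_coeff₃ (h : Y^2 = (v - 1) * Y + v^3) :
    (b₀ v Y * b₀ v Y - 2 * alpha v Y * (b₀ v Y * b₁ v Y)) - rho v Y * (b₁ v Y * b₁ v Y + 2 * b₀ v Y
        - 2 * alpha v Y * b₁ v Y) =
      c₁ v Y * c₁ v Y + 2 * (c₀ v Y * c₂ v Y) - beta v Y * (2 * c₀ v Y + 2 * (c₂ v Y * c₁ v Y)) :=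
          by
  rw [coeff_quad_square_mul_linear₁ h, coeff_quad_square_mul_linear₃ h, coeff_square_mul_linear₃ h]
  unfold rho
  linear_combination (2 - 12 * v + 14 * v^2 + 8 * v^3 + 52 * v^4 - 64 * v^5 - 244 * v^6 - 168 * v^7
      - 54 * v^8 +
      236 * v^9 + 230 * v^10) * h

theorem scaled_pell_coeff₄ (h : Y^2 = (v - 1) * Y + v^3) :
    (2 * (b₀ v Y * b₁ v Y) - alpha v Y * (b₁ v Y * b₁ v Y + 2 * b₀ v Y)) - rho v Y * (2 * b₁ v Y -
        alpha v Y) =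
      2 * c₀ v Y + 2 * (c₂ v Y * c₁ v Y) - beta v Y * (c₂ v Y * c₂ v Y + 2 * c₁ v Y) := by
  rw [coeff_quad_square_mul_linear₂ h, coeff_quad_square_mul_linear₄, coeff_square_mul_linear₄ h]
  unfold rho
  linear_combination (1 - 7 * v + 5 * v^2 + 21 * v^3 + 19 * v^4 + 11 * v^5 - 25 * v^6 - 25 * v^7) *
      h

theorem scaled_pell_coeff₅ (h : Y^2 = (v - 1) * Y + v^3) :
    (b₁ v Y * b₁ v Y + 2 * b₀ v Y - 2 * alpha v Y * b₁ v Y) - rho v Y * (1) =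
      c₂ v Y * c₂ v Y + 2 * c₁ v Y - 2 * beta v Y * c₂ v Y := by
  rw [coeff_quad_square_mul_linear₃ h, coeff_square_mul_linear₅ h]
  unfold rho
  linear_combination (0) * h

theorem scaled_pell_coeff₆  :
    (2 * b₁ v Y - alpha v Y) - rho v Y * (0) =
      2 * c₂ v Y - beta v Y := by
  rw [coeff_quad_square_mul_linear₄, coeff_square_mul_linear₆]
  ring

theorem scaled_pell_identity (h : Y^2 = (v - 1) * Y + v^3) (y : ℝ) :
    (y^2 - rho v Y) * (y - alpha v Y) * quadFactor v Y y ^ 2 - (y - beta v Y) * cubicFactor v Y y ^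
        2 =
      2 * (256 * (v + 1)^3 * (v - 1)^3 * v^12 * (v^3 + (v^2 - v + 1) * (Y - v + 1))) := by
  unfold quadFactor cubicFactor
  linear_combination scaled_pell_coeff₀ h + y^1 * scaled_pell_coeff₁ h + y^2 * scaled_pell_coeff₂ h
      + y^3 * scaled_pell_coeff₃ h + y^4 * scaled_pell_coeff₄ h + y^5 * scaled_pell_coeff₅ h + y^6
      * scaled_pell_coeff₆

/-- The left side is what remains of the derivative of (y-β)·C² after splitting off C. The second
form of the polynomial forces Q to divide the derivative as well, so only a linear factor with
leading coefficient 7 is left; its zero is the seventh part of `gamma7`. -/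
theorem cubicFactor_add_eq (h : Y^2 = (v - 1) * Y + v^3) (y : ℝ) :
    cubicFactor v Y y + 2 * (y - beta v Y) * (3 * y^2 + 2 * c₂ v Y * y + c₁ v Y) =
      (7 * y - gamma7 v Y) * quadFactor v Y y := by
  unfold cubicFactor quadFactor
  have h2 : 5 * c₂ v Y - 6 * beta v Y = 7 * b₁ v Y - gamma7 v Y := by
    unfold c₂ beta b₁ gamma7; ring
  have h1 : 3 * c₁ v Y - 4 * beta v Y * c₂ v Y = 7 * b₀ v Y - gamma7 v Y * b₁ v Y := by
    unfold c₁ c₂ beta b₀ b₁ gamma7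
    linear_combination (-4 + 6 * v + 22 * v^2 + 10 * v^3 - 2 * v^4) * h
  have h0 : c₀ v Y - 2 * beta v Y * c₁ v Y = -gamma7 v Y * b₀ v Y := by
    unfold c₀ c₁ beta b₀ gamma7
    linear_combination (-1 - v + 13 * v^2 + 17 * v^3 - 27 * v^4 - 51 * v^5 - 17 * v^6 + 3 * v^7) * h
  linear_combination y^2 * h2 + y * h1 + h0

/-! ### The coefficients as functions on the curve -/

/-- The numerator of the coefficient of `x ^ 0`. -/
def num₀ (v Y : ℝ) : ℝ :=
  (-1 + 12 * v - 54 * v^2 + 99 * v^3 + 13 * v^4 - 338 * v^5 + 428 * v^6 + 41 * v^7 - 375 *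
      v^8 + 144 * v^9 + 10 * v^10 + 245 * v^11 - 21 * v^12 + 54 * v^13 - v^15) +
      (-1 + 11 * v - 42 * v^2 + 58 * v^3 + 57 * v^4 - 239 * v^5 + 148 * v^6 + 108 * v^7 - 47 *
      v^8 - 35 * v^9 - 42 * v^10 + 90 * v^11 - 73 * v^12 + 7 * v^13) * Y

/-- The numerator of the coefficient of `x ^ 1` over the common irrationality. -/
def num₁ (v Y : ℝ) : ℝ :=
  (1 - 11 * v + 46 * v^2 - 98 * v^3 + 147 * v^4 - 225 * v^5 + 232 * v^6 + 184 * v^7 - 917 *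
      v^8 + 903 * v^9 - 646 * v^10 + 186 * v^11 - 207 * v^12 + 21 * v^13) +
      (1 - 10 * v + 36 * v^2 - 66 * v^3 + 93 * v^4 - 136 * v^5 + 92 * v^6 + 232 * v^7 - 521 * v^8
      + 98 * v^9 - 272 * v^10 + 74 * v^11 - 5 * v^12) * Y

/-- The numerator of the coefficient of `x ^ 2`. -/
def num₂ (v Y : ℝ) : ℝ :=
  (3 - 36 * v + 162 * v^2 - 297 * v^3 - 63 * v^4 + 1202 * v^5 - 1852 * v^6 + 713 * v^7 + 837
      * v^8 - 1400 * v^9 + 610 * v^10 - 2071 * v^11 - 137 * v^12 - 406 * v^13 + 184 * v^14 - 9 *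
      v^15) +
      (3 - 33 * v + 130 * v^2 - 170 * v^3 - 247 * v^4 + 865 * v^5 - 564 * v^6 + 84 * v^7 - 395 *
      v^8 - 415 * v^9 - 590 * v^10 - 1322 * v^11 + 639 * v^12 - 33 * v^13) * Y

/-- The numerator of the coefficient of `x ^ 3` over the common irrationality. -/
def num₃ (v Y : ℝ) : ℝ :=
  (-3 + 33 * v - 138 * v^2 + 294 * v^3 - 417 * v^4 + 507 * v^5 - 388 * v^6 - 484 * v^7 + 2195
      * v^8 - 2353 * v^9 + 2670 * v^10 - 162 * v^11 + 753 * v^12 - 75 * v^13) +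
      (-3 + 30 * v - 108 * v^2 + 194 * v^3 - 255 * v^4 + 308 * v^5 - 136 * v^6 - 660 * v^7 + 1511
      * v^8 + 270 * v^9 + 1364 * v^10 - 78 * v^11 - 5 * v^12) * Y

/-- The numerator of the coefficient of `x ^ 4`. -/
def num₄ (v Y : ℝ) : ℝ :=
  (-3 + 36 * v - 162 * v^2 + 297 * v^3 + 87 * v^4 - 1390 * v^5 + 2420 * v^6 - 1549 * v^7 -
      693 * v^8 + 2688 * v^9 - 706 * v^10 + 3391 * v^11 + 1537 * v^12 + 618 * v^13 - 432 * v^14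
      + 5 * v^15) +
      (-3 + 33 * v - 134 * v^2 + 166 * v^3 + 323 * v^4 - 1013 * v^5 + 684 * v^6 - 556 * v^7 + 723
      * v^8 + 1495 * v^9 + 2554 * v^10 + 2982 * v^11 - 1075 * v^12 - 35 * v^13) * Y

/-- The numerator of the coefficient of `x ^ 5` over the common irrationality. -/
def num₅ (v Y : ℝ) : ℝ :=
  (3 - 33 * v + 138 * v^2 - 294 * v^3 + 393 * v^4 - 339 * v^5 + 80 * v^6 + 416 * v^7 - 1495 *
      v^8 + 1309 * v^9 - 2602 * v^10 - 842 * v^11 - 869 * v^12 + 39 * v^13) +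
      (3 - 30 * v + 108 * v^2 - 190 * v^3 + 231 * v^4 - 208 * v^5 - 4 * v^6 + 624 * v^7 - 1251 *
      v^8 - 1378 * v^9 - 1912 * v^10 - 98 * v^11 + 9 * v^12) * Y

/-- The numerator of the coefficient of `x ^ 6`. -/
def num₆ (v Y : ℝ) : ℝ :=
  (1 - 12 * v + 54 * v^2 - 99 * v^3 - 37 * v^4 + 526 * v^5 - 996 * v^6 + 795 * v^7 + 231 *
      v^8 - 1432 * v^9 + 86 * v^10 - 1565 * v^11 - 1635 * v^12 - 266 * v^13 + 248 * v^14 + 5 *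
      v^15) +
      (1 - 11 * v + 46 * v^2 - 54 * v^3 - 133 * v^4 + 387 * v^5 - 268 * v^6 + 364 * v^7 - 281 *
      v^8 - 1045 * v^9 - 1922 * v^10 - 1750 * v^11 + 509 * v^12 + 61 * v^13) * Y

/-- The numerator of the coefficient of `x ^ 7` over the common irrationality. -/
def num₇ (v Y : ℝ) : ℝ :=
  (-1 + 11 * v - 46 * v^2 + 98 * v^3 - 123 * v^4 + 57 * v^5 + 76 * v^6 - 116 * v^7 + 217 *
      v^8 + 141 * v^9 + 578 * v^10 + 818 * v^11 + 323 * v^12 + 15 * v^13) +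
      (-1 + 10 * v - 36 * v^2 + 62 * v^3 - 69 * v^4 + 36 * v^5 + 48 * v^6 - 196 * v^7 + 261 * v^8
      + 1010 * v^9 + 820 * v^10 + 102 * v^11 + v^12) * Y

/-- `radSq` and `rho` differ by a square on the curve, so the scale √`rho` is a rational multiple of
the single root √`radSq` that occurs in all odd coefficients. -/
theorem kappa_sq_mul_radSq (h : Y^2 = (v - 1) * Y + v^3) (hv : 1 < v) : kappa v Y ^ 2 * radSq v Y =
    rho v Y := by
  have h0 : v ≠ 0 := by linarith
  unfold kappa radSq rho
  rw [div_pow, div_mul_eq_mul_div, div_eq_iff (by positivity)]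
  linear_combination ((v^2 - 1) * (v^2 * (v - 1) + (3 * v + 1) * Y)) * h + (-1 - 2 * v + 2 * v^2 -
      4 * v^3 - v^4 + 6 * v^5) * h

theorem lead_mul_rho (h : Y^2 = (v - 1) * Y + v^3) (hv : 1 < v) :
    lead v Y * rho v Y = ((4 * v^4) +
      (-1 - v + 5 * v^2 + v^3) * Y) / (256 * ((v + 1)^2 * (v - 1)^2 * v^15)) := by
  have h0 : v ≠ 0 := by linarith
  have h1 : v - 1 ≠ 0 := by linarith
  unfold lead rho
  rw [div_mul_eq_mul_div, div_eq_div_iff (by positivity) (by positivity)]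
  linear_combination (256 * ((v + 1)^2 * (v - 1)^2 * v^15) * (1 - 4 * v + 2 * v^2 - 3 * v^3 + v^4 +
      2 * v^5 - 4 * v^6 + 5 * v^7)) * h

theorem lead_mul_rho_sq (h : Y^2 = (v - 1) * Y + v^3) (hv : 1 < v) :
    lead v Y * rho v Y ^ 2 = ((v - 7 * v^2 + 14 * v^3 - 18 * v^4 + 33 * v^5 + 9 * v^6) +
      (1 + v - 18 * v^2 + 14 * v^3 + 33 * v^4 + v^5) * Y) / (256 * ((v - 1) * v^13)) := by
  have h0 : v ≠ 0 := by linarith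
  have h1 : v - 1 ≠ 0 := by linarith
  rw [pow_succ, ← mul_assoc, pow_one, lead_mul_rho h hv]
  unfold rho
  rw [div_mul_eq_mul_div, div_eq_div_iff (by positivity) (by positivity)]
  linear_combination (256 * ((v - 1) * v^13) * (-1 + 2 * v + 10 * v^2 - 10 * v^3 - 12 * v^4 - 18 *
      v^5 - 2 * v^6 + 26 * v^7 + 5 * v^8)) * h

theorem lead_mul_rho_cube (h : Y^2 = (v - 1) * Y + v^3) (hv : 1 < v) :
    lead v Y * rho v Y ^ 3 = ((-1 + 10 * v - 35 * v^2 + 54 * v^3 - 42 * v^4 - 12 * v^5 + 58 * v^6 -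
        36 * v^7 + 283 * v^8
      + 482 * v^9 + 249 * v^10 + 14 * v^11) +
      (-1 + 8 * v - 27 * v^2 + 48 * v^3 - 10 * v^4 - 160 * v^5 - 22 * v^6 + 528 * v^7 + 571 * v^8
      + 88 * v^9 + v^10) * Y) / (256 * (v^12)) := by
  have h0 : v ≠ 0 := by linarith
  have h1 : v - 1 ≠ 0 := by linarith
  rw [pow_succ, ← mul_assoc, lead_mul_rho_sq h hv]
  unfold rho
  rw [div_mul_eq_mul_div, div_eq_div_iff (by positivity) (by positivity)]
  linear_combination (256 * (v^12) * (1 - 2 * v - 23 * v^2 + 64 * v^3 + 26 * v^4 - 84 * v^5 - 110 *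
      v^6 - 144 * v^7 + 101 * v^8
      + 166 * v^9 + 5 * v^10)) * h

theorem kappa_mul_lead (h : Y^2 = (v - 1) * Y + v^3) (hv : 1 < v) :
    kappa v Y * (lead v Y) = (Y) / (256 * ((v + 1)^3 * (v - 1)^3 * v^16)) := by
  have h0 : v ≠ 0 := by linarith
  have h1 : v - 1 ≠ 0 := by linarith
  unfold kappa lead
  rw [div_mul_div_comm, div_eq_div_iff (by positivity) (by positivity)]
  linear_combination (256 * ((v + 1)^3 * (v - 1)^3 * v^16) * (1 - v + v^2)) * h

theorem kappa_mul_lead_mul_rho (h : Y^2 = (v - 1) * Y + v^3) (hv : 1 < v) :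
    kappa v Y * (lead v Y * rho v Y) = ((-v + 3 * v^2 + v^3 + 5 * v^4) +
      (-1 - v + 9 * v^2 + v^3) * Y) / (256 * ((v + 1)^2 * (v - 1)^2 * v^14)) := by
  have h0 : v ≠ 0 := by linarith
  have h1 : v - 1 ≠ 0 := by linarith
  rw [lead_mul_rho h hv]
  unfold kappa
  rw [div_mul_div_comm, div_eq_div_iff (by positivity) (by positivity)]
  linear_combination (256 * ((v + 1)^2 * (v - 1)^2 * v^14) * (-1 - v + 5 * v^2 + v^3)) * h

theorem kappa_mul_lead_mul_rho_sq (h : Y^2 = (v - 1) * Y + v^3) (hv : 1 < v) :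
    kappa v Y * (lead v Y * rho v Y ^ 2) = ((1 - 8 * v + 23 * v^2 - 38 * v^3 + 47 * v^4 - 28 * v^5
        + 57 * v^6 + 10 * v^7) +
      (1 - 6 * v + 15 * v^2 - 36 * v^3 + 47 * v^4 + 42 * v^5 + v^6) * Y) / (256 * ((v - 1) * v^13))
          := by
  have h0 : v ≠ 0 := by linarith
  have h1 : v - 1 ≠ 0 := by linarith
  rw [lead_mul_rho_sq h hv]
  unfold kappa
  rw [div_mul_div_comm, div_eq_div_iff (by positivity) (by positivity)]
  linear_combination (256 * ((v - 1) * v^13) * (1 + v - 18 * v^2 + 14 * v^3 + 33 * v^4 + v^5)) * h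

theorem kappa_mul_lead_mul_rho_cube (h : Y^2 = (v - 1) * Y + v^3) (hv : 1 < v) :
    kappa v Y * (lead v Y * rho v Y ^ 3) = (num₇ v Y) / (256 * (v^13)) := by
  have h0 : v ≠ 0 := by linarith
  have h1 : v - 1 ≠ 0 := by linarith
  rw [lead_mul_rho_cube h hv]
  unfold kappa num₇
  rw [div_mul_div_comm, div_eq_div_iff (by positivity) (by positivity)]
  linear_combination (256 * (v^13) * (-1 + 8 * v - 27 * v^2 + 48 * v^3 - 10 * v^4 - 160 * v^5 - 22
      * v^6 + 528 * v^7 + 571 * v^8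
      + 88 * v^9 + v^10)) * h

theorem coeff₀_eq (h : Y^2 = (v - 1) * Y + v^3) (hv : 1 < v) :
    1 + lead v Y * (-(beta v Y * (c₀ v Y * c₀ v Y))) = num₀ v Y / (256 * v^12) := by
  have h0 : v ≠ 0 := by linarith
  have h1 : v - 1 ≠ 0 := by linarith
  rw [coeff_square_mul_linear₀ h]
  unfold num₀ lead
  rw [div_mul_eq_mul_div, one_add_div (by positivity), div_eq_div_iff (by positivity) (by
      positivity)]
  linear_combination (256 * v^12 * (1 - 14 * v + 78 * v^2 - 202 * v^3 + 120 * v^4 + 691 * v^5 -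
      1840 * v^6 + 1078 * v^7 + 2727
      * v^8 - 5417 * v^9 + 1804 * v^10 + 4756 * v^11 - 5560 * v^12 + 310 * v^13 + 2768 * v^14 -
      572 * v^15 - 1249 * v^16 - 504 * v^17 + 2038 * v^18 - 938 * v^19 - 656 * v^20 + 839 * v^21
      - 240 * v^22 - 26 * v^23 + 9 * v^24 - v^25)) * h

theorem coeff₁_eq (h : Y^2 = (v - 1) * Y + v^3) (hv : 1 < v) :
    kappa v Y * (lead v Y) * (c₀ v Y * c₀ v Y - 2 * beta v Y * (c₀ v Y * c₁ v Y)) = num₁ v Y / (256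
        * v^13) := by
  have h0 : v ≠ 0 := by linarith
  have h1 : v - 1 ≠ 0 := by linarith
  rw [kappa_mul_lead h hv, coeff_square_mul_linear₁ h]
  unfold num₁
  rw [div_mul_eq_mul_div, div_eq_div_iff (by positivity) (by positivity)]
  linear_combination (256 * v^13 * (-1 + 11 * v - 43 * v^2 + 65 * v^3 - 12 * v^4 - 36 * v^5 + 72 *
      v^6 - 576 * v^7 + 1218 *
      v^8 + 226 * v^9 - 2654 * v^10 + 1746 * v^11 + 1252 * v^12 - 1988 * v^13 + 400 * v^14 + 408
      * v^15 - 25 * v^16 + 123 * v^17 - 207 * v^18 + 21 * v^19)) * h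

theorem coeff₂_eq (h : Y^2 = (v - 1) * Y + v^3) (hv : 1 < v) :
    (lead v Y * rho v Y) * (2 * (c₀ v Y * c₁ v Y) - beta v Y * (c₁ v Y * c₁ v Y + 2 * (c₀ v Y * c₂
        v Y))) = num₂ v Y / (256 * v^12) := by
  have h0 : v ≠ 0 := by linarith
  have h1 : v - 1 ≠ 0 := by linarith
  rw [lead_mul_rho h hv, coeff_square_mul_linear₂ h]
  unfold num₂
  rw [div_mul_eq_mul_div, div_eq_div_iff (by positivity) (by positivity)]
  linear_combination (256 * v^12 * (3 - 24 * v + 36 * v^2 + 195 * v^3 - 744 * v^4 + 260 * v^5 +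
      2636 * v^6 - 3712 * v^7 - 1946
      * v^8 + 6276 * v^9 - 1468 * v^10 - 2578 * v^11 - 1376 * v^12 - 116 * v^13 + 4804 * v^14 -
      40 * v^15 - 1057 * v^16 + 772 * v^17 + 136 * v^18 - 9 * v^19)) * h

theorem coeff₃_eq (h : Y^2 = (v - 1) * Y + v^3) (hv : 1 < v) :
    kappa v Y * (lead v Y * rho v Y) * (c₁ v Y * c₁ v Y + 2 * (c₀ v Y * c₂ v Y) - beta v Y * (2 *
        c₀ v Y + 2 * (c₂ v Y * c₁ v Y))) = num₃ v Y / (256 * v^13) := by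
  have h0 : v ≠ 0 := by linarith
  have h1 : v - 1 ≠ 0 := by linarith
  rw [kappa_mul_lead_mul_rho h hv, coeff_square_mul_linear₃ h]
  unfold num₃
  rw [div_mul_eq_mul_div, div_eq_div_iff (by positivity) (by positivity)]
  linear_combination (256 * v^13 * (-3 + 18 * v + 9 * v^2 - 222 * v^3 + 337 * v^4 + 26 * v^5 + 141
      * v^6 - 438 * v^7 - 1977 *
      v^8 + 5206 * v^9 + 555 * v^10 - 5946 * v^11 - 1045 * v^12 - 1154 * v^13 - 577 * v^14 - 50
      * v^15)) * h

theorem coeff₄_eq (h : Y^2 = (v - 1) * Y + v^3) (hv : 1 < v) :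
    (lead v Y * rho v Y ^ 2) * (2 * c₀ v Y + 2 * (c₂ v Y * c₁ v Y) - beta v Y * (c₂ v Y * c₂ v Y +
        2 * c₁ v Y)) = num₄ v Y / (256 * v^12) := by
  have h0 : v ≠ 0 := by linarith
  have h1 : v - 1 ≠ 0 := by linarith
  rw [lead_mul_rho_sq h hv, coeff_square_mul_linear₄ h]
  unfold num₄
  rw [div_mul_eq_mul_div, div_eq_div_iff (by positivity) (by positivity)]
  linear_combination (256 * v^12 * (3 - 12 * v - 57 * v^2 + 376 * v^3 - 409 * v^4 - 1392 * v^5 +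
      3639 * v^6 + 48 * v^7 - 6151
      * v^8 - 364 * v^9 + 2525 * v^10 + 6136 * v^11 + 5565 * v^12 + 328 * v^13 + 5 * v^14)) * h

theorem coeff₅_eq (h : Y^2 = (v - 1) * Y + v^3) (hv : 1 < v) :
    kappa v Y * (lead v Y * rho v Y ^ 2) * (c₂ v Y * c₂ v Y + 2 * c₁ v Y - 2 * beta v Y * c₂ v Y) =
        num₅ v Y / (256 * v^13) := by
  have h0 : v ≠ 0 := by linarith
  have h1 : v - 1 ≠ 0 := by linarith
  rw [kappa_mul_lead_mul_rho_sq h hv, coeff_square_mul_linear₅ h]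
  unfold num₅
  rw [div_mul_eq_mul_div, div_eq_div_iff (by positivity) (by positivity)]
  linear_combination (256 * v^13 * (-3 + 27 * v - 97 * v^2 + 233 * v^3 - 486 * v^4 + 438 * v^5 +
      118 * v^6 + 826 * v^7 + 89 *
      v^8 - 4033 * v^9 - 2181 * v^10 - 51 * v^11)) * h

theorem coeff₆_eq (h : Y^2 = (v - 1) * Y + v^3) (hv : 1 < v) :
    (lead v Y * rho v Y ^ 3) * (2 * c₂ v Y - beta v Y) = num₆ v Y / (256 * v^12) := by
  have h0 : v ≠ 0 := by linarith
  have h1 : v - 1 ≠ 0 := by linarith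
  rw [lead_mul_rho_cube h hv, coeff_square_mul_linear₆]
  unfold num₆
  rw [div_mul_eq_mul_div, div_eq_div_iff (by positivity) (by positivity)]
  linear_combination (256 * v^12 * (1 - 12 * v + 54 * v^2 - 116 * v^3 + 67 * v^4 + 360 * v^5 - 668
      * v^6 - 1416 * v^7 + 1431 *
      v^8 + 4836 * v^9 + 3206 * v^10 + 444 * v^11 + 5 * v^12)) * h

open SepticZolotarev

/-- The substitution is t = -12v - 1 and ω = 36(2Y - v + 1). Even coefficients are linear in ω,
hence in Y, so the identity needs no reduction by the curve equation. -/
theorem p0_eq (v Y : ℝ) :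
    p01 (-12 * v - 1) + 36 * (2 * Y - v + 1) * p02 (-12 * v - 1) =
      (2^6 * 3^3 * 12^12) * num₀ v Y := by
  unfold p01 p02 num₀
  ring

theorem num₁_sq (h : Y^2 = (v - 1) * Y + v^3) :
    num₁ v Y ^ 2 =
      (1 - 22 * v + 213 * v^2 - 1207 * v^3 + 4546 * v^4 - 12528 * v^5 + 27690 * v^6 - 51446 * v^7
      + 74287 * v^8 - 58758 * v^9 - 46197 * v^10 + 254631 * v^11 - 549620 * v^12 + 876800 * v^13
      - 944324 * v^14 + 283868 * v^15 + 968735 * v^16 - 1837618 * v^17 + 1827819 * v^18 -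
      1328425 * v^19 + 927250 * v^20 - 326224 * v^21 + 207226 * v^22 - 10438 * v^23 + 9425 *
      v^24 - 498 * v^25 - 299 * v^26 + 25 * v^27) +
      (1 - 21 * v + 192 * v^2 - 1016 * v^3 + 3550 * v^4 - 9150 * v^5 + 19376 * v^6 - 34776 * v^7
      + 46219 * v^8 - 26431 * v^9 - 49456 * v^10 + 179968 * v^11 - 366108 * v^12 + 555708 * v^13
      - 496400 * v^14 - 15424 * v^15 + 657751 * v^16 - 930323 * v^17 + 876592 * v^18 - 582216 *
      v^19 + 529694 * v^20 - 133342 * v^21 + 101280 * v^22 - 34984 * v^23 + 4413 * v^24 - 185 *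
      v^25) * Y := by
  unfold num₁
  linear_combination (1 - 20 * v + 172 * v^2 - 852 * v^3 + 2802 * v^4 - 6884 * v^5 + 13956 * v^6 -
      23444 * v^7 +
      27543 * v^8 - 10120 * v^9 - 35032 * v^10 + 99544 * v^11 - 185556 * v^12 + 243960 * v^13 -
      129416 * v^14 - 135304 * v^15 + 245807 * v^16 - 213348 * v^17 + 326444 * v^18 - 132740 *
      v^19 + 93698 * v^20 - 41236 * v^21 + 8196 * v^22 - 740 * v^23 + 25 * v^24) * h

/-- An odd coefficient is given as the root of a radicand. On the curve the radicand is `radSq`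
times a square, so that its root becomes √`radSq` times a rational expression, up to sign. -/
theorem p1_eq (h : Y^2 = (v - 1) * Y + v^3) :
    v^2 * (p11 (-12 * v - 1) + 36 * (2 * Y - v + 1) * p12 (-12 * v - 1)) =
      (2^6 * 3^3 * 12^12)^2 * (radSq v Y * num₁ v Y ^ 2) := by
  rw [num₁_sq h]
  unfold p11 p12 radSq
  linear_combination (-(2^6 * 3^3 * 12^12)^2 * (-1 + 18 * v - 128 * v^2 + 422 * v^3 - 373 * v^4 -
      1940 * v^5 + 8576 * v^6 - 21852 * v^7 +
      50035 * v^8 - 88874 * v^9 + 70640 * v^10 + 80626 * v^11 - 302545 * v^12 + 574216 * v^13 -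
      996928 * v^14 + 962008 * v^15 + 559245 * v^16 - 2547554 * v^17 + 2525856 * v^18 - 1004630
      * v^19 - 697423 * v^20 + 591820 * v^21 - 918208 * v^22 + 1186884 * v^23 - 198207 * v^24 +
      255802 * v^25 - 99984 * v^26 + 13054 * v^27 - 555 * v^28)) * h

theorem p2_eq (v Y : ℝ) :
    p21 (-12 * v - 1) + 36 * (2 * Y - v + 1) * p22 (-12 * v - 1) =
      (2^6 * 3^3 * 12^12) * num₂ v Y := by
  unfold p21 p22 num₂
  ring

theorem num₃_sq (h : Y^2 = (v - 1) * Y + v^3) :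
    num₃ v Y ^ 2 =
      (9 - 198 * v + 1917 * v^2 - 10863 * v^3 + 40770 * v^4 - 110160 * v^5 + 229674 * v^6 -
      382998 * v^7 + 474927 * v^8 - 246398 * v^9 - 650757 * v^10 + 2292743 * v^11 - 4284804 *
      v^12 + 5818320 * v^13 - 5526740 * v^14 + 1653932 * v^15 + 5705815 * v^16 - 12496322 * v^17
      + 15564451 * v^18 - 12436689 * v^19 + 10303138 * v^20 - 438720 * v^21 + 4907658 * v^22 +
      1158794 * v^23 + 375825 * v^24 - 120506 * v^25 + 6405 * v^26 + 25 * v^27) +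
      (9 - 189 * v + 1728 * v^2 - 9144 * v^3 + 31806 * v^4 - 79902 * v^5 + 157352 * v^6 - 249968
      * v^7 + 282091 * v^8 - 71839 * v^9 - 559008 * v^10 + 1572592 * v^11 - 2751948 * v^12 +
      3571180 * v^13 - 3027856 * v^14 + 207360 * v^15 + 4405231 * v^16 - 7691979 * v^17 +
      7562656 * v^18 - 2986104 * v^19 + 8620142 * v^20 + 1363794 * v^21 + 1804328 * v^22 -
      328784 * v^23 + 4925 * v^24 + 775 * v^25) * Y := by
  unfold num₃
  linear_combination (9 - 180 * v + 1548 * v^2 - 7644 * v^3 + 24834 * v^4 - 59052 * v^5 + 112012 *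
      v^6 - 169668
      * v^7 + 165239 * v^8 + 21752 * v^9 - 410216 * v^10 + 863080 * v^11 - 1353188 * v^12 +
      1518376 * v^13 - 533896 * v^14 - 1189896 * v^15 + 1510215 * v^16 - 966404 * v^17 + 4299228
      * v^18 + 507444 * v^19 + 1803266 * v^20 - 215484 * v^21 - 7556 * v^22 + 780 * v^23 + 25 *
      v^24) * h

theorem p3_eq (h : Y^2 = (v - 1) * Y + v^3) :
    v^2 * (p31 (-12 * v - 1) + 36 * (2 * Y - v + 1) * p32 (-12 * v - 1)) =
      (2^6 * 3^3 * 12^12)^2 * (radSq v Y * num₃ v Y ^ 2) := by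
  rw [num₃_sq h]
  unfold p31 p32 radSq
  linear_combination (-(2^6 * 3^3 * 12^12)^2 * (-9 + 162 * v - 1152 * v^2 + 3798 * v^3 - 3213 * v^4
      - 19476 * v^5 + 86728 * v^6 - 206572 *
      v^7 + 385459 * v^8 - 552346 * v^9 + 306712 * v^10 + 878866 * v^11 - 2740353 * v^12 +
      4580232 * v^13 - 5719856 * v^14 + 4191544 * v^15 + 2658373 * v^16 - 14399922 * v^17 +
      20540592 * v^18 - 14178150 * v^19 - 15175111 * v^20 - 7522356 * v^21 - 6233880 * v^22 +
      22140020 * v^23 + 6877137 * v^24 + 5068650 * v^25 - 983752 * v^26 + 15550 * v^27 + 2325 *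
      v^28)) * h

theorem p4_eq (v Y : ℝ) :
    p41 (-12 * v - 1) + 36 * (2 * Y - v + 1) * p42 (-12 * v - 1) =
      (2^6 * 3^3 * 12^12) * num₄ v Y := by
  unfold p41 p42 num₄
  ring

theorem num₅_sq (h : Y^2 = (v - 1) * Y + v^3) :
    num₅ v Y ^ 2 =
      (9 - 198 * v + 1917 * v^2 - 10863 * v^3 + 40626 * v^4 - 107568 * v^5 + 210138 * v^6 -
      302982 * v^7 + 283287 * v^8 + 6298 * v^9 - 710157 * v^10 + 1766351 * v^11 - 2781204 * v^12
      + 3069504 * v^13 - 2164324 * v^14 - 131268 * v^15 + 3356343 * v^16 - 5465186 * v^17 +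
      7823907 * v^18 - 5105745 * v^19 + 8255426 * v^20 + 8550448 * v^21 + 10859242 * v^22 +
      5163754 * v^23 + 1039433 * v^24 - 92594 * v^25 - 243 * v^26 + 81 * v^27) +
      (9 - 189 * v + 1728 * v^2 - 9144 * v^3 + 31662 * v^4 - 77454 * v^5 + 140288 * v^6 - 186920
      * v^7 + 150931 * v^8 + 65369 * v^9 - 531312 * v^10 + 1158336 * v^11 - 1693052 * v^12 +
      1739548 * v^13 - 1339056 * v^14 + 40544 * v^15 + 3241007 * v^16 - 4781643 * v^17 + 1977584
      * v^18 + 4522296 * v^19 + 15832622 * v^20 + 9604114 * v^21 + 3708528 * v^22 - 17016 * v^23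
      - 25131 * v^24 + 783 * v^25) * Y := by
  unfold num₅
  linear_combination (9 - 180 * v + 1548 * v^2 - 7620 * v^3 + 24450 * v^4 - 56148 * v^5 + 98452 *
      v^6 - 128724 *
      v^7 + 86591 * v^8 + 107000 * v^9 - 394712 * v^10 + 581816 * v^11 - 720948 * v^12 + 583640
      * v^13 + 128472 * v^14 - 803528 * v^15 - 94521 * v^16 + 1058620 * v^17 + 6560332 * v^18 +
      5525900 * v^19 + 3903314 * v^20 + 349948 * v^21 - 24812 * v^22 - 1764 * v^23 + 81 * v^24) * h

theorem p5_eq (h : Y^2 = (v - 1) * Y + v^3) :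
    v^2 * (p51 (-12 * v - 1) + 36 * (2 * Y - v + 1) * p52 (-12 * v - 1)) =
      (2^6 * 3^3 * 12^12)^2 * (radSq v Y * num₅ v Y ^ 2) := by
  rw [num₅_sq h]
  unfold p51 p52 radSq
  linear_combination (-(2^6 * 3^3 * 12^12)^2 * (-9 + 162 * v - 1152 * v^2 + 3798 * v^3 - 3069 * v^4
      - 21492 * v^5 + 96304 * v^6 - 216412 *
      v^7 + 317755 * v^8 - 284218 * v^9 - 74624 * v^10 + 953762 * v^11 - 2117161 * v^12 +
      2904008 * v^13 - 2097632 * v^14 + 637016 * v^15 + 516949 * v^16 - 8918002 * v^17 +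
      15729984 * v^18 - 5513670 * v^19 - 41766855 * v^20 - 46646932 * v^21 - 3121360 * v^22 +
      45993412 * v^23 + 32597049 * v^24 + 11183178 * v^25 - 78528 * v^26 - 74610 * v^27 + 2349 *
      v^28)) * h

theorem p6_eq (v Y : ℝ) :
    p61 (-12 * v - 1) + 36 * (2 * Y - v + 1) * p62 (-12 * v - 1) =
      (2^6 * 3^3 * 12^12) * num₆ v Y := by
  unfold p61 p62 num₆
  ring

theorem num₇_sq (h : Y^2 = (v - 1) * Y + v^3) :
    num₇ v Y ^ 2 =
      (1 - 22 * v + 213 * v^2 - 1207 * v^3 + 4498 * v^4 - 11664 * v^5 + 21178 * v^6 - 24774 * v^7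
      + 10407 * v^8 + 25474 * v^9 - 65997 * v^10 + 79167 * v^11 - 50724 * v^12 - 12336 * v^13 +
      57612 * v^14 - 81908 * v^15 + 73919 * v^16 + 120174 * v^17 + 171499 * v^18 + 203479 * v^19
      + 917106 * v^20 + 2451456 * v^21 + 2755994 * v^22 + 1424730 * v^23 + 298169 * v^24 + 21734
      * v^25 + 429 * v^26 + v^27) +
      (1 - 21 * v + 192 * v^2 - 1016 * v^3 + 3502 * v^4 - 8334 * v^5 + 13688 * v^6 - 13760 * v^7
      + 2499 * v^8 + 19305 * v^9 - 40224 * v^10 + 41712 * v^11 - 15276 * v^12 - 27444 * v^13 -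
      32496 * v^14 + 53600 * v^15 + 312983 * v^16 - 247059 * v^17 - 562272 * v^18 + 1443656 *
      v^19 + 3622494 * v^20 + 2829666 * v^21 + 885304 * v^22 + 103968 * v^23 + 3909 * v^24 + 31
      * v^25) * Y := by
  unfold num₇
  linear_combination (1 - 20 * v + 172 * v^2 - 844 * v^3 + 2674 * v^4 - 5916 * v^5 + 9436 * v^6 -
      9796 * v^7 +
      1327 * v^8 + 18296 * v^9 - 29864 * v^10 + 6344 * v^11 + 20412 * v^12 - 45048 * v^13 +
      35608 * v^14 + 39736 * v^15 - 241873 * v^16 + 215644 * v^17 + 1408252 * v^18 + 1709252 *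
      v^19 + 878962 * v^20 + 169300 * v^21 + 12044 * v^22 + 204 * v^23 + v^24) * h

theorem p7_eq (h : Y^2 = (v - 1) * Y + v^3) :
    v^2 * (p71 (-12 * v - 1) + 36 * (2 * Y - v + 1) * p72 (-12 * v - 1)) =
      (2^6 * 3^3 * 12^12)^2 * (radSq v Y * num₇ v Y ^ 2) := by
  rw [num₇_sq h]
  unfold p71 p72 radSq
  linear_combination (-(2^6 * 3^3 * 12^12)^2 * (-1 + 18 * v - 128 * v^2 + 422 * v^3 - 325 * v^4 -
      2612 * v^5 + 11768 * v^6 - 25132 * v^7 +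
      27467 * v^8 + 502 * v^9 - 56472 * v^10 + 105762 * v^11 - 92169 * v^12 - 5688 * v^13 +
      224688 * v^14 - 29384 * v^15 - 588611 * v^16 - 735778 * v^17 + 1777232 * v^18 + 935050 *
      v^19 - 9256911 * v^20 - 13940308 * v^21 - 1420840 * v^22 + 10937268 * v^23 + 9058489 *
      v^24 + 2748122 * v^25 + 315720 * v^26 + 11758 * v^27 + 93 * v^28)) * h

/-! ### Signs of the odd numerators for 1 < v ≤ 9/4 -/

theorem num₁_const_pos (hv : 1 < v) (hv' : v ≤ 9 / 4) :
    0 < -1 + 11 * v - 46 * v^2 + 98 * v^3 - 147 * v^4 + 225 * v^5 - 232 * v^6 - 184 * v^7 + 917 *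
      v^8 - 903 * v^9 + 646 * v^10 - 186 * v^11 + 207 * v^12 - 21 * v^13 := by
  -- The polynomial is rewritten in a = v - 1 and b = 9/4 - v with positive coefficients only, which
  -- certifies its sign on the interval. The other sign lemmas of this kind use the same device.
  have key : ∀ a b : ℝ, 0 < a → 0 ≤ b →
      0 < 384 + 3904 * a^1 + 18304 * a^2 + 52544 * a^3 + 103200 * a^4 + 146320 * a^5 + 153264 *
        a^6 + 118692 * a^7 + 66608 * a^8 + 25852 * a^9 + 6256 * a^10 + 8715 / 16 * a^11 + 369 /
        4 * a^11 * b + 21 * a^12 * b := by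
    intro a b ha hb
    positivity
  refine lt_of_lt_of_eq (key (v - 1) (9 / 4 - v) (by linarith) (by linarith)) ?_
  ring

theorem num₁_slope_pos (hv : 1 < v) (hv' : v ≤ 9 / 4) :
    0 < -1 + 10 * v - 36 * v^2 + 66 * v^3 - 93 * v^4 + 136 * v^5 - 92 * v^6 - 232 * v^7 + 521 *
      v^8 - 98 * v^9 + 272 * v^10 - 74 * v^11 + 5 * v^12 := by
  have key : ∀ a b : ℝ, 0 < a → 0 ≤ b →
      0 < 384 + 3520 * a^1 + 14272 * a^2 + 33568 * a^3 + 50384 * a^4 + 49856 * a^5 + 32192 * a^6 +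
        12588 * a^7 + 43213 / 32 * a^8 + 5 * a^12 + 5079 / 8 * a^8 * b + 459 / 2 * a^9 * b + 14
        * a^10 * b := by
    intro a b ha hb
    positivity
  refine lt_of_lt_of_eq (key (v - 1) (9 / 4 - v) (by linarith) (by linarith)) ?_
  ring

/-- The sign decides which root of the radicand is the right one; it accounts for the minus sign in
front of the root in the linear coefficient. -/
theorem num₁_neg (hv : 1 < v) (hv' : v ≤ 9 / 4) (hY : 0 < Y) : num₁ v Y < 0 := by
  have h1 := num₁_const_pos hv hv'
  have h2 := mul_pos (num₁_slope_pos hv hv') hY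
  unfold num₁
  linarith

theorem num₃_const_pos (hv : 1 < v) (hv' : v ≤ 9 / 4) :
    0 < -3 + 33 * v - 138 * v^2 + 294 * v^3 - 417 * v^4 + 507 * v^5 - 388 * v^6 - 484 * v^7 + 2195
      * v^8 - 2353 * v^9 + 2670 * v^10 - 162 * v^11 + 753 * v^12 - 75 * v^13 := by
  have key : ∀ a b : ℝ, 0 < a → 0 ≤ b →
      0 < 2432 + 25152 * a^1 + 119168 * a^2 + 342144 * a^3 + 662880 * a^4 + 912304 * a^5 + 912960
        * a^6 + 666984 * a^7 + 350648 * a^8 + 127472 * a^9 + 29136 * a^10 + 42069 / 16 * a^11 +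
        1263 / 4 * a^11 * b + 75 * a^12 * b := by
    intro a b ha hb
    positivity
  refine lt_of_lt_of_eq (key (v - 1) (9 / 4 - v) (by linarith) (by linarith)) ?_
  ring

theorem num₃_slope_pos (hv : 1 < v) (hv' : v ≤ 9 / 4) :
    0 < -3 + 30 * v - 108 * v^2 + 194 * v^3 - 255 * v^4 + 308 * v^5 - 136 * v^6 - 660 * v^7 + 1511
      * v^8 + 270 * v^9 + 1364 * v^10 - 78 * v^11 - 5 * v^12 := by
  have key : ∀ a b : ℝ, 0 < a → 0 ≤ b →
      0 < 2432 + 22720 * a^1 + 94912 * a^2 + 233440 * a^3 + 374160 * a^4 + 408000 * a^5 + 306016 *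
        a^6 + 155128 * a^7 + 49976 * a^8 + 544935 / 64 * a^9 + 69 / 16 * a^9 * b + 577 / 4 *
        a^10 * b + 5 * a^11 * b := by
    intro a b ha hb
    positivity
  refine lt_of_lt_of_eq (key (v - 1) (9 / 4 - v) (by linarith) (by linarith)) ?_
  ring

theorem num₃_pos (hv : 1 < v) (hv' : v ≤ 9 / 4) (hY : 0 < Y) : 0 < num₃ v Y := by
  have h1 := num₃_const_pos hv hv'
  have h2 := mul_pos (num₃_slope_pos hv hv') hY
  unfold num₃
  linarith

theorem num₅_const_pos (hv : 1 < v) (hv' : v ≤ 9 / 4) :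
    0 < -3 + 33 * v - 138 * v^2 + 294 * v^3 - 393 * v^4 + 339 * v^5 - 80 * v^6 - 416 * v^7 + 1495
      * v^8 - 1309 * v^9 + 2602 * v^10 + 842 * v^11 + 869 * v^12 - 39 * v^13 := by
  have key : ∀ a b : ℝ, 0 < a → 0 ≤ b →
      0 < 4096 + 42752 * a^1 + 204288 * a^2 + 590912 * a^3 + 1151808 * a^4 + 1592672 * a^5 +
        1600368 * a^6 + 1175844 * a^7 + 625696 * a^8 + 234316 * a^9 + 58064 * a^10 + 8228 * a^11
        + 1253 / 4 * a^12 + 39 * a^12 * b := by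
    intro a b ha hb
    positivity
  refine lt_of_lt_of_eq (key (v - 1) (9 / 4 - v) (by linarith) (by linarith)) ?_
  ring

theorem num₅_slope_pos (hv : 1 < v) (hv' : v ≤ 9 / 4) :
    0 < -3 + 30 * v - 108 * v^2 + 190 * v^3 - 231 * v^4 + 208 * v^5 + 4 * v^6 - 624 * v^7 + 1251 *
      v^8 + 1378 * v^9 + 1912 * v^10 + 98 * v^11 - 9 * v^12 := by
  have key : ∀ a b : ℝ, 0 < a → 0 ≤ b →
      0 < 4096 + 38656 * a^1 + 163584 * a^2 + 409024 * a^3 + 669632 * a^4 + 750784 * a^5 + 584896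
        * a^6 + 313644 * a^7 + 111408 * a^8 + 23908 * a^9 + 37911 / 16 * a^10 + 85 / 4 * a^10 *
        b + 9 * a^11 * b := by
    intro a b ha hb
    positivity
  refine lt_of_lt_of_eq (key (v - 1) (9 / 4 - v) (by linarith) (by linarith)) ?_
  ring

theorem num₅_neg (hv : 1 < v) (hv' : v ≤ 9 / 4) (hY : 0 < Y) : num₅ v Y < 0 := by
  have h1 := num₅_const_pos hv hv'
  have h2 := mul_pos (num₅_slope_pos hv hv') hY
  unfold num₅
  linarith

/-! ### Inequalities on the branch v > 1, Y > 0 -/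

/-- The curve equation reads Y(Y-v+1) = v³, and the left side increases with Y where both factors
are positive. At Y = 2v-1 it equals v(2v-1), which falls short of v³ by v(v-1)². -/
theorem two_mul_sub_one_lt (h : Y^2 = (v - 1) * Y + v^3) (hv : 1 < v) (hY : 0 < Y) :
    2 * v - 1 < Y := by
  by_contra! hle
  have h3 : 0 < v^3 := by positivity
  have h1 : Y * (Y - v + 1) = v^3 := by linear_combination h
  have h2 : 0 < Y - v + 1 := pos_of_mul_pos_right (h1 ▸ h3) hY.le
  have h4 : Y * (Y - v + 1) ≤ (2 * v - 1) * v :=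
    mul_le_mul hle (by linarith) h2.le (by linarith)
  nlinarith [mul_pos (by linarith : (0 : ℝ) < v) (pow_pos (sub_pos.2 hv) 2)]

/-- The same comparison as for the lower bound: at Y = v² the product Y(Y-v+1) exceeds v³ by
v²(v-1)². -/
theorem le_sq (h : Y^2 = (v - 1) * Y + v^3) (hv : 1 < v) : Y ≤ v^2 := by
  by_contra! hlt
  have h1 : Y * (Y - v + 1) = v^3 := by linear_combination h
  have h2 : v^2 * (v^2 - v + 1) < Y * (Y - v + 1) :=
    mul_lt_mul' hlt.le (by linarith) (by nlinarith) (by nlinarith)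
  nlinarith [mul_nonneg (sq_nonneg v) (sq_nonneg (v - 1))]

theorem rho_pos (hv : 1 < v) (hY : 0 < Y) : 0 < rho v Y := by
  obtain ⟨a, ha, rfl⟩ : ∃ a : ℝ, 0 < a ∧ v = 1 + a := ⟨v - 1, by linarith, by ring⟩
  have : rho (1 + a) Y = (2 * a + a^2) * ((8 + 28 * a + 40 * a^2 + 29 * a^3 + 9 * a^4 + a^5) +
      (8 + 20 * a + 16 * a^2 + 5 * a^3) * Y) := by unfold rho; ring
  rw [this]
  positivity

theorem radSq_pos (hv : 1 < v) (hY : 0 < Y) : 0 < radSq v Y := by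
  have h1 : 0 < v - 1 := by linarith
  have h2 : 0 < v^2 - 1 := by nlinarith
  unfold radSq
  positivity

theorem kappa_pos (hv : 1 < v) (hY : 0 < Y) : 0 < kappa v Y := by
  unfold kappa
  have h2 : 0 < v^2 + Y - v + 1 := by nlinarith
  have h3 : 0 < v := by linarith
  positivity

/-- At Y = 2v-1 the numerator equals (v-1)³, and it increases with Y. -/
theorem lead_pos (h : Y^2 = (v - 1) * Y + v^3) (hv : 1 < v) (hY : 0 < Y) : 0 < lead v Y := by
  have h1 : 0 < v - 1 := by linarith
  have h2 := two_mul_sub_one_lt h hv hY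
  have h3 : 0 < Y * (v^2 - v + 1) - v^3 := by
    nlinarith [mul_pos (sub_pos.2 h2) (by nlinarith : 0 < v^2 - v + 1), pow_pos h1 3]
  unfold lead
  positivity

theorem alpha_pos (h : Y^2 = (v - 1) * Y + v^3) (hv : 1 < v) (hv' : v ≤ 9 / 4) :
    0 < alpha v Y := by
  have h1 := mul_le_mul_of_nonneg_right (le_sq h hv) (by nlinarith : 0 ≤ v^2 - 1)
  unfold alpha
  nlinarith [mul_pos (pow_pos (by linarith : 0 < v) 3) (by linarith : 0 < 6 - v),
    pow_pos (by linarith : 0 < v) 3, mul_pos (by linarith : 0 < v) (by nlinarith : 0 < v^2 - 1)]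

/-- Reduces the comparison of α with U to an inequality linear in Y. -/
theorem alpha_sq_sub_rho (h : Y^2 = (v - 1) * Y + v^3) :
    alpha v Y ^ 2 - rho v Y = 16 * v^3 * (2 * v^3 - v^2 - v + 1 - Y * (v^2 - 1)) := by
  unfold alpha rho
  linear_combination ((v^2 - 1)^2) * h

/-- Let M be the right side. Then M - (v-1)(v²-1) = v³, and M - (v²-1)² is -v times the cubic of the
hypothesis. If Y(v²-1) were at least M, the curve equation multiplied by (v²-1)² would give M·v³ ≤
v³(v²-1)², against the sign of the cubic. -/
theorem mul_lt_of_cubic_neg (h : Y^2 = (v - 1) * Y + v^3) (hv : 1 < v) (hY : 0 < Y)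
    (hc : v^3 - 2 * v^2 - v + 1 < 0) : Y * (v^2 - 1) < 2 * v^3 - v^2 - v + 1 := by
  by_contra! hle
  have hM : 0 < 2 * v^3 - v^2 - v + 1 := by
    nlinarith [mul_pos (by linarith : 0 < v) (pow_pos (sub_pos.2 hv) 2), pow_pos (sub_pos.2 hv) 2]
  have h0 : 0 < v^2 - 1 := by nlinarith
  have h1 : (Y * (v^2 - 1)) * (Y * (v^2 - 1) - (v - 1) * (v^2 - 1)) = v^3 * (v^2 - 1)^2 := by
    linear_combination (v^2 - 1)^2 * h
  have h2 := mul_le_mul hle (sub_le_sub_right hle ((v - 1) * (v^2 - 1)))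
    (by ring_nf; positivity) (mul_pos hY h0).le
  nlinarith [mul_pos (pow_pos (by linarith : 0 < v) 4) (neg_pos.2 hc)]

theorem lt_of_cubic_neg (hv : 1 < v) (hc : v^3 - 2 * v^2 - v + 1 < 0) : v < 9 / 4 := by
  by_contra! hle
  nlinarith [mul_nonneg (by linarith : 0 ≤ v - 9 / 4) (by nlinarith : 0 ≤ v^2)]

/-- This is Q(0) < 0, which separates the two roots of Q by the origin. -/
theorem b₀_neg (h : Y^2 = (v - 1) * Y + v^3) (hv : 1 < v) (hv' : v ≤ 9 / 4) (hY : 0 < Y) :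
    b₀ v Y < 0 := by
  have h2 := two_mul_sub_one_lt h hv hY
  obtain ⟨a, ha, rfl⟩ : ∃ a : ℝ, 0 < a ∧ v = 1 + a := ⟨v - 1, by linarith, by ring⟩
  obtain ⟨z, hz, rfl⟩ : ∃ z : ℝ, 0 < z ∧ Y = 1 + 2 * a + z := ⟨Y - 1 - 2 * a, by linarith, by ring⟩
  have e : b₀ (1 + a) (1 + 2 * a + z) = -(z * (8 + 36 * a + 60 * a^2 + 46 * a^3 + 18 * a^4 +
      3 * a^5) + a * (8 + 28 * a + 36 * a^2 + 20 * a^3 + 2 * a^4 - 3 * a^5 - a^6)) := by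
    unfold b₀; ring
  have h3 : 0 < 20 - 3 * a^2 - a^3 := by nlinarith
  rw [e, neg_neg_iff_pos]
  -- The negative terms in a⁵ and a⁶ are absorbed by 20a³, since a ≤ 5/4.
  have h4 : 8 + 28 * a + 36 * a^2 + 20 * a^3 + 2 * a^4 - 3 * a^5 - a^6 =
      8 + 28 * a + 36 * a^2 + 2 * a^4 + a^3 * (20 - 3 * a^2 - a^3) := by ring
  rw [h4]
  positivity

theorem rho_add_b₀_pos (h : Y^2 = (v - 1) * Y + v^3) (hv : 1 < v) (hv' : v ≤ 9 / 4) :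
    0 < rho v Y + b₀ v Y := by
  have h1 := mul_le_mul_of_nonneg_left (le_sq h hv) (by nlinarith : 0 ≤ 1 + 2 * v - v^2)
  have e : rho v Y + b₀ v Y = 2 * (v + 1) * v^2 * (v * (v^3 + 2 * v^2 + v - 2) -
      (1 + 2 * v - v^2) * Y) := by
    unfold rho b₀; ring
  rw [e]
  refine mul_pos (by positivity) ?_
  nlinarith [pow_pos (by linarith : 0 < v) 3, mul_pos (by linarith : 0 < v) (by nlinarith : 0 < v^2
      - 1), mul_pos (pow_pos (by linarith : 0 < v) 2) (by nlinarith : 0 < v^2 - 1)]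

/-- The difference of the two sides is Q(U)·Q(-U). On the curve it is a positive factor times an
expression decreasing in Y, and replacing Y by its upper bound v² leaves (v-1)²(4v³+6v²+6). -/
theorem quadFactor_mul_quadFactor_neg_pos (h : Y^2 = (v - 1) * Y + v^3) (hv : 1 < v)
    (hv' : v ≤ 9 / 4) : b₁ v Y ^ 2 * rho v Y < (rho v Y + b₀ v Y)^2 := by
  have h1 := mul_le_mul_of_nonneg_left (le_sq h hv)
    (mul_nonneg (by linarith : 0 ≤ 3 - v) (by nlinarith : 0 ≤ v^2 + 3 * v - 2))
  have e : (rho v Y + b₀ v Y)^2 - b₁ v Y ^ 2 * rho v Y =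
      16 * (v + 1) * v^7 * ((6 - 12 * v + 6 * v^2 + 3 * v^3 - 2 * v^4 + 3 * v^5) -
        (3 - v) * (v^2 + 3 * v - 2) * Y) := by
    unfold rho b₀ b₁
    linear_combination (16 * v^4 - 20 * v^5 - 8 * v^6 + 36 * v^7 - 16 * v^8 + 20 * v^9 + 40 * v^10 -
      4 * v^11 + (-4 * v^2 + 4 * v^3 + 28 * v^4 + 36 * v^5 + 20 * v^6 - 20 * v^7 - 44 * v^8 -
      20 * v^9) * Y) * h
  have e2 : (6 - 12 * v + 6 * v^2 + 3 * v^3 - 2 * v^4 + 3 * v^5) -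
      (3 - v) * (v^2 + 3 * v - 2) * v^2 = (v - 1)^2 * (4 * v^3 + 6 * v^2 + 6) := by ring
  have e3 : 0 < (v - 1)^2 * (4 * v^3 + 6 * v^2 + 6) :=
    mul_pos (pow_pos (by linarith) 2) (by positivity)
  have : 0 < (rho v Y + b₀ v Y)^2 - b₁ v Y ^ 2 * rho v Y := by
    rw [e]
    exact mul_pos (by positivity) (by linarith)
  linarith

/-! ### The scaled polynomial on [-U, U] -/

variable {U : ℝ}

theorem curvePoly_eq (h : Y^2 = (v - 1) * Y + v^3) (hv : 1 < v) (y : ℝ) :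
    curvePoly v Y y =
      -1 + lead v Y * ((y^2 - rho v Y) * (y - alpha v Y) * quadFactor v Y y ^ 2) := by
  unfold curvePoly
  linear_combination (-lead v Y) * scaled_pell_identity h y - 2 * lead_mul h hv

theorem hasDerivAt_curvePoly (h : Y^2 = (v - 1) * Y + v^3) (y : ℝ) :
    HasDerivAt (curvePoly v Y)
      (lead v Y * (cubicFactor v Y y * ((7 * y - gamma7 v Y) * quadFactor v Y y))) y := by
  have h1 : HasDerivAt (cubicFactor v Y) (3 * y^2 + 2 * c₂ v Y * y + c₁ v Y) y := by
    unfold cubicFactor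
    convert! ((((hasDerivAt_id y).pow 3).add (((hasDerivAt_id y).pow 2).const_mul (c₂ v Y))).add
      ((hasDerivAt_id y).const_mul (c₁ v Y))).add_const (c₀ v Y) using 1
    simp; ring
  have h2 := ((((hasDerivAt_id y).sub_const (beta v Y)).mul (h1.pow 2)).const_mul
    (lead v Y)).const_add 1
  refine (h2.congr_deriv ?_).congr_of_eventuallyEq (Eventually.of_forall fun z => rfl)
  rw [← cubicFactor_add_eq h y]
  simp only [Pi.pow_apply, id_eq]
  push_cast
  ring

theorem continuous_curvePoly : Continuous (curvePoly v Y) := by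
  unfold curvePoly cubicFactor
  fun_prop

theorem continuous_quadFactor : Continuous (quadFactor v Y) := by
  unfold quadFactor
  fun_prop

/-- The second form gives the value -1 at U, whereas the first form gives at least 1 from β onwards.
-/
theorem lt_beta (h : Y^2 = (v - 1) * Y + v^3) (hv : 1 < v) (hY : 0 < Y)
    (hU : U^2 = rho v Y) : U < beta v Y := by
  have h1 := curvePoly_eq h hv U
  have h2 := lead_pos h hv hY
  rw [hU] at h1
  unfold curvePoly at h1
  by_contra! hle
  have := mul_nonneg h2.le (mul_nonneg (sub_nonneg.2 hle) (sq_nonneg (cubicFactor v Y U)))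
  linarith

theorem curvePoly_le_one (h : Y^2 = (v - 1) * Y + v^3) (hv : 1 < v) (hY : 0 < Y) {y : ℝ}
    (hy : y ≤ beta v Y) : curvePoly v Y y ≤ 1 := by
  have := mul_nonneg (lead_pos h hv hY).le
    (mul_nonneg (sub_nonneg.2 hy) (sq_nonneg (cubicFactor v Y y)))
  unfold curvePoly
  linarith

theorem one_le_curvePoly (h : Y^2 = (v - 1) * Y + v^3) (hv : 1 < v) (hY : 0 < Y) {y : ℝ}
    (hy : beta v Y ≤ y) : 1 ≤ curvePoly v Y y := by
  have := mul_nonneg (lead_pos h hv hY).le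
    (mul_nonneg (sub_nonneg.2 hy) (sq_nonneg (cubicFactor v Y y)))
  unfold curvePoly
  linarith

theorem neg_one_le_curvePoly (h : Y^2 = (v - 1) * Y + v^3) (hv : 1 < v) (hY : 0 < Y) {y : ℝ}
    (hy : 0 ≤ (y^2 - rho v Y) * (y - alpha v Y)) : -1 ≤ curvePoly v Y y := by
  have := mul_nonneg (lead_pos h hv hY).le (mul_nonneg hy (sq_nonneg (quadFactor v Y y)))
  rw [curvePoly_eq h hv]
  linarith

theorem curvePoly_le_neg_one (h : Y^2 = (v - 1) * Y + v^3) (hv : 1 < v) (hY : 0 < Y) {y : ℝ}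
    (hy : (y^2 - rho v Y) * (y - alpha v Y) ≤ 0) : curvePoly v Y y ≤ -1 := by
  have := mul_nonneg (lead_pos h hv hY).le
    (mul_nonneg (neg_nonneg.2 hy) (sq_nonneg (quadFactor v Y y)))
  rw [curvePoly_eq h hv]
  linarith

theorem lt_alpha (h : Y^2 = (v - 1) * Y + v^3) (hv : 1 < v) (hY : 0 < Y)
    (hc : v^3 - 2 * v^2 - v + 1 < 0) (hU : U^2 = rho v Y) : U < alpha v Y := by
  refine lt_of_pow_lt_pow_left₀ 2 (alpha_pos h hv (lt_of_cubic_neg hv hc).le).le ?_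
  have h1 := mul_lt_of_cubic_neg h hv hY hc
  have h2 := alpha_sq_sub_rho h
  have h3 : 0 < 16 * v^3 * (2 * v^3 - v^2 - v + 1 - Y * (v^2 - 1)) :=
    mul_pos (by positivity) (by linarith)
  linarith

theorem abs_curvePoly_le_one (h : Y^2 = (v - 1) * Y + v^3) (hv : 1 < v) (hY : 0 < Y)
    (hc : v^3 - 2 * v^2 - v + 1 < 0) (hU : U^2 = rho v Y) {y : ℝ}
    (hy : y ∈ Icc (-U) U) : |curvePoly v Y y| ≤ 1 := by
  refine abs_le.2 ⟨neg_one_le_curvePoly h hv hY ?_,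
    curvePoly_le_one h hv hY (hy.2.trans (lt_beta h hv hY hU).le)⟩
  have h1 := lt_alpha h hv hY hc hU
  exact mul_nonneg_of_nonpos_of_nonpos (by nlinarith [hy.1, hy.2]) (by linarith [hy.2])

/-- The quadratic factor has two roots of opposite sign inside the interval. -/
theorem exists_quadFactor_roots (h : Y^2 = (v - 1) * Y + v^3) (hv : 1 < v) (hv' : v ≤ 9 / 4)
    (hY : 0 < Y) (hU0 : 0 < U) (hU : U^2 = rho v Y) :
    ∃ r₁ r₂ : ℝ, -U < r₁ ∧ r₁ < r₂ ∧ r₂ < U ∧ ∀ y, quadFactor v Y y = (y - r₁) * (y - r₂) := by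
  have hb := b₀_neg h hv hv' hY
  have hs := rho_add_b₀_pos h hv hv'
  have hd := quadFactor_mul_quadFactor_neg_pos h hv hv'
  -- Here Q(±U) = ρ + b₀ ± b₁U. The sum and the product of these two values are positive, hence so
  -- are both of them.
  have habs : |b₁ v Y * U| < rho v Y + b₀ v Y := by
    refine abs_lt_of_sq_lt_sq ?_ hs.le
    rw [mul_pow, hU]
    exact hd
  obtain ⟨hl, hr⟩ := abs_lt.1 habs
  have hz : quadFactor v Y 0 < 0 := by unfold quadFactor; linarith
  have hp : 0 < quadFactor v Y U := by unfold quadFactor; linarith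
  have hm : 0 < quadFactor v Y (-U) := by unfold quadFactor; rw [neg_sq]; linarith
  obtain ⟨r₁, hr₁, e₁⟩ := intermediate_value_Ioo' (by linarith : -U ≤ 0)
    (continuous_quadFactor (v := v) (Y := Y)).continuousOn ⟨hz, hm⟩
  obtain ⟨r₂, hr₂, e₂⟩ := intermediate_value_Ioo hU0.le
    (continuous_quadFactor (v := v) (Y := Y)).continuousOn ⟨hz, hp⟩
  have hlt : r₁ < r₂ := hr₁.2.trans hr₂.1
  refine ⟨r₁, r₂, hr₁.1, hlt, hr₂.2, fun y => ?_⟩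
  unfold quadFactor at e₁ e₂ ⊢
  have e3 : b₁ v Y = -(r₁ + r₂) := by
    have : (r₁ - r₂) * (b₁ v Y + (r₁ + r₂)) = 0 := by linear_combination e₁ - e₂
    rcases mul_eq_zero.1 this with h' | h' <;> linarith
  rw [e3] at e₁ ⊢
  linear_combination e₁

/-- Rolle's theorem, with the nonzero leading factor divided out. -/
theorem exists_deriv_factor_eq_zero (h : Y^2 = (v - 1) * Y + v^3) (hv : 1 < v) (hY : 0 < Y)
    {a b : ℝ} (hab : a < b) (he : curvePoly v Y a = curvePoly v Y b) :
    ∃ c ∈ Ioo a b, cubicFactor v Y c * ((7 * c - gamma7 v Y) * quadFactor v Y c) = 0 := by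
  obtain ⟨c, hc, e⟩ := exists_hasDerivAt_eq_zero hab continuous_curvePoly.continuousOn he
    fun y _ => hasDerivAt_curvePoly h y
  exact ⟨c, hc, (mul_eq_zero.1 e).resolve_left (lead_pos h hv hY).ne'⟩

theorem curvePoly_eq_one_of_cubicFactor {y : ℝ} (hy : cubicFactor v Y y = 0) :
    curvePoly v Y y = 1 := by
  simp [curvePoly, hy]

/-- The scaled polynomial alternates seven times between `-1` and `1`. -/
theorem exists_alternation (h : Y^2 = (v - 1) * Y + v^3) (hv : 1 < v) (hY : 0 < Y)
    (hc : v^3 - 2 * v^2 - v + 1 < 0) (hU0 : 0 < U) (hU : U^2 = rho v Y) :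
    ∃ y : Fin 7 → ℝ, StrictMono y ∧ (∀ i, y i ∈ Icc (-U) U) ∧
      ∀ i, curvePoly v Y (y i) = (-1) ^ ((i : ℕ) + 1) := by
  obtain ⟨r₁, r₂, h₁, h₂, h₃, hB⟩ :=
    exists_quadFactor_roots h hv (lt_of_cubic_neg hv hc).le hY hU0 hU
  have hα := lt_alpha h hv hY hc hU
  have hl : curvePoly v Y (-U) = -1 := by rw [curvePoly_eq h hv, neg_sq, hU]; ring
  have hr : curvePoly v Y U = -1 := by rw [curvePoly_eq h hv, hU]; ring
  have hα1 : curvePoly v Y (alpha v Y) = -1 := by rw [curvePoly_eq h hv]; ring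
  have hr₁ : curvePoly v Y r₁ = -1 := by rw [curvePoly_eq h hv, hB]; ring
  have hr₂ : curvePoly v Y r₂ = -1 := by rw [curvePoly_eq h hv, hB]; ring
  -- The values at U and α agree, so there is a critical point between them. The value there is at
  -- most -1, so it is not a root of C; both roots of Q lie left of U. Hence it is the zero of the
  -- linear factor, which therefore never occurs inside [-U, U].
  have hγ : 7 * U < gamma7 v Y := by
    obtain ⟨g, hg, e⟩ := exists_deriv_factor_eq_zero h hv hY hα (hr.trans hα1.symm)
    have hle := curvePoly_le_neg_one h hv hY (y := g)
      (mul_nonpos_of_nonneg_of_nonpos (by nlinarith [hg.1]) (by linarith [hg.2]))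
    rcases mul_eq_zero.1 e with e | e
    · rw [curvePoly_eq_one_of_cubicFactor e] at hle
      norm_num at hle
    rcases mul_eq_zero.1 e with e | e
    · linarith [hg.1]
    · rw [hB] at e
      have : 0 < (g - r₁) * (g - r₂) := mul_pos (by linarith [hg.1]) (by linarith [hg.1])
      exact absurd e this.ne'
  -- Between two points with value -1 that enclose no root of Q, a critical point can only be a root
  -- of C, where the value is 1.
  have key : ∀ a b, a < b → b ≤ U → curvePoly v Y a = -1 → curvePoly v Y b = -1 →
      (∀ c ∈ Ioo a b, c ≠ r₁ ∧ c ≠ r₂) → ∃ c ∈ Ioo a b, curvePoly v Y c = 1 := by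
    intro a b hab hb ha' hb' hne
    obtain ⟨c, hc, e⟩ := exists_deriv_factor_eq_zero h hv hY hab (ha'.trans hb'.symm)
    refine ⟨c, hc, ?_⟩
    rcases mul_eq_zero.1 e with e | e
    · exact curvePoly_eq_one_of_cubicFactor e
    rcases mul_eq_zero.1 e with e | e
    · linarith [hc.2]
    · rw [hB] at e
      rcases mul_eq_zero.1 e with e | e
      · exact absurd (sub_eq_zero.1 e) (hne c hc).1
      · exact absurd (sub_eq_zero.1 e) (hne c hc).2
  obtain ⟨x₁, hx₁, e₁⟩ := key (-U) r₁ h₁ (by linarith) hl hr₁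
    fun c hc => ⟨hc.2.ne, (hc.2.trans h₂).ne⟩
  obtain ⟨x₂, hx₂, e₂⟩ := key r₁ r₂ h₂ h₃.le hr₁ hr₂ fun c hc => ⟨hc.1.ne', hc.2.ne⟩
  obtain ⟨x₃, hx₃, e₃⟩ := key r₂ U h₃ le_rfl hr₂ hr
    fun c hc => ⟨(h₂.trans hc.1).ne', hc.1.ne'⟩
  obtain ⟨hx₁, hx₁'⟩ := hx₁
  obtain ⟨hx₂, hx₂'⟩ := hx₂
  obtain ⟨hx₃, hx₃'⟩ := hx₃
  refine ⟨![-U, x₁, r₁, x₂, r₂, x₃, U], ?_, ?_, ?_⟩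
  · rw [Fin.strictMono_iff_lt_succ]
    intro i
    fin_cases i <;> simp <;> assumption
  · intro i
    fin_cases i <;> simp <;> first | linarith | (constructor <;> linarith)
  · intro i
    fin_cases i <;> simp <;> norm_num <;> assumption

end ZolotarevCurve

end

noncomputable section

namespace SepticZolotarev

open ZolotarevCurve

/-! # Alternation implies optimality -/

theorem uniformNorm_le_iff {P : ℝ[X]} {c : ℝ} (hc : 0 ≤ c) :
    uniformNorm P ≤ c ↔ ∀ x ∈ Icc (-1 : ℝ) 1, |P.eval x| ≤ c := by
  rw [uniformNorm, ContinuousMap.norm_le _ hc]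
  simp

theorem abs_eval_le_uniformNorm (P : ℝ[X]) {x : ℝ} (hx : x ∈ Icc (-1 : ℝ) 1) :
    |P.eval x| ≤ uniformNorm P :=
  (uniformNorm_le_iff (norm_nonneg _)).1 le_rfl x hx

/-- Exactly the m - i factors with j > i are negative. -/
theorem prod_erase_sub_sign {m : ℕ} {x : Fin (m + 1) → ℝ} (hx : StrictMono x) (i : Fin (m + 1)) :
    0 < (-1) ^ (m - i : ℕ) * ∏ j ∈ Finset.univ.erase i, (x i - x j) := by
  have h1 : ∏ j ∈ Finset.univ.erase i, (if i < j then (-1 : ℝ) else 1) = (-1) ^ (m - i : ℕ) := by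
    rw [Finset.prod_ite, Finset.prod_const_one, mul_one, Finset.prod_const]
    congr 1
    rw [show (Finset.univ.erase i).filter (i < ·) = Finset.Ioi i by
      ext j; simp; exact fun h => h.ne', Fin.card_Ioi]
    simp
  rw [← h1, ← Finset.prod_mul_distrib]
  refine Finset.prod_pos fun j hj => ?_
  split_ifs with h
  · linarith [hx h]
  · have := hx (lt_of_le_of_ne (not_lt.1 h) (Finset.ne_of_mem_erase hj))
    linarith

/-- A polynomial of degree less than `m` which weakly alternates in sign at `m + 1` points
vanishes. -/
theorem eq_zero_of_alternating {m : ℕ} {D : ℝ[X]} (hD : D.degree < m) {x : Fin (m + 1) → ℝ}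
    (hx : StrictMono x) (hs : ∀ i : Fin (m + 1), 0 ≤ (-1) ^ (i : ℕ) * D.eval (x i)) : D = 0 := by
  have hcard : D.degree < (Finset.univ : Finset (Fin (m + 1))).card := by
    rw [Finset.card_univ, Fintype.card_fin]
    exact hD.trans (by exact_mod_cast Nat.lt_succ_self m)
  -- The coefficient of degree m, which is zero here, is the sum of the quotients D(xᵢ)/∏(xᵢ-xⱼ).
  -- Under the alternation hypothesis, all terms have the same weak sign, so each vanishes and D has
  -- m + 1 roots.
  have hcoeff := Lagrange.coeff_eq_sum (s := Finset.univ) (v := x) hx.injective.injOn (P := D)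
    hcard
  simp only [Finset.card_univ, Fintype.card_fin, add_tsub_cancel_right,
    coeff_eq_zero_of_degree_lt hD] at hcoeff
  have hnn : ∀ i : Fin (m + 1), 0 ≤ (-1 : ℝ) ^ m *
      (D.eval (x i) / ∏ j ∈ Finset.univ.erase i, (x i - x j)) := by
    intro i
    have h1 := prod_erase_sub_sign hx i
    have h2 : (-1 : ℝ) ^ m * (D.eval (x i) / ∏ j ∈ Finset.univ.erase i, (x i - x j)) =
        ((-1) ^ (i : ℕ) * D.eval (x i)) /
          ((-1) ^ (m - i : ℕ) * ∏ j ∈ Finset.univ.erase i, (x i - x j)) := by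
      have h3 : (-1 : ℝ) ^ m = (-1) ^ (i : ℕ) * (-1) ^ (m - i : ℕ) := by
        rw [← pow_add]; congr 1; omega
      have h4 : ((-1 : ℝ) ^ (m - i : ℕ)) * (-1) ^ (m - i : ℕ) = 1 := by
        rw [← mul_pow]; simp
      have h5 : ∏ j ∈ Finset.univ.erase i, (x i - x j) ≠ 0 := by
        intro h0; simp [h0] at h1
      rw [h3, eq_div_iff h1.ne', mul_div_assoc']
      field_simp
      linear_combination D.eval (x i) * h4
    rw [h2]
    exact div_nonneg (hs i) h1.le
  have hsum : ∑ i : Fin (m + 1), (-1 : ℝ) ^ m *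
      (D.eval (x i) / ∏ j ∈ Finset.univ.erase i, (x i - x j)) = 0 := by
    rw [← Finset.mul_sum, ← hcoeff, mul_zero]
  have hzero : ∀ i, D.eval (x i) = 0 := by
    intro i
    have h1 := (Finset.sum_eq_zero_iff_of_nonneg fun i _ => hnn i).1 hsum i (Finset.mem_univ i)
    have h2 := prod_erase_sub_sign hx i
    have h5 : ∏ j ∈ Finset.univ.erase i, (x i - x j) ≠ 0 := by
      intro h0; simp [h0] at h2
    rcases mul_eq_zero.1 h1 with h | h
    · exact absurd h (pow_ne_zero _ (by norm_num))
    · exact (div_eq_zero_iff.1 h).resolve_right h5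
  refine eq_zero_of_degree_lt_of_eval_index_eq_zero Finset.univ hx.injective.injOn hcard fun i _ =>
      hzero i

/-- A polynomial alternating at `m + 1` points is the only solution of Zolotarev's problem
in degree `m + 1`. -/
theorem isMonicZolotarev_iff_of_alternating {m : ℕ} {s : ℝ} {P : ℝ[X]}
    (hP : P ∈ admissible (m + 1) s) {x : Fin (m + 1) → ℝ} (hx : StrictMono x)
    (hmem : ∀ i, x i ∈ Icc (-1 : ℝ) 1)
    (halt : ∀ i : Fin (m + 1), P.eval (x i) = (-1) ^ ((i : ℕ) + 1) * uniformNorm P) (Q : ℝ[X]) :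
    IsMonicZolotarev (m + 1) s Q ↔ Q = P := by
  have key : ∀ Q ∈ admissible (m + 1) s, uniformNorm Q ≤ uniformNorm P → Q = P := by
    intro Q hQ hle
    rw [← sub_eq_zero]
    -- The two top coefficients of Q and P agree, so Q - P has degree less than m. This is why m + 1
    -- points are enough in degree m + 1. At each of them P takes its extreme value, so the sign of
    -- Q - P is weakly determined.
    refine eq_zero_of_alternating (m := m) ?_ hx fun i => ?_
    · rw [degree_lt_iff_coeff_zero]
      intro k hk
      rw [coeff_sub, sub_eq_zero]
      rcases lt_trichotomy k (m + 1) with h | h | h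
      · obtain rfl : k = m := by omega
        have h1 := hQ.2.2
        have h2 := hP.2.2
        rw [add_tsub_cancel_right] at h1 h2
        rw [h1, h2]
      · rw [h, hQ.2.1, hP.2.1]
      · rw [coeff_eq_zero_of_natDegree_lt (by rw [hQ.1]; exact h),
          coeff_eq_zero_of_natDegree_lt (by rw [hP.1]; exact h)]
    · have h1 := (abs_eval_le_uniformNorm Q (hmem i)).trans hle
      have h2 : ((-1 : ℝ) ^ (i : ℕ)) * (-1) ^ (i : ℕ) = 1 := by rw [← mul_pow]; simp
      have h3 : |(-1) ^ (i : ℕ) * Q.eval (x i)| ≤ uniformNorm P := by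
        rwa [abs_mul, abs_pow, abs_neg, abs_one, one_pow, one_mul]
      rw [eval_sub, halt i, pow_succ]
      have := (abs_le.1 h3).1
      linear_combination this - uniformNorm P * h2
  constructor
  · exact fun h => key Q h.1 (h.2 P hP)
  · rintro rfl
    refine ⟨hP, fun R hR => ?_⟩
    by_contra! hlt
    rw [key R hR hlt.le] at hlt
    exact lt_irrefl _ hlt

/-! # The coefficients in terms of the curve -/

/-- The first coordinate on the curve. -/
def vCoord (t : ℝ) : ℝ := -(t + 1) / 12

/-- The second coordinate on the curve. -/
def yCoord (t : ℝ) : ℝ := (ω t / 36 + vCoord t - 1) / 2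

/-- The scale by which `x` has to be multiplied. -/
def scale (t : ℝ) : ℝ := kappa (vCoord t) (yCoord t) * √(radSq (vCoord t) (yCoord t))

theorem eq_of_vCoord (t : ℝ) : t = -12 * vCoord t - 1 := by
  unfold vCoord; ring

theorem ω_eq (t : ℝ) : ω t = 36 * (2 * yCoord t - vCoord t + 1) := by
  unfold yCoord; ring

theorem q_eq (t : ℝ) : q t = 2^14 * 3^3 * 12^12 * vCoord t ^ 12 := by
  unfold q vCoord; ring

theorem radicand_ω_pos {t : ℝ} (ht : 1 < vCoord t) : 0 < 3 * (506 + 75 * t - t ^ 3) := by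
  have : 3 * (506 + 75 * t - t ^ 3) = 36^2 * ((vCoord t - 1)^2 + 4 * vCoord t ^ 3) := by
    unfold vCoord; ring
  rw [this]
  have : 0 < vCoord t := by linarith
  positivity

/-- Up to the factor 36², the radicand of ω is the discriminant (v-1)² + 4v³ of the curve equation
as a quadratic in Y. The choice of sign makes `yCoord t` its larger root. -/
theorem yCoord_sq {t : ℝ} (ht : 1 < vCoord t) :
    yCoord t ^ 2 = (vCoord t - 1) * yCoord t + vCoord t ^ 3 := by
  have h1 : ω t ^ 2 = 36^2 * ((vCoord t - 1)^2 + 4 * vCoord t ^ 3) := by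
    rw [ω, Real.sq_sqrt (radicand_ω_pos ht).le]
    unfold vCoord; ring
  unfold yCoord
  linear_combination h1 / 36^2 / 4

theorem yCoord_pos {t : ℝ} (ht : 1 < vCoord t) : 0 < yCoord t := by
  have : 0 ≤ ω t := Real.sqrt_nonneg _
  unfold yCoord
  linarith

theorem scale_pos {t : ℝ} (ht : 1 < vCoord t) : 0 < scale t :=
  mul_pos (kappa_pos ht (yCoord_pos ht)) (Real.sqrt_pos.2 (radSq_pos ht (yCoord_pos ht)))

theorem scale_sq {t : ℝ} (ht : 1 < vCoord t) : scale t ^ 2 = rho (vCoord t) (yCoord t) := by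
  rw [scale, mul_pow, Real.sq_sqrt (radSq_pos ht (yCoord_pos ht)).le,
    kappa_sq_mul_radSq (yCoord_sq ht) ht]

theorem q_pos {t : ℝ} (ht : 1 < vCoord t) : 0 < q t := by
  rw [q_eq]
  have : 0 < vCoord t := by linarith
  positivity

/-- Unlike for the other odd numerators, positivity comes from a product of positive quantities and
needs no upper bound for v. -/
theorem num₇_pos {v Y : ℝ} (h : Y^2 = (v - 1) * Y + v^3) (hv : 1 < v) (hY : 0 < Y) :
    0 < num₇ v Y := by
  have h1 := kappa_mul_lead_mul_rho_cube h hv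
  have h2 : 0 < kappa v Y * (lead v Y * rho v Y ^ 3) :=
    mul_pos (kappa_pos hv hY) (mul_pos (lead_pos h hv hY) (pow_pos (rho_pos hv hY) 3))
  rw [h1] at h2
  exact (div_pos_iff_of_pos_right (by positivity)).1 h2

variable {t : ℝ}

theorem sqrt_eq_of_sq_mul_eq {a v m r n : ℝ} (hv : 0 < v) (hm : 0 ≤ m) (hn : 0 ≤ n) (hr : 0 ≤ r)
    (h : v^2 * a = m^2 * (r * n^2)) : 0 ≤ a ∧ √a = m * √r * n / v := by
  have h1 : a = (m * √r * n / v)^2 := by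
    rw [div_pow, eq_div_iff (by positivity), mul_pow, mul_pow, Real.sq_sqrt hr]
    linear_combination h
  exact ⟨h1 ▸ sq_nonneg _, by rw [h1, Real.sqrt_sq (by positivity)]⟩

theorem p1_radicand (ht : 1 < vCoord t) (ht' : vCoord t ≤ 9 / 4) :
    0 ≤ p11 t + ω t * p12 t ∧ √(p11 t + ω t * p12 t) = (2^6 * 3^3 * 12^12) *
      √(radSq (vCoord t) (yCoord t)) * (-num₁ (vCoord t) (yCoord t)) / vCoord t := by
  have hY := yCoord_pos ht
  refine sqrt_eq_of_sq_mul_eq (by linarith) (by positivity)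
    (neg_pos.2 (num₁_neg ht ht' hY)).le (radSq_pos ht hY).le ?_
  have := p1_eq (yCoord_sq ht)
  rwa [← eq_of_vCoord, ← ω_eq, ← neg_sq (num₁ _ _)] at this

theorem p3_radicand (ht : 1 < vCoord t) (ht' : vCoord t ≤ 9 / 4) :
    0 ≤ p31 t + ω t * p32 t ∧ √(p31 t + ω t * p32 t) = (2^6 * 3^3 * 12^12) *
      √(radSq (vCoord t) (yCoord t)) * num₃ (vCoord t) (yCoord t) / vCoord t := by
  have hY := yCoord_pos ht
  refine sqrt_eq_of_sq_mul_eq (by linarith) (by positivity)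
    (num₃_pos ht ht' hY).le (radSq_pos ht hY).le ?_
  have := p3_eq (yCoord_sq ht)
  rwa [← eq_of_vCoord, ← ω_eq] at this

theorem p5_radicand (ht : 1 < vCoord t) (ht' : vCoord t ≤ 9 / 4) :
    0 ≤ p51 t + ω t * p52 t ∧ √(p51 t + ω t * p52 t) = (2^6 * 3^3 * 12^12) *
      √(radSq (vCoord t) (yCoord t)) * (-num₅ (vCoord t) (yCoord t)) / vCoord t := by
  have hY := yCoord_pos ht
  refine sqrt_eq_of_sq_mul_eq (by linarith) (by positivity)
    (neg_pos.2 (num₅_neg ht ht' hY)).le (radSq_pos ht hY).le ?_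
  have := p5_eq (yCoord_sq ht)
  rwa [← eq_of_vCoord, ← ω_eq, ← neg_sq (num₅ _ _)] at this

theorem p7_radicand (ht : 1 < vCoord t) :
    0 ≤ p71 t + ω t * p72 t ∧ √(p71 t + ω t * p72 t) = (2^6 * 3^3 * 12^12) *
      √(radSq (vCoord t) (yCoord t)) * num₇ (vCoord t) (yCoord t) / vCoord t := by
  have hY := yCoord_pos ht
  refine sqrt_eq_of_sq_mul_eq (by linarith) (by positivity)
    (num₇_pos (yCoord_sq ht) ht hY).le (radSq_pos ht hY).le ?_
  have := p7_eq (yCoord_sq ht)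
  rwa [← eq_of_vCoord, ← ω_eq] at this

theorem even_coeff_eq {v n a c : ℝ} (hv : 0 < v) (ha : a = (2^6 * 3^3 * 12^12) * n)
    (hc : c = n / (256 * v^12)) : a / (2^14 * 3^3 * 12^12 * v^12) = c := by
  rw [ha, hc, div_eq_div_iff (by positivity) (by positivity)]
  ring

theorem odd_coeff_eq {v n a r c : ℝ} (hv : 0 < v) (ha : a = (2^6 * 3^3 * 12^12) * r * n / v)
    (hc : c = n / (256 * v^13)) : a / (2^14 * 3^3 * 12^12 * v^12) = r * c := by
  rw [ha, hc, div_div, mul_div_assoc', div_eq_div_iff (by positivity) (by positivity)]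
  ring

theorem b_zero_eq (ht : 1 < vCoord t) (v Y : ℝ) (hv : v = vCoord t) (hY : Y = yCoord t) :
    b 0 t = 1 + lead v Y * (-(beta v Y * (c₀ v Y * c₀ v Y))) := by
  subst hv hY
  rw [b, q_eq]
  refine even_coeff_eq (by linarith) ?_ (coeff₀_eq (yCoord_sq ht) ht)
  rw [← p0_eq, ← eq_of_vCoord, ← ω_eq]

theorem b_two_eq (ht : 1 < vCoord t) (v Y : ℝ) (hv : v = vCoord t) (hY : Y = yCoord t) :
    b 2 t = lead v Y * scale t ^ 2 * (2 * (c₀ v Y * c₁ v Y) -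
      beta v Y * (c₁ v Y * c₁ v Y + 2 * (c₀ v Y * c₂ v Y))) := by
  subst hv hY
  rw [b, q_eq, scale_sq ht]
  refine even_coeff_eq (by linarith) ?_ (coeff₂_eq (yCoord_sq ht) ht)
  rw [← p2_eq, ← eq_of_vCoord, ← ω_eq]

theorem b_four_eq (ht : 1 < vCoord t) (v Y : ℝ) (hv : v = vCoord t) (hY : Y = yCoord t) :
    b 4 t = lead v Y * scale t ^ 4 * (2 * c₀ v Y + 2 * (c₂ v Y * c₁ v Y) -
      beta v Y * (c₂ v Y * c₂ v Y + 2 * c₁ v Y)) := by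
  subst hv hY
  rw [b, q_eq, show scale t ^ 4 = (scale t ^ 2) ^ 2 by ring, scale_sq ht]
  refine even_coeff_eq (by linarith) ?_ (coeff₄_eq (yCoord_sq ht) ht)
  rw [← p4_eq, ← eq_of_vCoord, ← ω_eq]

theorem b_six_eq (ht : 1 < vCoord t) (v Y : ℝ) (hv : v = vCoord t) (hY : Y = yCoord t) :
    b 6 t = lead v Y * scale t ^ 6 * (2 * c₂ v Y - beta v Y) := by
  subst hv hY
  rw [b, q_eq, show scale t ^ 6 = (scale t ^ 2) ^ 3 by ring, scale_sq ht]
  refine even_coeff_eq (by linarith) ?_ (coeff₆_eq (yCoord_sq ht) ht)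
  rw [← p6_eq, ← eq_of_vCoord, ← ω_eq]

theorem b_one_eq (ht : 1 < vCoord t) (ht' : vCoord t ≤ 9 / 4) (v Y : ℝ) (hv : v = vCoord t)
    (hY : Y = yCoord t) : b 1 t = lead v Y * scale t * (c₀ v Y * c₀ v Y -
      2 * beta v Y * (c₀ v Y * c₁ v Y)) := by
  subst hv hY
  rw [b, q_eq, (p1_radicand ht ht').2, odd_coeff_eq (by linarith) (by ring)
    (coeff₁_eq (yCoord_sq ht) ht), scale]
  ring

theorem b_three_eq (ht : 1 < vCoord t) (ht' : vCoord t ≤ 9 / 4) (v Y : ℝ) (hv : v = vCoord t)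
    (hY : Y = yCoord t) : b 3 t = lead v Y * scale t ^ 3 * (c₁ v Y * c₁ v Y +
      2 * (c₀ v Y * c₂ v Y) - beta v Y * (2 * c₀ v Y + 2 * (c₂ v Y * c₁ v Y))) := by
  subst hv hY
  rw [b, q_eq, (p3_radicand ht ht').2, odd_coeff_eq (by linarith) rfl
    (coeff₃_eq (yCoord_sq ht) ht), pow_succ, scale_sq ht, scale]
  ring

theorem b_five_eq (ht : 1 < vCoord t) (ht' : vCoord t ≤ 9 / 4) (v Y : ℝ) (hv : v = vCoord t)
    (hY : Y = yCoord t) : b 5 t = lead v Y * scale t ^ 5 * (c₂ v Y * c₂ v Y + 2 * c₁ v Y -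
      2 * beta v Y * c₂ v Y) := by
  subst hv hY
  rw [b, q_eq, (p5_radicand ht ht').2, odd_coeff_eq (by linarith) (by ring)
    (coeff₅_eq (yCoord_sq ht) ht), show scale t ^ 5 = (scale t ^ 2) ^ 2 * scale t by ring,
    scale_sq ht, scale]
  ring

theorem b_seven_eq (ht : 1 < vCoord t) :
    b 7 t = lead (vCoord t) (yCoord t) * scale t ^ 7 := by
  rw [b, q_eq, (p7_radicand ht).2, odd_coeff_eq (by linarith) rfl
    (kappa_mul_lead_mul_rho_cube (yCoord_sq ht) ht),
    show scale t ^ 7 = (scale t ^ 2) ^ 3 * scale t by ring, scale_sq ht, scale]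
  ring

theorem b_seven_pos (ht : 1 < vCoord t) : 0 < b 7 t := by
  rw [b_seven_eq ht]
  exact mul_pos (lead_pos (yCoord_sq ht) ht (yCoord_pos ht)) (pow_pos (scale_pos ht) 7)

theorem eval_Z7 (t x : ℝ) : (Z7 t).eval x = b 0 t + b 1 t * x + b 2 t * x^2 + b 3 t * x^3 +
    b 4 t * x^4 + b 5 t * x^5 + b 6 t * x^6 + b 7 t * x^7 := by
  simp [Z7, Finset.sum_range_succ]

/-- The bridge between the explicit formula and the Pell structure: from here on, properties of `Z7
t` on [-1, 1] are read off from `curvePoly` on [-U, U]. -/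
theorem eval_Z7_eq_curvePoly (ht : 1 < vCoord t) (ht' : vCoord t ≤ 9 / 4) (x : ℝ) :
    (Z7 t).eval x = curvePoly (vCoord t) (yCoord t) (scale t * x) := by
  rw [eval_Z7, b_zero_eq ht _ _ rfl rfl, b_one_eq ht ht' _ _ rfl rfl, b_two_eq ht _ _ rfl rfl,
    b_three_eq ht ht' _ _ rfl rfl, b_four_eq ht _ _ rfl rfl, b_five_eq ht ht' _ _ rfl rfl,
    b_six_eq ht _ _ rfl rfl, b_seven_eq ht]
  unfold curvePoly cubicFactor
  ring

/-! # The left end of the parameter interval -/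

/-- Twice the cosine of `π / 7`. -/
def twoCos : ℝ := 2 * Real.cos (Real.pi / 7)

theorem twoCos_bounds : 1.79 < twoCos ∧ twoCos < 2 := by
  have h1 := Real.one_sub_sq_div_two_le_cos (x := Real.pi / 7)
  have h2 := Real.pi_lt_d2
  have h3 := Real.pi_pos
  refine ⟨?_, ?_⟩
  · unfold twoCos
    nlinarith
  · have : Real.cos (Real.pi / 7) < Real.cos 0 :=
      Real.cos_lt_cos_of_nonneg_of_le_pi_div_two le_rfl (by linarith) (by positivity)
    rw [Real.cos_zero] at this
    unfold twoCos
    linarith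

/-- For the angle π/7 one has cos 4x = -cos 3x. As a quartic in 2cos x this splits off the factor
2cos x + 2, which is not zero. -/
theorem twoCos_cubic : twoCos ^ 3 = twoCos ^ 2 + 2 * twoCos - 1 := by
  have h3 := Real.cos_three_mul (Real.pi / 7)
  have h2 := Real.cos_two_mul (Real.pi / 7)
  have h4 := Real.cos_two_mul (2 * (Real.pi / 7))
  have h5 : Real.cos (2 * (2 * (Real.pi / 7))) = -Real.cos (3 * (Real.pi / 7)) := by
    rw [← Real.cos_pi_sub]; congr 1; ring
  rw [h5, h3, h2] at h4
  have h6 : (twoCos + 2) * (twoCos ^ 3 - (twoCos ^ 2 + 2 * twoCos - 1)) = 0 := by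
    unfold twoCos
    linear_combination -2 * h4
  have h7 := twoCos_bounds.1
  rcases mul_eq_zero.1 h6 with h | h <;> linarith

theorem cos_pi_div_fourteen_sq : Real.cos (Real.pi / 14) ^ 2 = (twoCos + 2) / 4 := by
  rw [Real.cos_sq, twoCos, show 2 * (Real.pi / 14) = Real.pi / 7 by ring]
  ring

theorem tan_pi_div_fourteen_sq :
    Real.tan (Real.pi / 14) ^ 2 = (2 - twoCos) / (twoCos + 2) := by
  have h1 := twoCos_bounds.1
  rw [Real.tan_eq_sin_div_cos, div_pow, Real.sin_sq, cos_pi_div_fourteen_sq,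
    div_eq_div_iff (by positivity) (by positivity)]
  ring

/-- The left end of the parameter interval. -/
def leftEnd : ℝ := -12 * (twoCos ^ 2 - 1) - 1

theorem vCoord_leftEnd : vCoord leftEnd = twoCos ^ 2 - 1 := by
  unfold vCoord leftEnd; ring

theorem leftEnd_root : leftEnd ^ 3 + 27 * leftEnd ^ 2 - 93 * leftEnd - 1847 = 0 := by
  unfold leftEnd
  linear_combination (-1728 * (-1 - 2 * twoCos + twoCos^2 + twoCos^3)) * twoCos_cubic

theorem leftEnd_rough : -37 < leftEnd ∧ leftEnd < -27 := by
  obtain ⟨h1, h2⟩ := twoCos_bounds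
  unfold leftEnd
  constructor <;> nlinarith

theorem leftEnd_mem : leftEnd ∈ Ioo (-27.963756 : ℝ) (-27.963755) := by
  obtain ⟨h1, h2⟩ := leftEnd_rough
  have h := leftEnd_root
  constructor
  · by_contra! hle
    have h3 : 0 < leftEnd ^ 2 + leftEnd * (-27.963756) + (-27.963756) ^ 2 +
        27 * (leftEnd + (-27.963756)) - 93 := by nlinarith
    nlinarith [mul_nonneg (sub_nonneg.2 hle) h3.le]
  · by_contra! hle
    have h3 : 0 < leftEnd ^ 2 + leftEnd * (-27.963755) + (-27.963755) ^ 2 +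
        27 * (leftEnd + (-27.963755)) - 93 := by nlinarith
    nlinarith [mul_nonneg (sub_nonneg.2 hle) h3.le]

theorem isLeast_leftEnd :
    IsLeast {x : ℝ | x ^ 3 + 27 * x ^ 2 - 93 * x - 1847 = 0} leftEnd := by
  refine ⟨leftEnd_root, fun x hx => ?_⟩
  obtain ⟨h1, h2⟩ := leftEnd_rough
  have h := leftEnd_root
  rw [mem_ofPred_eq] at hx
  by_contra! hlt
  have h3 : 0 < x ^ 2 + x * leftEnd + leftEnd ^ 2 + 27 * (x + leftEnd) - 93 := by nlinarith
  nlinarith [mul_pos (sub_pos.2 hlt) h3]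

/-- The value of v at θ is about 2.247; 9/4 is the convenient upper bound used by the sign lemmas.
-/
theorem vCoord_le {t : ℝ} (ht : leftEnd ≤ t) : vCoord t ≤ 9 / 4 := by
  have := leftEnd_mem.1
  unfold vCoord
  linarith

theorem one_lt_vCoord {t : ℝ} (ht : t < -13) : 1 < vCoord t := by
  unfold vCoord
  linarith

/-- Multiplied by -1728, the cubic in v becomes t³ + 27t² - 93t - 1847, which vanishes at θ and has
a positive difference quotient between θ and t. -/
theorem cubic_neg {t : ℝ} (ht : t ∈ Ioo leftEnd (-13)) :
    vCoord t ^ 3 - 2 * vCoord t ^ 2 - vCoord t + 1 < 0 := by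
  obtain ⟨h1, h2⟩ := leftEnd_mem
  have h := leftEnd_root
  have h3 : 0 < t ^ 2 + t * leftEnd + leftEnd ^ 2 + 27 * (t + leftEnd) - 93 := by
    nlinarith [ht.1, ht.2, mul_pos (neg_pos.2 (ht.2.trans (by norm_num : (-13 : ℝ) < 0)))
      (by linarith : 0 < -(leftEnd + 27))]
  have h4 := mul_pos (sub_pos.2 ht.1) h3
  unfold vCoord
  nlinarith

theorem one_lt_vCoord_leftEnd : 1 < vCoord leftEnd :=
  one_lt_vCoord (leftEnd_rough.2.trans (by norm_num))

theorem yCoord_leftEnd : yCoord leftEnd = twoCos ^ 2 + twoCos - 1 := by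
  have h1 := yCoord_sq one_lt_vCoord_leftEnd
  have h2 := yCoord_pos one_lt_vCoord_leftEnd
  have h3 := twoCos_bounds.1
  rw [vCoord_leftEnd] at h1
  -- Over v = k² - 1 the two points of the curve have Y = k² + k - 1 and Y = -k - 1, and only the
  -- first is positive.
  have h4 : (yCoord leftEnd - (twoCos ^ 2 + twoCos - 1)) * (yCoord leftEnd + twoCos + 1) = 0 := by
    linear_combination h1 + (twoCos ^ 2 + twoCos ^ 3) * twoCos_cubic
  rcases mul_eq_zero.1 h4 with h | h <;> linarith

theorem scale_leftEnd : scale leftEnd = 11 * twoCos ^ 2 + 8 * twoCos - 7 := by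
  have h1 := scale_sq one_lt_vCoord_leftEnd
  have h2 := scale_pos one_lt_vCoord_leftEnd
  have h3 := twoCos_bounds.1
  rw [vCoord_leftEnd, yCoord_leftEnd] at h1
  refine (pow_left_inj₀ h2.le (by nlinarith) two_ne_zero).1 ?_
  rw [h1]
  have hk := twoCos_cubic
  generalize twoCos = k at *
  unfold rho
  linear_combination (-49 + 14 * k + 69 * k^2 + 41 * k^3 + 48 * k^4 + 28 * k^5 - 17 * k^6 -
    10 * k^7 + 11 * k^8 + 5 * k^9 + k^10 + k^11) * hk

/-- These relations say that y = (1+x)(k+2)/4 - 1 carries β/U to 1, and that C(Ux) becomes a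
multiple of 8y³ + 4y² - 4y - 1, the cubic whose square divides T₇ - 1. -/
theorem endpoint_data {k U : ℝ} (hk : k ^ 3 = k ^ 2 + 2 * k - 1) (hU : U = 11 * k ^ 2 + 8 * k - 7) :
    (k + 2) * beta (k^2 - 1) (k^2 + k - 1) = U * (6 - k) ∧
    (k + 2) * c₂ (k^2 - 1) (k^2 + k - 1) = U * (3 * k - 4) ∧
    (k + 2)^2 * c₁ (k^2 - 1) (k^2 + k - 1) = U^2 * (3 * (k - 2)^2 + 4 * (k - 2) - 8) ∧
    (k + 2)^3 * c₀ (k^2 - 1) (k^2 + k - 1) =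
      U^3 * ((k - 2)^3 + 2 * (k - 2)^2 - 8 * (k - 2) - 8) := by
  subst hU
  have e : beta (k^2 - 1) (k^2 + k - 1) = 13 * k^2 + 8 * k - 9 := by
    unfold beta
    linear_combination (5 + 2 * k + 4 * k^2 + 3 * k^3) * hk
  have e₂ : c₂ (k^2 - 1) (k^2 + k - 1) = 3 * k^2 + 4 * k - 1 := by
    unfold c₂
    linear_combination (5 + 6 * k - 3 * k^3) * hk
  have e₁ : c₁ (k^2 - 1) (k^2 + k - 1) = -269 * k^2 - 217 * k + 148 := by
    unfold c₁
    linear_combination (-148 - 79 * k - 37 * k^2 - 25 * k^3 - 48 * k^4 - 28 * k^5 + 37 * k^6 +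
      26 * k^7 - 23 * k^8 - 17 * k^9 + 3 * k^10 + 3 * k^11) * hk
  have e₀ : c₀ (k^2 - 1) (k^2 + k - 1) = -2239 * k^2 - 1796 * k + 1242 := by
    unfold c₀
    linear_combination (-1242 - 688 * k - 379 * k^2 - 236 * k^3 - 227 * k^4 - 119 * k^5 +
      267 * k^6 + 282 * k^7 - 378 * k^8 - 469 * k^9 + 238 * k^10 + 353 * k^11 - 95 * k^12 -
      153 * k^13 + 22 * k^14 + 36 * k^15 - 3 * k^16 - 4 * k^17) * hk
  refine ⟨?_, ?_, ?_, ?_⟩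
  · rw [e]; linear_combination 24 * hk
  · rw [e₂]; linear_combination -30 * hk
  · rw [e₁]; linear_combination (788 + 1244 * k + 77 * k^2 - 363 * k^3) * hk
  · rw [e₀]
    linear_combination (12680 + 15116 * k + 12048 * k^2 + 21741 * k^3 + 15796 * k^4 +
      1089 * k^5 - 1331 * k^6) * hk

theorem eval_T_six (x : ℝ) :
    (Chebyshev.T ℝ 6).eval x = -1 + 18 * x ^ 2 - 48 * x ^ 4 + 32 * x ^ 6 := by
  have e2 := Chebyshev.T_add_two ℝ 0
  have e3 := Chebyshev.T_add_two ℝ 1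
  have e4 := Chebyshev.T_add_two ℝ 2
  have e5 := Chebyshev.T_add_two ℝ 3
  have e6 := Chebyshev.T_add_two ℝ 4
  norm_num at e2 e3 e4 e5 e6
  rw [e6, e5, e4, e3, e2]
  simp
  ring

theorem eval_T_seven (x : ℝ) :
    (Chebyshev.T ℝ 7).eval x = -7 * x + 56 * x ^ 3 - 112 * x ^ 5 + 64 * x ^ 7 := by
  have e2 := Chebyshev.T_add_two ℝ 0
  have e3 := Chebyshev.T_add_two ℝ 1
  have e4 := Chebyshev.T_add_two ℝ 2
  have e5 := Chebyshev.T_add_two ℝ 3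
  have e6 := Chebyshev.T_add_two ℝ 4
  have e7 := Chebyshev.T_add_two ℝ 5
  norm_num at e2 e3 e4 e5 e6 e7
  rw [e7, e6, e5, e4, e3, e2]
  simp
  ring

theorem eval_Z7_leftEnd (x : ℝ) :
    (Z7 leftEnd).eval x =
      (Chebyshev.T ℝ 7).eval ((1 + x) * Real.cos (Real.pi / 14) ^ 2 - 1) := by
  have hk := twoCos_cubic
  have h3 := twoCos_bounds.1
  have hv := one_lt_vCoord_leftEnd
  rw [eval_Z7_eq_curvePoly hv (vCoord_le le_rfl), eval_T_seven, cos_pi_div_fourteen_sq]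
  have h := yCoord_sq hv
  have hs := scale_sq hv
  obtain ⟨e, e₂, e₁, e₀⟩ := endpoint_data hk scale_leftEnd
  have hl : curvePoly (vCoord leftEnd) (yCoord leftEnd) (-scale leftEnd) = -1 := by
    rw [curvePoly_eq h hv, neg_sq, hs]; ring
  rw [vCoord_leftEnd, yCoord_leftEnd] at hl ⊢
  generalize twoCos = k at *
  generalize scale leftEnd = U at *
  have hC : ∀ x, (k + 2)^3 * cubicFactor (k^2 - 1) (k^2 + k - 1) (U * x) =
      8 * U^3 * (8 * ((1 + x) * ((k + 2) / 4) - 1)^3 + 4 * ((1 + x) * ((k + 2) / 4) - 1)^2 -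
        4 * ((1 + x) * ((k + 2) / 4) - 1) - 1) := by
    intro x
    unfold cubicFactor
    linear_combination (k + 2)^2 * (U * x)^2 * e₂ + (k + 2) * (U * x) * e₁ + e₀
  have hlin : ∀ x, (k + 2) * (U * x - beta (k^2 - 1) (k^2 + k - 1)) =
      4 * U * (((1 + x) * ((k + 2) / 4) - 1) - 1) := by
    intro x
    linear_combination -e
  have hL : ∀ x, (k + 2)^7 * (curvePoly (k^2 - 1) (k^2 + k - 1) (U * x) - 1) =
      256 * (lead (k^2 - 1) (k^2 + k - 1) * U^7) * ((((1 + x) * ((k + 2) / 4) - 1) - 1) *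
      (8 * ((1 + x) * ((k + 2) / 4) - 1)^3 + 4 * ((1 + x) * ((k + 2) / 4) - 1)^2 -
        4 * ((1 + x) * ((k + 2) / 4) - 1) - 1)^2) := by
    intro x
    have : (k + 2)^7 * (curvePoly (k^2 - 1) (k^2 + k - 1) (U * x) - 1) =
        lead (k^2 - 1) (k^2 + k - 1) * (((k + 2) * (U * x - beta (k^2 - 1) (k^2 + k - 1))) *
        ((k + 2)^3 * cubicFactor (k^2 - 1) (k^2 + k - 1) (U * x))^2) := by
      unfold curvePoly
      ring
    rw [this, hC, hlin]
    ring
  -- The leading factor is not computed but found by comparison at x = -1: there the polynomial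
  -- takes the value -1, and so does T₇ at y = -1.
  have hlead : 256 * (lead (k^2 - 1) (k^2 + k - 1) * U^7) = (k + 2)^7 := by
    have h1 := hL (-1)
    rw [mul_neg_one, hl] at h1
    linear_combination h1 / 2
  have h2 := hL x
  rw [hlead] at h2
  have h5 := mul_left_cancel₀ (pow_ne_zero 7 (by linarith : k + 2 ≠ 0)) h2
  linear_combination h5

theorem s7_leftEnd : s7 leftEnd = Real.tan (Real.pi / 14) ^ 2 := by
  have hk := twoCos_cubic
  have h3 := twoCos_bounds.1
  have hv := one_lt_vCoord_leftEnd
  have hU := scale_pos hv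
  have hl := lead_pos (yCoord_sq hv) hv (yCoord_pos hv)
  obtain ⟨e, e₂, -, -⟩ := endpoint_data hk scale_leftEnd
  rw [tan_pi_div_fourteen_sq, s7, a, b_six_eq hv _ _ rfl rfl, b_seven_eq hv]
  rw [vCoord_leftEnd, yCoord_leftEnd] at hl ⊢
  rw [div_eq_div_iff (by norm_num) (by positivity), ← neg_div, div_mul_eq_mul_div,
    div_eq_iff (by positivity)]
  -- The quotient of the two top coefficients involves only β - 2c₂.
  linear_combination lead (twoCos ^ 2 - 1) (twoCos ^ 2 + twoCos - 1) * scale leftEnd ^ 6 *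
    (e - 2 * e₂)

/-! # Optimality of the explicit polynomials -/

theorem uniformNorm_C_mul (c : ℝ) (P : ℝ[X]) : uniformNorm (C c * P) = |c| * uniformNorm P := by
  rw [uniformNorm, uniformNorm, ← Real.norm_eq_abs, ← norm_smul]
  congr 1
  ext x
  simp

theorem monicZ7_eq (t : ℝ) : monicZ7 t = C (b 7 t)⁻¹ * Z7 t := by
  rw [monicZ7, Z7, Finset.mul_sum]
  refine Finset.sum_congr rfl fun k _ => ?_
  rw [← mul_assoc, ← C_mul, a, div_eq_inv_mul]

theorem coeff_monicZ7 (t : ℝ) {k : ℕ} (hk : k < 8) : (monicZ7 t).coeff k = a k t := by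
  simp only [monicZ7, finsetSum_coeff, coeff_C_mul, coeff_X_pow]
  simp [hk]

theorem monicZ7_mem_admissible (ht : 1 < vCoord t) : monicZ7 t ∈ admissible 7 (s7 t) := by
  have h7 : (monicZ7 t).coeff 7 = 1 := by
    rw [coeff_monicZ7 t (by norm_num), a, div_self (b_seven_pos ht).ne']
  refine ⟨natDegree_eq_of_le_of_coeff_ne_zero ?_ (by rw [h7]; exact one_ne_zero), h7, ?_⟩
  · refine natDegree_sum_le_of_forall_le _ _ fun k hk => (natDegree_C_mul_X_pow_le _ _).trans ?_
    have := Finset.mem_range.1 hk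
    omega
  · rw [coeff_monicZ7 t (by norm_num), s7]
    push_cast
    ring

theorem mapsTo_scale {x U : ℝ} (hU : 0 < U) : U * x ∈ Icc (-U) U ↔ x ∈ Icc (-1 : ℝ) 1 := by
  constructor
  · rintro ⟨h1, h2⟩
    constructor <;> nlinarith
  · rintro ⟨h1, h2⟩
    constructor <;> nlinarith

/-- The alternation points of the scaled polynomial, divided by the scale. Here t > θ enters through
`cubic_neg`. -/
theorem exists_alternation_Z7 (ht : t ∈ Ioo leftEnd (-13)) :
    ∃ x : Fin 7 → ℝ, StrictMono x ∧ (∀ i, x i ∈ Icc (-1 : ℝ) 1) ∧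
      ∀ i, (Z7 t).eval (x i) = (-1) ^ ((i : ℕ) + 1) := by
  have hv := one_lt_vCoord ht.2
  have hU := scale_pos hv
  obtain ⟨y, hy, hmem, halt⟩ := exists_alternation (yCoord_sq hv) hv (yCoord_pos hv)
    (cubic_neg ht) hU (scale_sq hv)
  have e : ∀ i, scale t * (y i / scale t) = y i := fun i => by field_simp
  refine ⟨fun i => y i / scale t, fun i j hij => div_lt_div_of_pos_right (hy hij) hU,
    fun i => ?_, fun i => ?_⟩
  · rw [← mapsTo_scale hU, e]
    exact hmem i
  · rw [eval_Z7_eq_curvePoly hv (vCoord_le ht.1.le), e]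
    exact halt i

theorem uniformNorm_Z7 (ht : t ∈ Ioo leftEnd (-13)) : uniformNorm (Z7 t) = 1 := by
  have hv := one_lt_vCoord ht.2
  have hU := scale_pos hv
  refine le_antisymm ((uniformNorm_le_iff zero_le_one).2 fun x hx => ?_) ?_
  · rw [eval_Z7_eq_curvePoly hv (vCoord_le ht.1.le)]
    exact abs_curvePoly_le_one (yCoord_sq hv) hv (yCoord_pos hv) (cubic_neg ht) (scale_sq hv)
      ((mapsTo_scale hU).2 hx)
  · obtain ⟨x, -, hmem, halt⟩ := exists_alternation_Z7 ht
    have := abs_eval_le_uniformNorm (Z7 t) (hmem 0)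
    rw [halt 0] at this
    simpa using this

theorem uniformNorm_monicZ7 (ht : t ∈ Ioo leftEnd (-13)) :
    uniformNorm (monicZ7 t) = (b 7 t)⁻¹ := by
  rw [monicZ7_eq, uniformNorm_C_mul, uniformNorm_Z7 ht, mul_one,
    abs_of_pos (inv_pos.2 (b_seven_pos (one_lt_vCoord ht.2)))]

theorem isMonicZolotarev_iff (ht : t ∈ Ioo leftEnd (-13)) (P : ℝ[X]) :
    IsMonicZolotarev 7 (s7 t) P ↔ P = monicZ7 t := by
  obtain ⟨x, hx, hmem, halt⟩ := exists_alternation_Z7 ht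
  refine isMonicZolotarev_iff_of_alternating (m := 6)
    (monicZ7_mem_admissible (one_lt_vCoord ht.2)) hx hmem (fun i => ?_) P
  rw [uniformNorm_monicZ7 ht, monicZ7_eq, eval_mul, eval_C, halt i, mul_comm]

theorem C_mul_monicZ7 (ht : t ∈ Ioo leftEnd (-13)) :
    C (uniformNorm (monicZ7 t))⁻¹ * monicZ7 t = Z7 t := by
  rw [uniformNorm_monicZ7 ht, inv_inv, monicZ7_eq, ← mul_assoc, ← C_mul,
    mul_inv_cancel₀ (b_seven_pos (one_lt_vCoord ht.2)).ne', C_1, one_mul]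

/-! # Injectivity of the parametrization -/

theorem cubicFactor_ne_zero_of_interval {v Y U a c : ℝ} (hU : 0 < U) (hac : a < c)
    (h : ∀ x ∈ Icc a c, cubicFactor v Y (U * x) = 0) : False := by
  have h0 := h a ⟨le_rfl, hac.le⟩
  have h1 := h (a + (c - a) / 3) ⟨by linarith, by linarith⟩
  have h2 := h (a + 2 * (c - a) / 3) ⟨by linarith, by linarith⟩
  have h3 := h c ⟨hac.le, le_rfl⟩
  unfold cubicFactor at h0 h1 h2 h3
  -- The third difference of a monic cubic with step h is 6h³; here h = U(c-a)/3, so the factor 9/2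
  -- restores the full cube.
  have : (U * (c - a))^3 = 0 := by
    linear_combination 9 / 2 * (h3 - 3 * h2 + 3 * h1 - h0)
  exact (pow_pos (mul_pos hU (sub_pos.2 hac)) 3).ne' this

theorem quadFactor_ne_zero_of_interval {v Y U a c : ℝ} (hU : 0 < U) (hac : a < c)
    (h : ∀ x ∈ Icc a c, quadFactor v Y (U * x) = 0) : False := by
  have h0 := h a ⟨le_rfl, hac.le⟩
  have h1 := h ((a + c) / 2) ⟨by linarith, by linarith⟩
  have h2 := h c ⟨hac.le, le_rfl⟩
  unfold quadFactor at h0 h1 h2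
  have : (U * (c - a))^2 = 0 := by
    linear_combination 2 * (h2 - 2 * h1 + h0)
  exact (pow_pos (mul_pos hU (sub_pos.2 hac)) 2).ne' this

/-- The last end point of the inverse image of `[-1, 1]`. -/
def betaRoot (t : ℝ) : ℝ := beta (vCoord t) (yCoord t) / scale t

/-- The third end point of the inverse image of `[-1, 1]`. -/
def alphaRoot (t : ℝ) : ℝ := alpha (vCoord t) (yCoord t) / scale t

/-- To the right of its own β the polynomial is at least 1, while left of β the first form allows 1
only at roots of C. Two different values of β/U for one polynomial would make a monic cubic vanish
on an interval. -/
theorem betaRoot_le {t₁ t₂ : ℝ} (h₁ : t₁ ∈ Ioo leftEnd (-13)) (h₂ : t₂ ∈ Ioo leftEnd (-13))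
    (h : Z7 t₁ = Z7 t₂) : betaRoot t₂ ≤ betaRoot t₁ := by
  by_contra! hlt
  have hv₁ := one_lt_vCoord h₁.2
  have hv₂ := one_lt_vCoord h₂.2
  have hU₁ := scale_pos hv₁
  have hU₂ := scale_pos hv₂
  have hl := lead_pos (yCoord_sq hv₂) hv₂ (yCoord_pos hv₂)
  obtain ⟨c, hc₁, hc₂⟩ := exists_between hlt
  refine cubicFactor_ne_zero_of_interval (v := vCoord t₂) (Y := yCoord t₂) hU₂ hc₁ fun x hx => ?_
  have e1 : 1 ≤ curvePoly (vCoord t₁) (yCoord t₁) (scale t₁ * x) :=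
    one_le_curvePoly (yCoord_sq hv₁) hv₁ (yCoord_pos hv₁)
      (by rw [mul_comm]; exact (div_le_iff₀ hU₁).1 hx.1)
  rw [← eval_Z7_eq_curvePoly hv₁ (vCoord_le h₁.1.le), h,
    eval_Z7_eq_curvePoly hv₂ (vCoord_le h₂.1.le)] at e1
  have e2 : scale t₂ * x < beta (vCoord t₂) (yCoord t₂) := by
    rw [mul_comm]; exact (lt_div_iff₀ hU₂).1 (hx.2.trans_lt hc₂)
  unfold curvePoly at e1
  by_contra hne
  have : 0 < lead (vCoord t₂) (yCoord t₂) * ((beta (vCoord t₂) (yCoord t₂) - scale t₂ * x) *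
      cubicFactor (vCoord t₂) (yCoord t₂) (scale t₂ * x) ^ 2) :=
    mul_pos hl (mul_pos (sub_pos.2 e2) (by positivity))
  linarith

theorem one_lt_alphaRoot (ht : t ∈ Ioo leftEnd (-13)) : 1 < alphaRoot t := by
  have hv := one_lt_vCoord ht.2
  rw [alphaRoot, one_lt_div (scale_pos hv)]
  exact lt_alpha (yCoord_sq hv) hv (yCoord_pos hv) (cubic_neg ht) (scale_sq hv)

/-- The same argument at level -1, with the quadratic factor. It needs x > 1, where x²-1 is positive
and only the factor belonging to α decides the sign. -/
theorem alphaRoot_le {t₁ t₂ : ℝ} (h₁ : t₁ ∈ Ioo leftEnd (-13)) (h₂ : t₂ ∈ Ioo leftEnd (-13))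
    (h : Z7 t₁ = Z7 t₂) : alphaRoot t₂ ≤ alphaRoot t₁ := by
  by_contra! hlt
  have hv₁ := one_lt_vCoord h₁.2
  have hv₂ := one_lt_vCoord h₂.2
  have hU₁ := scale_pos hv₁
  have hU₂ := scale_pos hv₂
  have hl := lead_pos (yCoord_sq hv₂) hv₂ (yCoord_pos hv₂)
  have h1 := one_lt_alphaRoot h₁
  obtain ⟨c, hc₁, hc₂⟩ := exists_between hlt
  refine quadFactor_ne_zero_of_interval (v := vCoord t₂) (Y := yCoord t₂) hU₂ hc₁ fun x hx => ?_
  have hx1 : 1 < x := h1.trans_le hx.1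
  have e1 : -1 ≤ curvePoly (vCoord t₁) (yCoord t₁) (scale t₁ * x) := by
    refine neg_one_le_curvePoly (yCoord_sq hv₁) hv₁ (yCoord_pos hv₁) (mul_nonneg ?_ ?_)
    · rw [← scale_sq hv₁]; exact (sub_pos.2 (pow_lt_pow_left₀ (lt_mul_of_one_lt_right hU₁ hx1)
        hU₁.le two_ne_zero)).le
    · rw [sub_nonneg, mul_comm]; exact (div_le_iff₀ hU₁).1 hx.1
  rw [← eval_Z7_eq_curvePoly hv₁ (vCoord_le h₁.1.le), h,
    eval_Z7_eq_curvePoly hv₂ (vCoord_le h₂.1.le), curvePoly_eq (yCoord_sq hv₂) hv₂] at e1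
  have e2 : scale t₂ * x < alpha (vCoord t₂) (yCoord t₂) := by
    rw [mul_comm]; exact (lt_div_iff₀ hU₂).1 (hx.2.trans_lt hc₂)
  have e3 : 0 < (scale t₂ * x)^2 - rho (vCoord t₂) (yCoord t₂) := by
    rw [← scale_sq hv₂]; exact sub_pos.2 (pow_lt_pow_left₀ (lt_mul_of_one_lt_right hU₂ hx1) hU₂.le
        two_ne_zero)
  by_contra hne
  have : 0 < lead (vCoord t₂) (yCoord t₂) * (((scale t₂ * x)^2 - rho (vCoord t₂) (yCoord t₂)) *
      (alpha (vCoord t₂) (yCoord t₂) - scale t₂ * x) *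
      quadFactor (vCoord t₂) (yCoord t₂) (scale t₂ * x) ^ 2) :=
    mul_pos hl (mul_pos (mul_pos e3 (sub_pos.2 e2)) (by positivity))
  linarith

/-- The quadratic in k belonging to s₂ is positive at k₁ and increasing from there on, so its root
k₂ cannot lie beyond k₁. -/
theorem inverse_coord_antitone {s₁ s₂ k₁ k₂ : ℝ} (h₁ : k₁^2 = (s₁ - s₁^2) * k₁ + s₁)
    (h₂ : k₂^2 = (s₂ - s₂^2) * k₂ + s₂) (hs₂ : 0 < s₂) (hs : s₂ < s₁) (hs₁ : s₁ < 1)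
    (hk : s₁ < k₁) : k₂ ≤ k₁ := by
  by_contra! hlt
  have e1 : s₁ * (k₁^2 - (s₂ - s₂^2) * k₁ - s₂) = (s₁ - s₂) * k₁ * (k₁ - s₁ * s₂) := by
    linear_combination s₂ * h₁
  have h3 : s₁ * s₂ < s₁ := mul_lt_of_lt_one_right (by linarith) (by linarith)
  have e2 : 0 < s₁ * (k₁^2 - (s₂ - s₂^2) * k₁ - s₂) := by
    rw [e1]
    exact mul_pos (mul_pos (by linarith) (by linarith)) (by linarith)
  have e3 := pos_of_mul_pos_right e2 (by linarith)
  have e4 : 0 < (k₂ - k₁) * (k₁ + k₂ - (s₂ - s₂^2)) :=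
    mul_pos (by linarith) (by nlinarith)
  linarith

/-- In the coordinates s = 1/v and k = Y/v² the ratio becomes (1-s)³(1+s)/(s+k). As v grows, s
decreases and k does not increase, so the numerator grows and the denominator shrinks. -/
theorem ratio_strictMono {v₁ v₂ Y₁ Y₂ : ℝ} (h₁ : Y₁^2 = (v₁ - 1) * Y₁ + v₁^3)
    (h₂ : Y₂^2 = (v₂ - 1) * Y₂ + v₂^3) (hv₁ : 1 < v₁) (hv : v₁ < v₂) (hY₁ : 0 < Y₁) (hY₂ : 0 < Y₂) :
    (v₁^2 - 1) * (Y₁ - 2 * v₁ + 1) / v₁^3 < (v₂^2 - 1) * (Y₂ - 2 * v₂ + 1) / v₂^3 := by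
  have key : ∀ v Y : ℝ, Y^2 = (v - 1) * Y + v^3 → 1 < v → 0 < Y →
      (v^2 - 1) * (Y - 2 * v + 1) / v^3 = (1 - v⁻¹)^3 * (1 + v⁻¹) / (v⁻¹ + Y / v^2) ∧
      (Y / v^2)^2 = (v⁻¹ - v⁻¹^2) * (Y / v^2) + v⁻¹ := by
    intro v Y h hv hY
    have hv0 : 0 < v := by linarith
    constructor
    · have e : (1 - v⁻¹)^3 * (1 + v⁻¹) / (v⁻¹ + Y / v^2) =
          (v - 1)^3 * (v + 1) / (v^2 * (v + Y)) := by
        field_simp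
      rw [e, div_eq_div_iff (by positivity) (by positivity)]
      linear_combination (v^2 - 1) * v^2 * h
    · field_simp
      linear_combination h
  have hv₂ : 1 < v₂ := hv₁.trans hv
  have hv₀ : 0 < v₁ := by linarith
  have hw₀ : 0 < v₂ := by linarith
  obtain ⟨e₁, f₁⟩ := key v₁ Y₁ h₁ hv₁ hY₁
  obtain ⟨e₂, f₂⟩ := key v₂ Y₂ h₂ hv₂ hY₂
  have hs : v₂⁻¹ < v₁⁻¹ := inv_strictAnti₀ hv₀ hv
  have hs₁ : v₁⁻¹ < 1 := inv_lt_one_of_one_lt₀ hv₁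
  have hs₂ : 0 < v₂⁻¹ := by positivity
  have hk₁ : v₁⁻¹ < Y₁ / v₁^2 := by
    rw [lt_div_iff₀ (by positivity), show v₁⁻¹ * v₁^2 = v₁ by field_simp]
    linarith [two_mul_sub_one_lt h₁ hv₁ hY₁]
  have hk := inverse_coord_antitone f₁ f₂ hs₂ hs hs₁ hk₁
  have hk₂ : 0 < Y₂ / v₂^2 := by positivity
  rw [e₁, e₂]
  generalize v₁⁻¹ = s₁ at *
  generalize v₂⁻¹ = s₂ at *
  refine div_lt_div₀ ?_ (by linarith) ?_ (by linarith)
  · have h1 : (1 - s₁)^2 ≤ (1 - s₂)^2 := by nlinarith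
    have h2 : (1 - s₁) * (1 + s₁) < (1 - s₂) * (1 + s₂) := by nlinarith
    have h3 : 0 < (1 - s₁)^2 := pow_pos (by linarith) 2
    have h4 : 0 ≤ (1 - s₂) * (1 + s₂) := mul_nonneg (by linarith) (by linarith)
    linarith [mul_lt_mul_of_pos_left h2 h3, mul_le_mul_of_nonneg_right h1 h4]
  · exact mul_nonneg (pow_nonneg (by linarith) 3) (by linarith)

theorem injOn_Z7 : InjOn Z7 (Ioo leftEnd (-13)) := by
  intro t₁ h₁ t₂ h₂ h
  have hα := le_antisymm (alphaRoot_le h₂ h₁ h.symm) (alphaRoot_le h₁ h₂ h)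
  have hβ := le_antisymm (betaRoot_le h₂ h₁ h.symm) (betaRoot_le h₁ h₂ h)
  -- The scale cancels in this ratio, and the sum β + α reduces to 8v³.
  have key : ∀ t ∈ Ioo leftEnd (-13), (betaRoot t - alphaRoot t) / (betaRoot t + alphaRoot t) =
      (vCoord t ^ 2 - 1) * (yCoord t - 2 * vCoord t + 1) / vCoord t ^ 3 / 4 := by
    intro t ht
    have hv := one_lt_vCoord ht.2
    have hU := scale_pos hv
    have e : beta (vCoord t) (yCoord t) + alpha (vCoord t) (yCoord t) = 8 * vCoord t ^ 3 := by
      unfold alpha beta; ring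
    have e' : beta (vCoord t) (yCoord t) - alpha (vCoord t) (yCoord t) =
        2 * ((vCoord t ^ 2 - 1) * (yCoord t - 2 * vCoord t + 1)) := by
      unfold alpha beta; ring
    rw [betaRoot, alphaRoot, ← sub_div, ← add_div, div_div_div_cancel_right₀ hU.ne', e', e]
    have : 0 < vCoord t := by linarith
    field_simp
    ring
  have hr : (vCoord t₁ ^ 2 - 1) * (yCoord t₁ - 2 * vCoord t₁ + 1) / vCoord t₁ ^ 3 =
      (vCoord t₂ ^ 2 - 1) * (yCoord t₂ - 2 * vCoord t₂ + 1) / vCoord t₂ ^ 3 := by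
    have e1 := key t₁ h₁
    rw [hα, hβ, key t₂ h₂] at e1
    linarith
  have hv₁ := one_lt_vCoord h₁.2
  have hv₂ := one_lt_vCoord h₂.2
  have hvv : vCoord t₁ = vCoord t₂ := by
    rcases lt_trichotomy (vCoord t₁) (vCoord t₂) with h | h | h
    · exact absurd hr (ratio_strictMono (yCoord_sq hv₁) (yCoord_sq hv₂) hv₁ h (yCoord_pos hv₁)
        (yCoord_pos hv₂)).ne
    · exact h
    · exact absurd hr (ratio_strictMono (yCoord_sq hv₂) (yCoord_sq hv₁) hv₂ h (yCoord_pos hv₂)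
        (yCoord_pos hv₁)).ne'
  rw [eq_of_vCoord t₁, eq_of_vCoord t₂, hvv]

/-- The monic solution is determined by s alone, and dividing by its norm recovers the normalized
polynomial. Uniqueness of the extremal polynomial thus yields injectivity without any estimate of s
itself. -/
theorem injOn_s7 : InjOn s7 (Ioo leftEnd (-13)) := by
  intro t₁ h₁ t₂ h₂ h
  refine injOn_Z7 h₁ h₂ ?_
  have : monicZ7 t₁ = monicZ7 t₂ := by
    rw [← isMonicZolotarev_iff h₂, ← h, isMonicZolotarev_iff h₁]
  rw [← C_mul_monicZ7 h₁, this, C_mul_monicZ7 h₂]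

/-! # Continuity and limits -/

theorem continuous_ω : Continuous ω := by
  unfold ω
  fun_prop

/-- The real square root is continuous on the whole line, so no sign of a radicand is needed and
both ends of the parameter interval are covered. -/
theorem continuousAt_b (k : ℕ) {t : ℝ} (ht : 1 + t ≠ 0) : ContinuousAt (b k) t := by
  have hq : q t ≠ 0 := by unfold q; positivity
  have hqc : ContinuousAt q t := by unfold q; fun_prop
  have hω := continuous_ω.continuousAt (x := t)
  have h01 : ContinuousAt p01 t := by unfold p01; fun_prop
  have h02 : ContinuousAt p02 t := by unfold p02; fun_prop
  have h11 : ContinuousAt p11 t := by unfold p11; fun_prop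
  have h12 : ContinuousAt p12 t := by unfold p12; fun_prop
  have h21 : ContinuousAt p21 t := by unfold p21; fun_prop
  have h22 : ContinuousAt p22 t := by unfold p22; fun_prop
  have h31 : ContinuousAt p31 t := by unfold p31; fun_prop
  have h32 : ContinuousAt p32 t := by unfold p32; fun_prop
  have h41 : ContinuousAt p41 t := by unfold p41; fun_prop
  have h42 : ContinuousAt p42 t := by unfold p42; fun_prop
  have h51 : ContinuousAt p51 t := by unfold p51; fun_prop
  have h52 : ContinuousAt p52 t := by unfold p52; fun_prop
  have h61 : ContinuousAt p61 t := by unfold p61; fun_prop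
  have h62 : ContinuousAt p62 t := by unfold p62; fun_prop
  have h71 : ContinuousAt p71 t := by unfold p71; fun_prop
  have h72 : ContinuousAt p72 t := by unfold p72; fun_prop
  match k with
  | 0 => exact (h01.add (hω.mul h02)).div hqc hq
  | 1 => exact (h11.add (hω.mul h12)).sqrt.neg.div hqc hq
  | 2 => exact (h21.add (hω.mul h22)).div hqc hq
  | 3 => exact (h31.add (hω.mul h32)).sqrt.div hqc hq
  | 4 => exact (h41.add (hω.mul h42)).div hqc hq
  | 5 => exact (h51.add (hω.mul h52)).sqrt.neg.div hqc hq
  | 6 => exact (h61.add (hω.mul h62)).div hqc hq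
  | 7 => exact (h71.add (hω.mul h72)).sqrt.div hqc hq
  | _ + 8 => exact continuousAt_const

theorem continuousAt_eval_Z7 (x : ℝ) {t : ℝ} (ht : 1 + t ≠ 0) :
    ContinuousAt (fun t => (Z7 t).eval x) t := by
  simp only [eval_Z7]
  have h := fun k => continuousAt_b k ht
  have := h 0; have := h 1; have := h 2; have := h 3
  have := h 4; have := h 5; have := h 6; have := h 7
  fun_prop

theorem continuousAt_s7 {t : ℝ} (ht : t < -13) : ContinuousAt s7 t := by
  have h1 : 1 + t ≠ 0 := by linarith
  exact (((continuousAt_b 6 h1).div (continuousAt_b 7 h1)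
    (b_seven_pos (one_lt_vCoord ht)).ne').neg).div_const 7

theorem ω_neg_thirteen : ω (-13) = 72 := by
  rw [ω, Real.sqrt_eq_iff_mul_self_eq] <;> norm_num

theorem b_six_neg_thirteen : b 6 (-13) = -32 := by
  rw [b, ω_neg_thirteen]
  unfold p61 p62 q
  norm_num

theorem b_seven_neg_thirteen : b 7 (-13) = 0 := by
  have h : p71 (-13) + ω (-13) * p72 (-13) = 0 := by
    unfold p71 p72
    norm_num
  rw [b, h]
  simp

theorem eval_Z7_neg_thirteen (x : ℝ) :
    (Z7 (-13)).eval x = 1 - 18 * x ^ 2 + 48 * x ^ 4 - 32 * x ^ 6 := by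
  have h0 : b 0 (-13) = 1 := by
    rw [b, ω_neg_thirteen]; unfold p01 p02 q; norm_num
  have h2 : b 2 (-13) = -18 := by
    rw [b, ω_neg_thirteen]; unfold p21 p22 q; norm_num
  have h4 : b 4 (-13) = 48 := by
    rw [b, ω_neg_thirteen]; unfold p41 p42 q; norm_num
  have h1 : b 1 (-13) = 0 := by
    have h : p11 (-13) + ω (-13) * p12 (-13) = 0 := by unfold p11 p12; norm_num
    rw [b, h]; simp
  have h3 : b 3 (-13) = 0 := by
    have h : p31 (-13) + ω (-13) * p32 (-13) = 0 := by unfold p31 p32; norm_num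
    rw [b, h]; simp
  have h5 : b 5 (-13) = 0 := by
    have h : p51 (-13) + ω (-13) * p52 (-13) = 0 := by unfold p51 p52; norm_num
    rw [b, h]; simp
  rw [eval_Z7, h0, h1, h2, h3, h4, h5, b_six_neg_thirteen, b_seven_neg_thirteen]
  ring

/-! ### The range of s, and the final statement -/

/-- s is -b₆/7 divided by b₇, where the numerator tends to 32/7 and b₇ tends to 0 through positive
values. -/
theorem tendsto_s7_atTop : Tendsto s7 (𝓝[<] (-13)) atTop := by
  have h1 : (1 : ℝ) + (-13) ≠ 0 := by norm_num
  have h6 : Tendsto (fun t => -b 6 t / 7) (𝓝[<] (-13)) (𝓝 (32 / 7)) := by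
    have := (((continuousAt_b 6 h1).neg.div_const 7).tendsto).mono_left
      (nhdsWithin_le_nhds (s := Iio (-13)))
    simpa [b_six_neg_thirteen] using this
  have h7 : Tendsto (b 7) (𝓝[<] (-13)) (𝓝[>] 0) := by
    refine tendsto_nhdsWithin_iff.2 ⟨?_, ?_⟩
    · have := (continuousAt_b 7 h1).tendsto.mono_left (nhdsWithin_le_nhds (s := Iio (-13)))
      rwa [b_seven_neg_thirteen] at this
    · filter_upwards [self_mem_nhdsWithin] with t ht
      exact b_seven_pos (one_lt_vCoord ht)
  refine (h6.pos_mul_atTop (by norm_num) (tendsto_inv_nhdsGT_zero.comp h7)).congr fun t => ?_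
  simp only [s7, a, Function.comp]
  ring

theorem leftEnd_lt : leftEnd < -13 := leftEnd_rough.2.trans (by norm_num)

theorem tendsto_s7_leftEnd :
    Tendsto s7 (𝓝[>] leftEnd) (𝓝 (Real.tan (Real.pi / 14) ^ 2)) := by
  rw [← s7_leftEnd]
  exact (continuousAt_s7 leftEnd_lt).tendsto.mono_left nhdsWithin_le_nhds

theorem strictMonoOn_s7 : StrictMonoOn s7 (Ioo leftEnd (-13)) := by
  have hc : ContinuousOn s7 (Ioo leftEnd (-13)) :=
    fun t ht => (continuousAt_s7 ht.2).continuousWithinAt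
  -- Continuity and injectivity leave only the two monotone cases; a decreasing s could not tend to
  -- infinity at the right end.
  refine (hc.strictMonoOn_of_injOn_Ioo leftEnd_lt injOn_s7).resolve_right fun hanti => ?_
  obtain ⟨m, hm⟩ := exists_between leftEnd_lt
  obtain ⟨t, ht1, ht2⟩ := ((tendsto_s7_atTop.eventually_gt_atTop (s7 m)).and
    (Ioo_mem_nhdsLT hm.2)).exists
  exact lt_asymm ht1 (hanti hm ⟨hm.1.trans ht2.1, ht2.2⟩ ht2.1)

theorem tan_sq_lt_s7 {t : ℝ} (ht : t ∈ Ioo leftEnd (-13)) :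
    Real.tan (Real.pi / 14) ^ 2 < s7 t := by
  -- An intermediate parameter makes the inequality strict: the limit at θ is at most s(m), and s(m)
  -- < s(t).
  obtain ⟨m, hm⟩ := exists_between ht.1
  have hm' : m ∈ Ioo leftEnd (-13) := ⟨hm.1, hm.2.trans ht.2⟩
  refine lt_of_le_of_lt ?_ (strictMonoOn_s7 hm' ht hm.2)
  refine le_of_tendsto tendsto_s7_leftEnd ?_
  filter_upwards [Ioo_mem_nhdsGT hm.1] with r hr
  exact (strictMonoOn_s7 ⟨hr.1, hr.2.trans hm'.2⟩ hm' hr.2).le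

theorem bijOn_s7 : BijOn s7 (Ioo leftEnd (-13)) (Ioi (Real.tan (Real.pi / 14) ^ 2)) := by
  refine ⟨fun t ht => tan_sq_lt_s7 ht, injOn_s7, fun y hy => ?_⟩
  have hc : ContinuousOn s7 (Ioo leftEnd (-13)) :=
    fun t ht => (continuousAt_s7 ht.2).continuousWithinAt
  obtain ⟨r, hr1, hr2⟩ := ((tendsto_s7_leftEnd.eventually (gt_mem_nhds hy)).and
    (Ioo_mem_nhdsGT leftEnd_lt)).exists
  obtain ⟨t, ht1, ht2⟩ := ((tendsto_s7_atTop.eventually_gt_atTop y).and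
    (Ioo_mem_nhdsLT leftEnd_lt)).exists
  exact isPreconnected_Ioo.intermediate_value hr2 ht2 hc ⟨hr1.le, ht1.le⟩

theorem properBound_lt {t : ℝ} (ht : t ∈ Ioo leftEnd (-13)) : properBound 7 < s7 t := by
  have h : Real.pi / (2 * ((7 : ℕ) : ℝ)) = Real.pi / 14 := by norm_num
  rw [properBound, h]
  exact tan_sq_lt_s7 ht

theorem isMonicProperZolotarev_iff {t : ℝ} (ht : t ∈ Ioo leftEnd (-13)) (P : ℝ[X]) :
    IsMonicProperZolotarev 7 (s7 t) P ↔ P = monicZ7 t := by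
  rw [IsMonicProperZolotarev, isMonicZolotarev_iff ht, and_iff_right (properBound_lt ht)]

theorem isNormalizedProperZolotarev_iff {t : ℝ} (ht : t ∈ Ioo leftEnd (-13)) (Z : ℝ[X]) :
    IsNormalizedProperZolotarev 7 (s7 t) Z ↔ Z = Z7 t := by
  simp only [IsNormalizedProperZolotarev, isMonicProperZolotarev_iff ht, exists_eq_left,
    C_mul_monicZ7 ht]

end SepticZolotarev

end

theorem theorem1 :
    ∃ θ : ℝ, IsLeast {x : ℝ | x ^ 3 + 27 * x ^ 2 - 93 * x - 1847 = 0} θ ∧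
      θ ∈ Ioo (-27.963756 : ℝ) (-27.963755) ∧
      -- the radicands are nonnegative and the denominators are nonzero
      (∀ t ∈ Ioo θ (-13),
        0 ≤ 3 * (506 + 75 * t - t ^ 3) ∧ 0 < SepticZolotarev.q t ∧
        0 ≤ SepticZolotarev.p11 t + SepticZolotarev.ω t * SepticZolotarev.p12 t ∧
        0 ≤ SepticZolotarev.p31 t + SepticZolotarev.ω t * SepticZolotarev.p32 t ∧
        0 ≤ SepticZolotarev.p51 t + SepticZolotarev.ω t * SepticZolotarev.p52 t ∧
        0 ≤ SepticZolotarev.p71 t + SepticZolotarev.ω t * SepticZolotarev.p72 t ∧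
        0 < SepticZolotarev.b 7 t) ∧
      -- `Z7 t` is the normalized, and `monicZ7 t` the monic, proper Zolotarev polynomial
      -- for the parameter `s7 t`
      (∀ t ∈ Ioo θ (-13),
        SepticZolotarev.uniformNorm (SepticZolotarev.Z7 t) = 1 ∧
        (∀ Z : ℝ[X], SepticZolotarev.IsNormalizedProperZolotarev 7 (SepticZolotarev.s7 t) Z ↔
          Z = SepticZolotarev.Z7 t) ∧
        (∀ P : ℝ[X], SepticZolotarev.IsMonicProperZolotarev 7 (SepticZolotarev.s7 t) P ↔
          P = SepticZolotarev.monicZ7 t)) ∧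
      -- every proper value of `s` is attained for exactly one `t`
      BijOn SepticZolotarev.s7 (Ioo θ (-13)) (Ioi (Real.tan (Real.pi / 14) ^ 2)) ∧
      -- the limits at the two ends of the parameter interval
      (∀ x : ℝ,
        Tendsto (fun t => (SepticZolotarev.Z7 t).eval x) (𝓝[<] (-13))
          (𝓝 (-(Chebyshev.T ℝ 6).eval x)) ∧
        -(Chebyshev.T ℝ 6).eval x = 1 - 18 * x ^ 2 + 48 * x ^ 4 - 32 * x ^ 6) ∧
      (∀ x y : ℝ, y = (1 + x) * Real.cos (Real.pi / 14) ^ 2 - 1 →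
        Tendsto (fun t => (SepticZolotarev.Z7 t).eval x) (𝓝[>] θ)
          (𝓝 ((Chebyshev.T ℝ 7).eval y)) ∧
        (Chebyshev.T ℝ 7).eval y = -7 * y + 56 * y ^ 3 - 112 * y ^ 5 + 64 * y ^ 7) := by
  open SepticZolotarev in
  refine ⟨leftEnd, isLeast_leftEnd, leftEnd_mem, fun t ht => ?_, fun t ht => ?_, bijOn_s7,
    fun x => ⟨?_, ?_⟩, fun x y hy => ⟨?_, ?_⟩⟩
  · have hv := one_lt_vCoord ht.2
    have hv' := vCoord_le ht.1.le
    exact ⟨(radicand_ω_pos hv).le, q_pos hv, (p1_radicand hv hv').1, (p3_radicand hv hv').1,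
      (p5_radicand hv hv').1, (p7_radicand hv).1, b_seven_pos hv⟩
  · exact ⟨uniformNorm_Z7 ht, isNormalizedProperZolotarev_iff ht, isMonicProperZolotarev_iff ht⟩
  · have := ((continuousAt_eval_Z7 x (t := -13) (by norm_num)).tendsto).mono_left
      (nhdsWithin_le_nhds (s := Iio (-13)))
    rw [eval_Z7_neg_thirteen] at this
    convert this using 2
    rw [eval_T_six]
    ring
  · rw [eval_T_six]
    ring
  · have h1 : 1 + leftEnd ≠ 0 := by linarith [leftEnd_rough.2]
    have := (continuousAt_eval_Z7 x h1).tendsto.mono_left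
      (nhdsWithin_le_nhds (s := Ioi leftEnd))
    rwa [eval_Z7_leftEnd, ← hy] at this
  · exact eval_T_seven y
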